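/- **Setting.** Let $\mathcal D$ and $\mathcal E$ be complex pre-Hilbert spaces which are Fréchet spaces for increasing sequences of Hilbertian norms $\|\cdot\|_p$ on $\mathcal D$ and $\|\cdot\|(\xi)$ on $\mathcal E$ that dominate the pre-Hilbert norms ($p,\xi\in\mathbb N$). Let $\mathfrak E=L^2_{\mathcal E}(\mathbb R_+)$ be the space of strongly measurable $f:\mathbb R_+\to\mathcal E$ with $\int\|f(s)\|^2(\xi)\,ds<\infty$ for all $\xi$, and $f_t=f1_{[0,t)}$, $f_{[t}=f1_{[t,\infty)}$. Let $\mathfrak F$ be the Fréchet space generated by the coherent vectors $f^\otimes$, $f\in\mathfrak E$, in the Fock norms given by $\langle f'^\otimes|f^\otimes\rangle(\xi)=\exp\int\langle f'(s)|f(s)\rangle(\xi)\,ds$, let $\delta_\emptyset=0^\otimes$ be the vacuum, and let $\mathfrak D=\mathcal D\otimes\mathfrak F$ be the projective tensor product. $\mathcal B(\mathcal D)$ and $\mathcal B(\mathfrak D)$ are the spaces of continuous sesquilinear forms, with the usual order. The form $I$ is the pre-Hilbert inner product. Let $\mathcal A$ be a $*$-algebra of continuous operators on $\mathcal D$, with commutant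 $\mathcal A^c=\{B\in\mathcal B(\mathcal D):\langle\eta'|BA\eta\rangle=\langle A^\dagger\eta'|B\eta\rangle\ \forall A\in\mathcal A\}$. Let $\mathfrak a$ be a $\star$-subalgebra of the Hudson–Parthasarathy algebra of quadruples $a=(a^\bullet_\bullet,a^\bullet_+,a^-_\bullet,a^-_+)$, where $a^\bullet_\bullet$ is a continuous operator on $\mathcal E$ with a continuous adjoint, $a^\bullet_+\in\mathcal E$, $a^-_\bullet=\langle k|\cdot\rangle$ with $k\in\mathcal E$, and $a^-_+\in\mathbb C$; the product is $(ab)^\mu_\nu=a^\mu_\bullet b^\bullet_\nu$, and $a^\star$ has the components $(a^\bullet_\bullet)^\dagger,\ k,\ \langle a^\bullet_+|\cdot\rangle,\ \overline{a^-_+}$. Let $\mathfrak g_t$ be the set of step functions $g:\mathbb R_+\to\mathfrak a$ with $g(s)=0$ for $s\ge t$, and let $(g\star h)(s)=h(s)+g(s)^\star h(s)+g(s)^\star$. For $g\in\mathfrak g_t$ the exponential operator $W_t(g)$ is given by $$W_t(g)(\eta\otimes f^\otimes)=\exp\Big[\int_0^t\big(g^-_\bullet f+g^-_+\big)(s)\,ds\Big]\;\eta\otimes\big(f+g^\bullet_\bullet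 f+g^\bullet_+\big)^\otimes ,$$ and $W(t,a)=W_t(a1_{[0,t)})$. Let $\mathfrak B$ be the set of all $Y\in\mathcal B(\mathfrak D)$ which commute with $A\otimes I$ for all $A\in\mathcal A$ and with $W(t,a)$ for all $t>0$, $a\in\mathfrak a$ (in the sense $\langle\psi'|YX\psi\rangle=\langle X^\dagger\psi'|Y\psi\rangle$ on the span of the vectors $\eta\otimes f^\otimes$, with $W(t,a)^\dagger=W(t,a^\star)$). The vacuum conditional expectation is $$\langle\eta'\otimes f'^\otimes|\epsilon_t(Z)(\eta\otimes f^\otimes)\rangle=\langle\eta'\otimes f'^\otimes_t|Z(\eta\otimes f^\otimes_t)\rangle\exp\int_t^\infty\langle f'(s)|f(s)\rangle ds ,$$ and $\mathfrak B_t=\{Y\in\mathfrak B:\epsilon_t(Y)=Y\}$ is the set of adapted forms in $\mathfrak B$. A family $(R_t)_{t\ge0}$ of positive forms $R_t\in\mathfrak B_t$ is a positive martingale (submartingale) if $\epsilon_t(R_s)=R_t$ ($\epsilon_t(R_s)\le R_t$) for all $s\ge t\ge0$. Its generating function is $\vartheta_t(g)=\epsilon[R_tW_t(g)]$, $g\in\mathfrak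 g_t$, that is $$\langle\eta'|\vartheta_t(g)\eta\rangle=\langle\eta'\otimes\delta_\emptyset|R_tW_t(g)(\eta\otimes\delta_\emptyset)\rangle .$$ A function $\theta$ from $\mathfrak g_t$ to sesquilinear forms on $\mathcal D$ is called positive definite, $\theta\ge0$, if $\sum_{k,l}\langle\eta_k|\theta(g_k\star g_l)\eta_l\rangle\ge0$ for all finite families $g_k\in\mathfrak g_t$, $\eta_k\in\mathcal D$. It is called absolutely continuous if $$\lim_{n\to\infty}\sum_{g\in\mathfrak g_t}\eta^g_n\otimes W_t(g)\delta_\emptyset=0\ \text{ in }\mathfrak D\quad\Longrightarrow\quad\lim_{n\to\infty}\sum_{g,h\in\mathfrak g_t}\langle\eta^g_n|\theta(g\star h)\eta^h_n\rangle=0$$ for all $\eta^g_n\in\mathcal D$ such that, for each $n$, $\eta^g_n=0$ for all but finitely many $g$. Here $W_t(g)\delta_\emptyset=e^{\int_0^t g^-_+(s)ds}\,(g^\bullet_+)^\otimes$. **Theorem.** 1. Let $(R_t)$ be a positive submartingale with $R_t\in\mathfrak B_t$. Then $\vartheta_t(g)\in\mathcal A^c$ for all $g\in\mathfrak g_t$,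 $\vartheta_t$ is positive definite and absolutely continuous on $\mathfrak g_t$ for every $t$, and $\vartheta_t-\vartheta_s|\mathfrak g_t\ge0$ for $s\ge t$. If $R_0=I$, then $\vartheta_0(0)=I\ge\vartheta_t(0)$ for all $t$. 2. If $(R_t)$ is a positive martingale, then moreover $\vartheta_t=\vartheta_s|\mathfrak g_t$ for $s\ge t$, and, if $R_0=I$, $\vartheta_t(0)=I$ for all $t$. 3. Suppose that the closure $K$ of $\{a^\bullet_+:a\in\mathfrak a\}$ in $\mathcal E$ is an orthogonal direct summand, with projection $P$ onto $K$ such that for each $\zeta$ there is $\xi$ with $\|Pe\|^2(\zeta)+\|e-Pe\|^2\le\|e\|^2(\xi)$ for all $e\in\mathcal E$ (for instance, $\{a^\bullet_+\}$ is dense in $\mathcal E$, or $\mathcal E$ is a Hilbert space with the norms $\|e\|(\xi)=\sqrt{\xi+1}\,\|e\|$). Let $\vartheta_t:\mathfrak g_t\to\mathcal A^c$, $t\ge0$, be positive definite functions with $\vartheta_0(0)=I$ and $\vartheta_t-\vartheta_s|\mathfrak g_t\ge0$ (respectively $\vartheta_t=\vartheta_s|\mathfrak g_t$) for all $s\ge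 t$. Then there is a positive submartingale (respectively martingale) $R_t\in\mathfrak B_t$ with $R_0=I$ and $\vartheta_t(g)=\epsilon[R_tW_t(g)]$ for all $t\ge 0$, $g\in\mathfrak g_t$, if and only if $\vartheta_t$ is absolutely continuous for every $t$. -/

import Mathlib

open MeasureTheory Filter Topology
open scoped NNReal ComplexOrder

set_option linter.unusedSectionVars false

noncomputable section

namespace QFlow

/-! ### Fréchet spaces with a scale of Hilbertian norms -/

/-- The Hilbertian norm `‖x‖ = √⟨x|x⟩` of a (positive definite) inner product, as a seminorm. -/
def coreSeminorm {E : Type*} [AddCommGroup E] [Module ℂ E] (c : InnerProductSpace.Core ℂ E) :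
    Seminorm ℂ E :=
  @normSeminorm ℂ E _ c.toNormedAddCommGroup.toSeminormedAddCommGroup
    (@InnerProductSpace.Core.toNormedSpace ℂ E _ _ _ c.toCore)

/-- A complex pre-Hilbert space whose topology is given by an increasing sequence of Hilbertian
norms dominating the pre-Hilbert norm. It is a Fréchet space when it is complete. Inner products
are antilinear in the first argument. -/
class HilbertScale (E : Type*) [AddCommGroup E] [Module ℂ E] [UniformSpace E] where
  /-- the inner product of the pre-Hilbert space -/
  core : InnerProductSpace.Core ℂ E
  /-- the inner product defining the norm number `ξ` of the scale -/
  level : ℕ → InnerProductSpace.Core ℂ E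
  core_le : ∀ ξ x, coreSeminorm core x ≤ coreSeminorm (level ξ) x
  level_mono : ∀ ξ x, coreSeminorm (level ξ) x ≤ coreSeminorm (level (ξ + 1)) x
  withSeminorms : WithSeminorms (fun ξ => coreSeminorm (level ξ))

section Spaces

variable {E : Type*} [AddCommGroup E] [Module ℂ E] [UniformSpace E] [HilbertScale E]

/-- The inner product `⟨x|y⟩` of the pre-Hilbert space. -/
def ip (x y : E) : ℂ := (HilbertScale.core (E := E)).inner x y

/-- The inner product `⟨x|y⟩(ξ)` of the norm number `ξ`. -/
def ipL (ξ : ℕ) (x y : E) : ℂ := (HilbertScale.level (E := E) ξ).inner x y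

/-- The pre-Hilbert norm `‖x‖`. -/
def nrm (x : E) : ℝ := coreSeminorm (HilbertScale.core (E := E)) x

/-- The norm `‖x‖(ξ)` of the scale. -/
def nrmL (ξ : ℕ) (x : E) : ℝ := coreSeminorm (HilbertScale.level (E := E) ξ) x

theorem core_add_right (c : InnerProductSpace.Core ℂ E) (x y z : E) :
    c.inner x (y + z) = c.inner x y + c.inner x z := by
  rw [← c.conj_inner_symm x (y + z), c.add_left, map_add, c.conj_inner_symm, c.conj_inner_symm]

theorem core_smul_right (c : InnerProductSpace.Core ℂ E) (x y : E) (r : ℂ) :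
    c.inner x (r • y) = r * c.inner x y := by
  rw [← c.conj_inner_symm x (r • y), c.smul_left, map_mul, c.conj_inner_symm, Complex.conj_conj]

/-- The inner product of the pre-Hilbert space as a sesquilinear form. -/
def ipForm (E : Type*) [AddCommGroup E] [Module ℂ E] [UniformSpace E] [HilbertScale E] :
    E →ₗ⋆[ℂ] E →ₗ[ℂ] ℂ :=
  LinearMap.mk₂'ₛₗ (starRingEnd ℂ) (RingHom.id ℂ) ip
    (fun _ _ _ => (HilbertScale.core (E := E)).add_left _ _ _)
    (fun _ _ _ => (HilbertScale.core (E := E)).smul_left _ _ _)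
    (fun _ _ _ => core_add_right _ _ _ _)
    (fun _ _ _ => core_smul_right _ _ _ _)

theorem ipForm_apply (x y : E) : ipForm E x y = ip x y := rfl

theorem ip_zero_left (x : E) : ip 0 x = 0 := by
  rw [← ipForm_apply, map_zero, LinearMap.zero_apply]

theorem ip_conj (x y : E) : (starRingEnd ℂ) (ip x y) = ip y x :=
  (HilbertScale.core (E := E)).conj_inner_symm y x

theorem nrmL_add_le (ξ : ℕ) (x y : E) : nrmL ξ (x + y) ≤ nrmL ξ x + nrmL ξ y :=
  map_add_le_add _ x y

theorem nrmL_nonneg (ξ : ℕ) (x : E) : 0 ≤ nrmL ξ x := apply_nonneg _ x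

theorem nrmL_zero (ξ : ℕ) : nrmL ξ (0 : E) = 0 := map_zero _

theorem nrmL_continuous (ξ : ℕ) : Continuous (nrmL ξ : E → ℝ) :=
  (HilbertScale.withSeminorms (E := E)).continuous_seminorm ξ

/-- A continuous operator is bounded from some norm of the scale to any given one. -/
theorem exists_bound [IsUniformAddGroup E] (T : E →L[ℂ] E) (ξ : ℕ) :
    ∃ (ζ : ℕ) (C : ℝ), 0 ≤ C ∧ ∀ x, nrmL ξ (T x) ≤ C * nrmL ζ x := by
  have hW := HilbertScale.withSeminorms (E := E)
  have hmono : Monotone (fun ξ => coreSeminorm (HilbertScale.level (E := E) ξ)) :=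
    monotone_nat_of_le_succ fun n x => HilbertScale.level_mono n x
  have hcont : Continuous ((coreSeminorm (HilbertScale.level (E := E) ξ)).comp
      (T : E →ₗ[ℂ] E)) := (hW.continuous_seminorm ξ).comp T.continuous
  obtain ⟨s, C, -, h⟩ := Seminorm.bound_of_continuous hW _ hcont
  refine ⟨s.sup id, C, C.2, fun x => (h x).trans ?_⟩
  refine mul_le_mul_of_nonneg_left ?_ C.2
  exact (Finset.sup_le fun i hi => hmono (Finset.le_sup (f := id) hi) :
    s.sup (fun ξ => coreSeminorm (HilbertScale.level (E := E) ξ)) ≤ _) x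

end Spaces

/-! ### The Hudson–Parthasarathy algebra -/

/-- The Hudson–Parthasarathy `⋆`-algebra of the quadruples `a = (aᵘᵥ)` over `E`:
`gauge = a^•_•` is a continuous operator with the continuous adjoint `gaugeAdj`,
`crea = a^•_+ ∈ E`, `a^-_• = ⟨anni| ∈ E'` with `anni ∈ E`, and `time = a^-_+ ∈ ℂ`. -/
@[ext]
structure HPAlg (E : Type*) [AddCommGroup E] [Module ℂ E] [UniformSpace E]
    [HilbertScale E] where
  gauge : E →L[ℂ] E
  gaugeAdj : E →L[ℂ] E
  crea : E
  anni : E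
  time : ℂ
  adjoint : ∀ x y, ip (gaugeAdj x) y = ip x (gauge y)

namespace HPAlg

variable {E : Type*} [AddCommGroup E] [Module ℂ E] [UniformSpace E] [IsUniformAddGroup E]
  [ContinuousSMul ℂ E] [HilbertScale E]

theorem ip_add_left (x y z : E) : ip (x + y) z = ip x z + ip y z := by
  simp [← ipForm_apply]

theorem ip_add_right (x y z : E) : ip x (y + z) = ip x y + ip x z := by
  simp [← ipForm_apply]

theorem ip_smul_left (r : ℂ) (x y : E) : ip (r • x) y = (starRingEnd ℂ) r * ip x y := by
  simp [← ipForm_apply]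

theorem ip_smul_right (r : ℂ) (x y : E) : ip x (r • y) = r * ip x y := by
  simp [← ipForm_apply]

theorem ip_zero_right (x : E) : ip x (0 : E) = 0 := by
  simp [← ipForm_apply]

theorem ip_neg_left (x y : E) : ip (-x) y = -ip x y := by
  simp [← ipForm_apply]

theorem ip_neg_right (x y : E) : ip x (-y) = -ip x y := by
  simp [← ipForm_apply]

instance : Zero (HPAlg E) := ⟨⟨0, 0, 0, 0, 0, fun x y => by simp [ip_zero_left, ip_zero_right]⟩⟩

instance : Add (HPAlg E) := ⟨fun a b => ⟨a.gauge + b.gauge, a.gaugeAdj + b.gaugeAdj,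
  a.crea + b.crea, a.anni + b.anni, a.time + b.time,
  fun x y => by simp [ip_add_left, ip_add_right, a.adjoint, b.adjoint]⟩⟩

instance : Neg (HPAlg E) := ⟨fun a => ⟨-a.gauge, -a.gaugeAdj, -a.crea, -a.anni, -a.time,
  fun x y => by simp [ip_neg_left, ip_neg_right, a.adjoint]⟩⟩

instance : SMul ℂ (HPAlg E) := ⟨fun c a => ⟨c • a.gauge, (starRingEnd ℂ) c • a.gaugeAdj,
  c • a.crea, (starRingEnd ℂ) c • a.anni, c * a.time,
  fun x y => by simp [ip_smul_left, ip_smul_right, a.adjoint]⟩⟩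

/-- The Hudson–Parthasarathy product `(ab)ᵘᵥ = aᵘ_• b^•_ᵥ`. -/
instance : Mul (HPAlg E) := ⟨fun a b => ⟨a.gauge ∘L b.gauge, b.gaugeAdj ∘L a.gaugeAdj,
  a.gauge b.crea, b.gaugeAdj a.anni, ip a.anni b.crea,
  fun x y => by simp [a.adjoint, b.adjoint]⟩⟩

/-- The involution `a^⋆`. -/
instance : Star (HPAlg E) := ⟨fun a => ⟨a.gaugeAdj, a.gauge, a.anni, a.crea,
  (starRingEnd ℂ) a.time, fun x y => by
    rw [← ip_conj y (a.gauge x), ← a.adjoint, ip_conj]⟩⟩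

@[simp] theorem zero_gauge : (0 : HPAlg E).gauge = 0 := rfl
@[simp] theorem zero_gaugeAdj : (0 : HPAlg E).gaugeAdj = 0 := rfl
@[simp] theorem zero_crea : (0 : HPAlg E).crea = 0 := rfl
@[simp] theorem zero_anni : (0 : HPAlg E).anni = 0 := rfl
@[simp] theorem zero_time : (0 : HPAlg E).time = 0 := rfl
@[simp] theorem add_gauge (a b : HPAlg E) : (a + b).gauge = a.gauge + b.gauge := rfl
@[simp] theorem add_gaugeAdj (a b : HPAlg E) : (a + b).gaugeAdj = a.gaugeAdj + b.gaugeAdj := rfl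
@[simp] theorem add_crea (a b : HPAlg E) : (a + b).crea = a.crea + b.crea := rfl
@[simp] theorem add_anni (a b : HPAlg E) : (a + b).anni = a.anni + b.anni := rfl
@[simp] theorem add_time (a b : HPAlg E) : (a + b).time = a.time + b.time := rfl
@[simp] theorem neg_gauge (a : HPAlg E) : (-a).gauge = -a.gauge := rfl
@[simp] theorem neg_gaugeAdj (a : HPAlg E) : (-a).gaugeAdj = -a.gaugeAdj := rfl
@[simp] theorem neg_crea (a : HPAlg E) : (-a).crea = -a.crea := rfl
@[simp] theorem neg_anni (a : HPAlg E) : (-a).anni = -a.anni := rfl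
@[simp] theorem neg_time (a : HPAlg E) : (-a).time = -a.time := rfl
@[simp] theorem smul_gauge (c : ℂ) (a : HPAlg E) : (c • a).gauge = c • a.gauge := rfl
@[simp] theorem smul_gaugeAdj (c : ℂ) (a : HPAlg E) :
    (c • a).gaugeAdj = (starRingEnd ℂ) c • a.gaugeAdj := rfl
@[simp] theorem smul_crea (c : ℂ) (a : HPAlg E) : (c • a).crea = c • a.crea := rfl
@[simp] theorem smul_anni (c : ℂ) (a : HPAlg E) :
    (c • a).anni = (starRingEnd ℂ) c • a.anni := rfl
@[simp] theorem smul_time (c : ℂ) (a : HPAlg E) : (c • a).time = c * a.time := rfl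
@[simp] theorem mul_gauge (a b : HPAlg E) : (a * b).gauge = a.gauge ∘L b.gauge := rfl
@[simp] theorem mul_gaugeAdj (a b : HPAlg E) :
    (a * b).gaugeAdj = b.gaugeAdj ∘L a.gaugeAdj := rfl
@[simp] theorem mul_crea (a b : HPAlg E) : (a * b).crea = a.gauge b.crea := rfl
@[simp] theorem mul_anni (a b : HPAlg E) : (a * b).anni = b.gaugeAdj a.anni := rfl
@[simp] theorem mul_time (a b : HPAlg E) : (a * b).time = ip a.anni b.crea := rfl
@[simp] theorem star_gauge (a : HPAlg E) : (star a).gauge = a.gaugeAdj := rfl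
@[simp] theorem star_gaugeAdj (a : HPAlg E) : (star a).gaugeAdj = a.gauge := rfl
@[simp] theorem star_crea (a : HPAlg E) : (star a).crea = a.anni := rfl
@[simp] theorem star_anni (a : HPAlg E) : (star a).anni = a.crea := rfl
@[simp] theorem star_time (a : HPAlg E) : (star a).time = (starRingEnd ℂ) a.time := rfl

instance : AddCommGroup (HPAlg E) where
  add_assoc a b c := by ext <;> simp [add_assoc]
  zero_add a := by ext <;> simp
  add_zero a := by ext <;> simp
  nsmul := nsmulRec
  zsmul := zsmulRec
  neg_add_cancel a := by ext <;> simp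
  add_comm a b := by ext <;> simp [add_comm]

instance : Module ℂ (HPAlg E) where
  one_smul a := by ext <;> simp
  mul_smul c d a := by ext <;> simp [mul_smul, mul_assoc]
  smul_zero c := by ext <;> simp
  smul_add c a b := by ext <;> simp [mul_add]
  add_smul c d a := by ext <;> simp [add_smul, add_mul]
  zero_smul a := by ext <;> simp

instance : NonUnitalRing (HPAlg E) where
  left_distrib a b c := by ext <;> simp [ip_add_right]
  right_distrib a b c := by ext <;> simp [ip_add_left]
  zero_mul a := by ext <;> simp [ip_zero_left]
  mul_zero a := by ext <;> simp [ip_zero_right]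
  mul_assoc a b c := by ext <;> simp [b.adjoint]

instance : StarRing (HPAlg E) where
  star_involutive a := by ext <;> simp
  star_mul a b := by ext <;> simp [ip_conj]
  star_add a b := by ext <;> simp

end HPAlg

section Noise

variable {E : Type*} [AddCommGroup E] [Module ℂ E] [UniformSpace E] [IsUniformAddGroup E]
  [ContinuousSMul ℂ E] [HilbertScale E]

/-! ### Square-integrable functions on the half-line -/

/-- Lebesgue measure on `ℝ₊ = [0, ∞)`. -/
def timeMeasure : Measure ℝ≥0 := Measure.comap ((↑) : ℝ≥0 → ℝ) volume

theorem timeMeasure_Iio_lt_top (t : ℝ≥0) : timeMeasure (Set.Iio t) < ⊤ := by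
  have hemb : MeasurableEmbedding ((↑) : ℝ≥0 → ℝ) :=
    MeasurableEmbedding.subtype_coe measurableSet_Ici
  rw [timeMeasure, hemb.comap_apply]
  refine (measure_mono (t := Set.Icc (0 : ℝ) t) ?_).trans_lt (by simp)
  rintro _ ⟨s, hs, rfl⟩
  exact ⟨s.2, by exact_mod_cast (le_of_lt hs : s ≤ t)⟩

/-- `f : ℝ₊ → E` is strongly measurable for the topology of `E` and square-integrable for every
norm of the scale. -/
structure IsNoise (f : ℝ≥0 → E) : Prop where
  aesm : AEStronglyMeasurable f timeMeasure
  sq : ∀ ξ, Integrable (fun s => nrmL ξ (f s) ^ 2) timeMeasure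

theorem IsNoise.zero : IsNoise (fun _ => (0 : E)) :=
  ⟨aestronglyMeasurable_const, fun ξ => by simp [nrmL_zero]⟩

theorem IsNoise.add {f g : ℝ≥0 → E} (hf : IsNoise f) (hg : IsNoise g) :
    IsNoise (fun s => f s + g s) := by
  refine ⟨hf.aesm.add hg.aesm, fun ξ => ?_⟩
  refine Integrable.mono' (((hf.sq ξ).const_mul 2).add ((hg.sq ξ).const_mul 2))
    (((nrmL_continuous ξ).comp_aestronglyMeasurable (hf.aesm.add hg.aesm)).pow 2)
    (Eventually.of_forall fun s => ?_)
  have h1 := nrmL_add_le ξ (f s) (g s)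
  have h2 := nrmL_nonneg ξ (f s + g s)
  rw [Real.norm_of_nonneg (sq_nonneg _)]
  simp only [Pi.add_apply]
  nlinarith [sq_nonneg (nrmL ξ (f s) - nrmL ξ (g s))]

theorem IsNoise.indicator {f : ℝ≥0 → E} (hf : IsNoise f) {s : Set ℝ≥0} (hs : MeasurableSet s) :
    IsNoise (s.indicator f) := by
  refine ⟨hf.aesm.indicator hs, fun ξ => ?_⟩
  refine ((hf.sq ξ).indicator hs).congr (Eventually.of_forall fun x => ?_)
  by_cases hx : x ∈ s <;> simp [hx, nrmL_zero]

theorem IsNoise.map {f : ℝ≥0 → E} (hf : IsNoise f) (T : E →L[ℂ] E) :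
    IsNoise (fun s => T (f s)) := by
  have hm : AEStronglyMeasurable (fun s => T (f s)) timeMeasure :=
    T.continuous.comp_aestronglyMeasurable hf.aesm
  refine ⟨hm, fun ξ => ?_⟩
  obtain ⟨ζ, C, hC, h⟩ := exists_bound T ξ
  refine Integrable.mono' ((hf.sq ζ).const_mul (C ^ 2))
    (((nrmL_continuous ξ).comp_aestronglyMeasurable hm).pow 2)
    (Eventually.of_forall fun s => ?_)
  rw [Real.norm_of_nonneg (sq_nonneg _), ← mul_pow]
  exact pow_le_pow_left₀ (nrmL_nonneg _ _) (h _) 2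

theorem IsNoise.const (e : E) {s : Set ℝ≥0} (hs : MeasurableSet s) (hfin : timeMeasure s < ⊤) :
    IsNoise (s.indicator fun _ => e) := by
  refine ⟨aestronglyMeasurable_const.indicator hs, fun ξ => ?_⟩
  have : Integrable (s.indicator fun _ => nrmL ξ e ^ 2) timeMeasure :=
    (integrable_indicator_iff hs).2 (integrableOn_const hfin.ne)
  refine this.congr (Eventually.of_forall fun x => ?_)
  by_cases hx : x ∈ s <;> simp [hx, nrmL_zero]

theorem IsNoise.sum {ι : Type*} (s : Finset ι) {f : ι → ℝ≥0 → E} (hf : ∀ i ∈ s, IsNoise (f i)) :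
    IsNoise (fun x => ∑ i ∈ s, f i x) := by
  classical
  induction s using Finset.induction_on with
  | empty => simpa using IsNoise.zero
  | insert i s hi ih =>
    simp only [Finset.sum_insert hi]
    exact (hf i (by simp)).add (ih fun j hj => hf j (by simp [hj]))

/-- The space `L²_E(ℝ₊)` of the test functions `f^•` (as functions; functions which are equal
almost everywhere define the same vectors below). -/
structure NoiseFn (E : Type*) [AddCommGroup E] [Module ℂ E] [UniformSpace E]
    [HilbertScale E] where
  toFun : ℝ≥0 → E
  isNoise : IsNoise toFun

namespace NoiseFn

instance : CoeFun (NoiseFn E) (fun _ => ℝ≥0 → E) := ⟨toFun⟩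

/-- The zero function; its coherent vector `0^⊗ = δ_∅` is the vacuum. -/
instance : Zero (NoiseFn E) := ⟨⟨fun _ => 0, IsNoise.zero⟩⟩

/-- The restriction `f_t` of `f` to `[0, t)`, extended by zero. -/
def past (t : ℝ≥0) (f : NoiseFn E) : NoiseFn E :=
  ⟨(Set.Iio t).indicator f, f.isNoise.indicator measurableSet_Iio⟩

/-- The restriction `f_{[t}` of `f` to `[t, ∞)`, extended by zero. -/
def future (t : ℝ≥0) (f : NoiseFn E) : NoiseFn E :=
  ⟨(Set.Ici t).indicator f, f.isNoise.indicator measurableSet_Ici⟩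

/-- The inner product `∫ ⟨f'(s)|f(s)⟩ ds`. -/
def inner (f' f : NoiseFn E) : ℂ := ∫ s, ip (f' s) (f s) ∂timeMeasure

/-- The inner product `∫ ⟨f'(s)|f(s)⟩(ξ) ds` of the norm number `ξ`. -/
def innerL (ξ : ℕ) (f' f : NoiseFn E) : ℂ := ∫ s, ipL ξ (f' s) (f s) ∂timeMeasure

end NoiseFn

/-! ### Step functions with values in an Itô algebra -/

/-- Piecewise constant functions on `ℝ₊` with finitely many pieces, the pieces being points and
open intervals. -/
def IsStep {α : Type*} (g : ℝ≥0 → α) : Prop :=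
  ∃ S : Finset ℝ≥0, ∀ s s', (∀ r ∈ S, (s < r ↔ s' < r) ∧ (r < s ↔ r < s')) → g s = g s'

theorem IsStep.map₂ {α β γ : Type*} {g : ℝ≥0 → α} {h : ℝ≥0 → β} (hg : IsStep g) (hh : IsStep h)
    (F : α → β → γ) : IsStep (fun s => F (g s) (h s)) := by
  classical
  obtain ⟨S, hS⟩ := hg
  obtain ⟨T, hT⟩ := hh
  refine ⟨S ∪ T, fun s s' hr => ?_⟩
  change F (g s) (h s) = F (g s') (h s')
  rw [hS s s' fun r h => hr r (by simp [h]), hT s s' fun r h => hr r (by simp [h])]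

theorem IsStep.map {α β : Type*} {g : ℝ≥0 → α} (hg : IsStep g) (F : α → β) :
    IsStep (fun s => F (g s)) := hg.map₂ hg fun a _ => F a

theorem IsStep.factor {α : Type*} {g : ℝ≥0 → α} (hg : IsStep g) :
    (Set.range g).Finite ∧ ∀ B : Set α, MeasurableSet (g ⁻¹' B) := by
  classical
  obtain ⟨S, hS⟩ := hg
  let π : ℝ≥0 → S → Bool × Bool := fun s r => (decide (s < r), decide ((r : ℝ≥0) < s))
  have hπ : ∀ s s', π s = π s' → g s = g s' := fun s s' h => hS s s' fun r hr => by
    have := congrFun h ⟨r, hr⟩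
    simpa [π] using this
  have hmeas : Measurable π := by
    refine measurable_pi_iff.2 fun r => Measurable.prodMk ?_ ?_
    · exact measurable_to_bool (by
        have : (fun s : ℝ≥0 => decide (s < r)) ⁻¹' {true} = Set.Iio (r : ℝ≥0) := by ext; simp
        rw [this]
        exact measurableSet_Iio)
    · exact measurable_to_bool (by
        have : (fun s : ℝ≥0 => decide ((r : ℝ≥0) < s)) ⁻¹' {true} = Set.Ioi (r : ℝ≥0) := by
          ext; simp
        rw [this]
        exact measurableSet_Ioi)
  constructor
  · refine (Set.finite_range fun c => g (Function.invFun π c)).subset ?_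
    rintro _ ⟨s, rfl⟩
    exact ⟨π s, hπ _ _ (Function.invFun_eq ⟨s, rfl⟩)⟩
  · intro B
    have : g ⁻¹' B = π ⁻¹' (π '' (g ⁻¹' B)) := by
      refine (Set.subset_preimage_image π _).antisymm ?_
      rintro s ⟨s', hs', h⟩
      have h' : g s' = g s := hπ _ _ h
      change g s ∈ B
      rw [← h']
      exact hs'
    rw [this]
    exact hmeas (Set.toFinite _).measurableSet

/-- Step functions `g : ℝ₊ → 𝔞` of bounded support. -/
@[ext]
structure StepFn (𝔞 : NonUnitalStarSubalgebra ℂ (HPAlg E)) where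
  toFun : ℝ≥0 → 𝔞
  isStep : IsStep toFun
  bounded : ∃ t, ∀ s, t ≤ s → toFun s = 0

variable {𝔞 : NonUnitalStarSubalgebra ℂ (HPAlg E)}

namespace StepFn

instance : CoeFun (StepFn 𝔞) (fun _ => ℝ≥0 → 𝔞) := ⟨toFun⟩

instance : Zero (StepFn 𝔞) := ⟨⟨fun _ => 0, ⟨∅, fun _ _ _ => rfl⟩, ⟨0, fun _ _ => rfl⟩⟩⟩

/-- The pointwise involution `g^⋆`. -/
instance : Star (StepFn 𝔞) := ⟨fun g => ⟨fun s => star (g s), g.isStep.map _, by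
  obtain ⟨t, ht⟩ := g.bounded
  exact ⟨t, fun s hs => by simp [ht s hs]⟩⟩⟩

/-- The `⋆`-product `(g ⋆ h)(t) = h(t) + g(t)^⋆ h(t) + g(t)^⋆`. -/
def starProd (g h : StepFn 𝔞) : StepFn 𝔞 :=
  ⟨fun s => h s + star (g s) * h s + star (g s),
    g.isStep.map₂ h.isStep fun a b => b + star a * b + star a, by
    obtain ⟨t, ht⟩ := g.bounded
    obtain ⟨t', ht'⟩ := h.bounded
    exact ⟨max t t', fun s hs => by
      simp [ht s ((le_max_left _ _).trans hs), ht' s ((le_max_right _ _).trans hs)]⟩⟩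

/-- The function equal to `a` on `[0, t)` and to `0` on `[t, ∞)`. -/
def const (t : ℝ≥0) (a : 𝔞) : StepFn 𝔞 :=
  ⟨fun s => open Classical in if s < t then a else 0,
    ⟨{t}, fun s s' h => by simp [(h t (by simp)).1]⟩,
    ⟨t, fun s hs => by simp [not_lt.2 hs]⟩⟩

end StepFn

/-- The `⋆`-semigroup `𝔤_t` of the step functions `g` with `g(s) = 0` for all `s ≥ t`. -/
def stepsBefore (𝔞 : NonUnitalStarSubalgebra ℂ (HPAlg E)) (t : ℝ≥0) : Set (StepFn 𝔞) :=
  {g | ∀ s, t ≤ s → g s = 0}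

theorem isNoise_shift (g : StepFn 𝔞) (f : NoiseFn E) :
    IsNoise (fun s => f s + (g s).1.gauge (f s) + (g s).1.crea) := by
  classical
  obtain ⟨hfin, hmeas⟩ := g.isStep.factor
  obtain ⟨t, ht⟩ := g.bounded
  have key : ∀ a ∈ hfin.toFinset, IsNoise ((g.toFun ⁻¹' {a}).indicator
      fun s => a.1.gauge (f s) + a.1.crea) := by
    intro a _
    by_cases ha : a = 0
    · subst ha
      simpa using IsNoise.zero.indicator (hmeas {0})
    · have hsub : g.toFun ⁻¹' {a} ⊆ Set.Iio t := by
        intro s hs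
        by_contra hcon
        exact ha ((Set.mem_singleton_iff.1 hs).symm.trans (ht s (not_lt.1 hcon)))
      have h1 := ((f.isNoise.map a.1.gauge).indicator (hmeas {a})).add
        (IsNoise.const a.1.crea (hmeas {a})
          ((measure_mono hsub).trans_lt (timeMeasure_Iio_lt_top t)))
      convert h1 using 2 with s
      by_cases hs : s ∈ g.toFun ⁻¹' {a} <;> simp [Set.indicator, hs]
  have h2 := f.isNoise.add (IsNoise.sum _ key)
  convert h2 using 2 with s
  rw [add_assoc, Finset.sum_eq_single (g s)]
  · simp [Set.indicator]
  · intro b _ hb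
    simp [Set.indicator, Ne.symm hb]
  · intro h
    simp at h

/-- The function `f ↦ (1 + g^•_•) f + g^•_+` on the test functions. -/
def weylShift (g : StepFn 𝔞) (f : NoiseFn E) : NoiseFn E := ⟨_, isNoise_shift g f⟩

/-- The factor `exp ∫ (g^-_•(s) f(s) + g^-_+(s)) ds`. -/
def weylFactor (g : StepFn 𝔞) (f : NoiseFn E) : ℂ :=
  Complex.exp (∫ s, (ip (g s).1.anni (f s) + (g s).1.time) ∂timeMeasure)

end Noise

/-! ### Coherent vectors, continuous sesquilinear forms and exponential operators -/

section Fock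

variable (D E : Type*) [AddCommGroup D] [Module ℂ D] [UniformSpace D] [IsUniformAddGroup D]
  [ContinuousSMul ℂ D] [HilbertScale D] [AddCommGroup E] [Module ℂ E] [UniformSpace E]
  [IsUniformAddGroup E] [ContinuousSMul ℂ E] [HilbertScale E]

/-- The span of the coherent vectors `f^⊗`, whose elements `∑ c_f f^⊗` are finite formal sums.
Its completion in the Fock norms `fockNorm` is the space `𝔉`, the intersection of the Fock
spaces over the spaces `L²(ξ)`. -/
abbrev CoherentSpan := NoiseFn E →₀ ℂ

/-- The span of the vectors `η ⊗ f^⊗`, whose elements `∑ η_f ⊗ f^⊗` are finite formal sums.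
Its completion in the seminorms `projNorm` is the projective tensor product `𝔇 = D ⊗ 𝔉`; the
continuous sesquilinear forms on `𝔇` are the same as the ones on this dense subspace. -/
abbrev DSpan := NoiseFn E →₀ D

/-- Sesquilinear forms on `D`, antilinear in the first argument. -/
abbrev DForm := D →ₗ⋆[ℂ] D →ₗ[ℂ] ℂ

/-- Sesquilinear forms on the span of the vectors `η ⊗ f^⊗`. -/
abbrev QForm := DSpan D E →ₗ⋆[ℂ] DSpan D E →ₗ[ℂ] ℂ

variable {D E}

/-- The norm number `ξ` of the Fock scale, defined by `⟨f'^⊗|f^⊗⟩(ξ) = exp ⟨f'|f⟩(ξ)`. -/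
def fockNorm (ξ : ℕ) (φ : CoherentSpan E) : ℝ :=
  √(φ.sum fun f' c' => φ.sum fun f c =>
    (starRingEnd ℂ) c' * c * Complex.exp (NoiseFn.innerL ξ f' f)).re

/-- The vector `η ⊗ φ`. -/
def tens (η : D) (φ : CoherentSpan E) : DSpan D E :=
  φ.mapRange (fun c => c • η) (zero_smul ℂ η)

/-- The vector `η ⊗ f^⊗`. -/
def coh (η : D) (f : NoiseFn E) : DSpan D E := Finsupp.single f η

/-- The projective tensor norm of `‖·‖_p` on `D` and `‖·‖(ξ)` on the Fock space: the infimum of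
`∑ ‖η_i‖_p ‖φ_i‖(ξ)` over all the representations `ψ = ∑ η_i ⊗ φ_i`. -/
def projNorm (p ξ : ℕ) (ψ : DSpan D E) : ℝ :=
  sInf {r | ∃ (n : ℕ) (η : Fin n → D) (φ : Fin n → CoherentSpan E),
    ψ = ∑ i, tens (η i) (φ i) ∧ r = ∑ i, nrmL p (η i) * fockNorm ξ (φ i)}

/-- Continuous sesquilinear forms on `D`. -/
def DContinuous (B : DForm D) : Prop :=
  ∃ (p : ℕ) (C : ℝ), ∀ η' η, ‖B η' η‖ ≤ C * nrmL p η' * nrmL p η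

/-- Continuous sesquilinear forms on `𝔇`. -/
def QContinuous (Y : QForm D E) : Prop :=
  ∃ (p ξ : ℕ) (C : ℝ), ∀ ψ' ψ, ‖Y ψ' ψ‖ ≤ C * projNorm p ξ ψ' * projNorm p ξ ψ

/-- The coherent matrix element `Y(f', f)`, a sesquilinear form on `D`. -/
def matElem (Y : QForm D E) (f' f : NoiseFn E) : DForm D :=
  LinearMap.mk₂'ₛₗ (starRingEnd ℂ) (RingHom.id ℂ) (fun η' η => Y (coh η' f') (coh η f))
    (by simp [coh]) (by simp [coh, ← Finsupp.smul_single]) (by simp [coh])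
    (by simp [coh, ← Finsupp.smul_single])

/-- The sesquilinear form with the given coherent matrix elements. -/
def ofKernel (K : NoiseFn E → NoiseFn E → DForm D) : QForm D E :=
  LinearMap.mk₂'ₛₗ (starRingEnd ℂ) (RingHom.id ℂ)
    (fun ψ' ψ => ψ'.sum fun f' η' => ψ.sum fun f η => K f' f η' η)
    (fun a b c => by
      classical
      refine Finsupp.sum_add_index' (by simp) fun f' x y => ?_
      simp [Finsupp.sum_add])
    (fun c a b => by
      rw [Finsupp.sum_smul_index' (by simp)]
      simp [Finsupp.sum, Finset.mul_sum])
    (fun a b c => by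
      classical
      rw [← Finsupp.sum_add]
      exact Finsupp.sum_congr fun f' _ => Finsupp.sum_add_index' (by simp) (by simp))
    (fun c a b => by
      have h : ∀ f' η', ((c • b).sum fun f η => K f' f η' η) =
          c * b.sum fun f η => K f' f η' η := fun f' η' => by
        rw [Finsupp.sum_smul_index' (fun f => map_zero (K f' f η'))]
        simp [Finsupp.sum, Finset.mul_sum]
      simp only [h]
      simp [Finsupp.sum, Finset.mul_sum])

theorem ofKernel_coh (K : NoiseFn E → NoiseFn E → DForm D) (η' η : D) (f' f : NoiseFn E) :
    ofKernel K (coh η' f') (coh η f) = K f' f η' η := by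
  simp [ofKernel, coh]

/-- The identity form `I`, that is the Hilbert space inner product
`⟨η' ⊗ f'^⊗|η ⊗ f^⊗⟩ = ⟨η'|η⟩ exp ⟨f'|f⟩`. -/
def idForm (D E : Type*) [AddCommGroup D] [Module ℂ D] [UniformSpace D] [HilbertScale D]
    [AddCommGroup E] [Module ℂ E] [UniformSpace E] [IsUniformAddGroup E] [ContinuousSMul ℂ E]
    [HilbertScale E] : QForm D E :=
  ofKernel fun f' f => Complex.exp (NoiseFn.inner f' f) • ipForm D

/-- The vacuum conditional expectation `ε_t(Z) = E_t Z E_t^† ⊗ I_{[t}`: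
`⟨η' ⊗ f'^⊗|ε_t(Z) (η ⊗ f^⊗)⟩ = ⟨η' ⊗ f'_t^⊗|Z (η ⊗ f_t^⊗)⟩ ⟨f'_{[t}^⊗|f_{[t}^⊗⟩`. -/
def condExp (t : ℝ≥0) (Z : QForm D E) : QForm D E :=
  ofKernel fun f' f => Complex.exp (NoiseFn.inner (f'.future t) (f.future t)) •
    matElem Z (f'.past t) (f.past t)

/-- A form is adapted at `t` if it acts as the identity on the future `[t, ∞)`. -/
def IsAdapted (t : ℝ≥0) (Z : QForm D E) : Prop := condExp t Z = Z

/-- Positive forms. -/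
def QPos (Z : QForm D E) : Prop := ∀ ψ, 0 ≤ Z ψ ψ

/-- The order of forms on `𝔇`. -/
def QLe (Y Z : QForm D E) : Prop := QPos (Z - Y)

variable {𝔞 : NonUnitalStarSubalgebra ℂ (HPAlg E)}

/-- The exponential operator `W(g)`, for a step function `g` the solution at any time `t` after
the support of `g` of `dW_t(g) = W_t(g) dΛ(t, g(t))`, `W_0(g) = I`, on the span of the vectors
`η ⊗ f^⊗`: `W(g) (η ⊗ f^⊗) = exp(∫ (g^-_• f + g^-_+) ds) η ⊗ ((1 + g^•_•) f + g^•_+)^⊗`.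
So `W(g) = W_t(g)` for `g ∈ 𝔤_t`, and the adjoint operator is `W(g^⋆)`. -/
def weyl (g : StepFn 𝔞) : DSpan D E →ₗ[ℂ] DSpan D E :=
  Finsupp.lsum ℂ fun f => weylFactor g f • Finsupp.lsingle (weylShift g f)

theorem weyl_coh (g : StepFn 𝔞) (η : D) (f : NoiseFn E) :
    weyl g (coh η f) = weylFactor g f • coh η (weylShift g f) := by
  simp [weyl, coh]

/-- `A'` is the adjoint of the operator `A` in `D`. -/
def IsAdj (A A' : D →L[ℂ] D) : Prop := ∀ x y, ip (A' x) y = ip x (A y)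

/-- The commutant `𝒜ᶜ`: continuous sesquilinear forms `B` on `D` which commute with all the
operators of the `*`-algebra `𝒜`, in the sense `⟨η'|B A η⟩ = ⟨A^† η'|B η⟩`. -/
def commutant (𝒜 : NonUnitalSubalgebra ℂ (D →L[ℂ] D)) : Set (DForm D) :=
  {B | DContinuous B ∧ ∀ A ∈ 𝒜, ∀ A' ∈ 𝒜, IsAdj A A' → ∀ η' η, B η' (A η) = B (A' η') η}

/-- The operator `A ⊗ I`. -/
def ampl (A : D →L[ℂ] D) : DSpan D E →ₗ[ℂ] DSpan D E :=
  Finsupp.mapRange.linearMap (A : D →ₗ[ℂ] D)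

/-- The space `𝔅` of the continuous forms on `𝔇` which commute with all the operators `A ⊗ I`,
`A ∈ 𝒜`, and with all the exponential operators `W(t, a)`, `t > 0`, `a ∈ 𝔞`. -/
def commutingForms (𝒜 : NonUnitalSubalgebra ℂ (D →L[ℂ] D))
    (𝔞 : NonUnitalStarSubalgebra ℂ (HPAlg E)) : Set (QForm D E) :=
  {Y | QContinuous Y ∧
    (∀ A ∈ 𝒜, ∀ A' ∈ 𝒜, IsAdj A A' → ∀ ψ' ψ, Y ψ' (ampl A ψ) = Y (ampl A' ψ') ψ) ∧
    ∀ (t : ℝ≥0) (a : 𝔞), 0 < t → ∀ ψ' ψ,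
      Y ψ' (weyl (StepFn.const t a) ψ) = Y (weyl (StepFn.const t (star a)) ψ') ψ}

/-- The filtration `𝔅_t` of the adapted forms in `𝔅`. -/
def filtration (𝒜 : NonUnitalSubalgebra ℂ (D →L[ℂ] D))
    (𝔞 : NonUnitalStarSubalgebra ℂ (HPAlg E)) (t : ℝ≥0) : Set (QForm D E) :=
  {Y | Y ∈ commutingForms 𝒜 𝔞 ∧ IsAdapted t Y}

/-- `R` is a positive submartingale with `R_t ∈ 𝔅_t`. -/
def IsPosSubmartingale (𝒜 : NonUnitalSubalgebra ℂ (D →L[ℂ] D))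
    (𝔞 : NonUnitalStarSubalgebra ℂ (HPAlg E)) (R : ℝ≥0 → QForm D E) : Prop :=
  (∀ t, R t ∈ filtration 𝒜 𝔞 t) ∧ (∀ t, QPos (R t)) ∧
    ∀ t s, t ≤ s → QLe (condExp t (R s)) (R t)

/-- `R` is a positive martingale with `R_t ∈ 𝔅_t`. -/
def IsPosMartingale (𝒜 : NonUnitalSubalgebra ℂ (D →L[ℂ] D))
    (𝔞 : NonUnitalStarSubalgebra ℂ (HPAlg E)) (R : ℝ≥0 → QForm D E) : Prop :=
  (∀ t, R t ∈ filtration 𝒜 𝔞 t) ∧ (∀ t, QPos (R t)) ∧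
    ∀ t s, t ≤ s → condExp t (R s) = R t

/-! ### State generating functions -/

/-- The form `ε[R W(g)]` on `D`: `⟨η'|ε[R W(g)] η⟩ = ⟨η' ⊗ δ_∅|R W(g) (η ⊗ δ_∅)⟩`. -/
def genFun (R : QForm D E) (g : StepFn 𝔞) : DForm D :=
  LinearMap.mk₂'ₛₗ (starRingEnd ℂ) (RingHom.id ℂ)
    (fun η' η => R (coh η' 0) (weyl g (coh η 0)))
    (by simp [coh]) (by simp [coh, ← Finsupp.smul_single]) (by simp [coh])
    (by simp [coh, ← Finsupp.smul_single])

/-- Positive definiteness of `θ` on `𝔤_t`: `∑ ⟨η_k|θ(g_k ⋆ g_l) η_l⟩ ≥ 0` for all finite families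
`g_k ∈ 𝔤_t` and `η_k ∈ D`. -/
def PosDefOn (t : ℝ≥0) (θ : StepFn 𝔞 → DForm D) : Prop :=
  ∀ (n : ℕ) (g : Fin n → StepFn 𝔞) (η : Fin n → D), (∀ k, g k ∈ stepsBefore 𝔞 t) →
    0 ≤ ∑ k, ∑ l, θ ((g k).starProd (g l)) (η k) (η l)

/-- Absolute continuity of `θ` on `𝔤_t`: if `∑_g η_n^g ⊗ W(g)δ_∅ → 0` in `𝔇` as `n → ∞`, where
`η_n^g = 0` except for finitely many `g ∈ 𝔤_t`, then `∑_{g,h} ⟨η_n^g|θ(g ⋆ h) η_n^h⟩ → 0`.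
Here `W(g)δ_∅` is the multiple `exp(∫ g^-_+ ds)` of the coherent vector of `g^•_+`. -/
def AbsContOn (t : ℝ≥0) (θ : StepFn 𝔞 → DForm D) : Prop :=
  ∀ η : ℕ → StepFn 𝔞 →₀ D, (∀ n, ∀ g ∈ (η n).support, g ∈ stepsBefore 𝔞 t) →
    (∀ p ξ, Tendsto (fun n => projNorm p ξ ((η n).sum fun g x => weyl g (coh x (0 : NoiseFn E))))
      atTop (𝓝 0)) →
    Tendsto (fun n => (η n).sum fun g x => (η n).sum fun h y => θ (g.starProd h) x y)
      atTop (𝓝 0)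

/-- `ϑ = (ϑ_t)` is a family of `𝒜ᶜ`-valued positive definite functions `ϑ_t` on `𝔤_t` with
`ϑ_0(0) = I`. The values of `ϑ_t` outside `𝔤_t` are irrelevant. -/
def IsPosDefFamily (𝒜 : NonUnitalSubalgebra ℂ (D →L[ℂ] D))
    (ϑ : ℝ≥0 → StepFn 𝔞 → DForm D) : Prop :=
  (∀ t, ∀ g ∈ stepsBefore 𝔞 t, ϑ t g ∈ commutant 𝒜) ∧ (∀ t, PosDefOn t (ϑ t)) ∧
    ϑ 0 0 = ipForm D

/-- The closure `K` of the subspace `{a^•_+ : a ∈ 𝔞}` is an orthogonal direct summand of `E`: there is a projection `P` onto `K` along the orthogonal complement of `K`, and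
`P ⊕ (1 - P)` is a projective contraction. This holds with `P = 1` if the vectors `a^•_+`
are dense in `E`, and it always holds if `E` is a Hilbert space with the norms
`‖e‖(ξ) = √(ξ + 1) ‖e‖`. -/
def NoiseComplemented (𝔞 : NonUnitalStarSubalgebra ℂ (HPAlg E)) : Prop :=
  ∃ P : E →ₗ[ℂ] E, (∀ e, P e ∈ closure {k : E | ∃ a ∈ 𝔞, a.crea = k}) ∧
    (∀ e, ∀ a ∈ 𝔞, ip a.crea (e - P e) = 0) ∧
    ∀ ζ, ∃ ξ, ∀ e, nrmL ζ (P e) ^ 2 + nrm (e - P e) ^ 2 ≤ nrmL ξ e ^ 2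

end Fock

end QFlow

end

set_option linter.unusedSectionVars false

noncomputable section

namespace QFlow

/-! ### Positive sesquilinear forms -/

section PosForm

universe u

variable {V : Type u} [AddCommGroup V] [Module ℂ V]

/-! Everything rests on the identity ⟨η'|ϑ(g ⋆ h)η⟩ = ⟨W(g)(η' ⊗ δ_∅)|Y W(h)(η ⊗ δ_∅)⟩ for ϑ =
`genFun Y` (`genFun_starProd`), valid once Y commutes with W(g) for every step function g. It turns
positivity and continuity of Y into positive definiteness and absolute continuity of ϑ. Since
W(g)δ_∅ with g ∈ 𝔤_t lives before t, ε_t is invisible on these vectors (`condExp_vacuum`), which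
gives the order relations.

Commutation is assumed only for constants on [0, t), and 1 + a need not be invertible, so the part
on [0, s) cannot simply be divided out. Instead (1 - b)(1 + b) = 1 - b², (1 + b²)(1 - b²) = 1 - b⁴
and so on: Y commutes with W of a function equal to μa on [s, t) and to -(μa)^(2^n) on [0, s). Hence
the commutation defect of μa·1_[s,t) is an entire function of μ vanishing to infinite order at 0, so
it is zero (`commutesWeyl_interval`). Every step function is almost everywhere a product of such
pieces (`commutesWeyl_of_const`).

Conversely, a positive definite θ has a GNS space, and absolute continuity amounts to a bound of the
GNS norm by one projective norm of ∑ W(g)(η_g ⊗ δ_∅) (`gnsForm_bound`). So the normalized GNS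
vectors depend continuously on g^•_+ and extend to limits of such functions, which include all
K-valued test functions on [0, t) (`exists_approx`). Their inner products are coherent matrix
elements B(f', f) (`exists_reconstruction`).

The form R_t is B on the part 1_[0,t) P f and the identity on the rest (`recon`). As 𝔞 is a
⋆-algebra, P commutes with the operators a^•_•, whence R_t commutes with W(g); positivity is Schur's
product theorem; continuity is an inequality of positive kernels coming from the bound on P. Finally
ε_t maps the form built from B at time s to the one built from the same B at time t, so the
relations between ϑ_t and ϑ_s become the submartingale or martingale property. -/

theorem posForm_conj {q : V →ₗ⋆[ℂ] V →ₗ[ℂ] ℂ} (hq : ∀ x, 0 ≤ q x x) (x y : V) :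
    (starRingEnd ℂ) (q x y) = q y x := by
  have h0 : ∀ z, (q z z).im = 0 := fun z => (Complex.nonneg_iff.1 (hq z)).2.symm
  -- The form is real on the diagonal; at x + y this compares the imaginary parts of q x y and q y
  -- x, at x + iy the real parts.
  have h1 := h0 (x + y)
  have h2 := h0 (x + Complex.I • y)
  simp only [map_add, LinearMap.add_apply, map_smul, LinearMap.map_smulₛₗ, LinearMap.smul_apply,
    Complex.add_im, smul_eq_mul, Complex.mul_im, Complex.I_re, Complex.I_im, Complex.conj_I,
    Complex.neg_re, Complex.neg_im, h0, Complex.add_re, Complex.mul_re] at h1 h2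
  apply Complex.ext
  · simp only [Complex.conj_re]
    linarith
  · simp only [Complex.conj_im]
    linarith

/-- The Hilbert space of a positive sesquilinear form. -/
theorem exists_hilbert {q : V →ₗ⋆[ℂ] V →ₗ[ℂ] ℂ} (hq : ∀ x, 0 ≤ q x x) :
    ∃ (H : Type u) (_ : NormedAddCommGroup H) (_ : InnerProductSpace ℂ H) (_ : CompleteSpace H)
      (u : V →ₗ[ℂ] H), DenseRange u ∧ ∀ x y, inner ℂ (u x) (u y) = q x y := by
  let c : PreInnerProductSpace.Core ℂ V :=
    { inner := fun x y => q x y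
      conj_inner_symm := fun x y => posForm_conj hq y x
      re_inner_nonneg := fun x => (Complex.nonneg_iff.1 (hq x)).1
      add_left := fun x y z => by simp
      smul_left := fun x y r => by simp }
  let _ : SeminormedAddCommGroup V := @InnerProductSpace.Core.toSeminormedAddCommGroup ℂ V _ _ _ c
  let _ : InnerProductSpace ℂ V := InnerProductSpace.ofCore c
  -- The form may degenerate, so V is only seminormed. Its completion is Hausdorff, and the map into
  -- it need not be injective.
  refine ⟨UniformSpace.Completion V, inferInstance, inferInstance, inferInstance,
    (UniformSpace.Completion.toComplL (𝕜 := ℂ) (E := V)).toLinearMap, ?_, fun x y => ?_⟩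
  · exact UniformSpace.Completion.denseRange_coe
  · exact UniformSpace.Completion.inner_coe x y

/-- The seminorm of a positive sesquilinear form. -/
def formNorm (q : V →ₗ⋆[ℂ] V →ₗ[ℂ] ℂ) (x : V) : ℝ := √(q x x).re

theorem formNorm_nonneg (q : V →ₗ⋆[ℂ] V →ₗ[ℂ] ℂ) (x : V) : 0 ≤ formNorm q x := Real.sqrt_nonneg _

section

variable {q : V →ₗ⋆[ℂ] V →ₗ[ℂ] ℂ} (hq : ∀ x, 0 ≤ q x x)
include hq

theorem formNorm_sq (x : V) : formNorm q x ^ 2 = (q x x).re :=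
  Real.sq_sqrt (Complex.nonneg_iff.1 (hq x)).1

theorem formNorm_sq_complex (x : V) : ((formNorm q x ^ 2 : ℝ) : ℂ) = q x x := by
  rw [formNorm_sq hq]
  exact Complex.ext rfl (by simpa using (Complex.nonneg_iff.1 (hq x)).2)

/-- Cauchy–Schwarz, like the triangle inequality and the continuity below, is read off in the
Hilbert space of the form, where `formNorm q` is the norm of the image. -/
theorem norm_form_le (x y : V) : ‖q x y‖ ≤ formNorm q x * formNorm q y := by
  obtain ⟨H, _, _, _, u, -, hu⟩ := exists_hilbert hq
  have h : ∀ z, formNorm q z = ‖u z‖ := fun z => by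
    rw [formNorm, ← hu, norm_eq_sqrt_re_inner (𝕜 := ℂ)]; rfl
  rw [h, h, ← hu]
  exact norm_inner_le_norm _ _

theorem formNorm_add_le (x y : V) : formNorm q (x + y) ≤ formNorm q x + formNorm q y := by
  obtain ⟨H, _, _, _, u, -, hu⟩ := exists_hilbert hq
  have h : ∀ z, formNorm q z = ‖u z‖ := fun z => by
    rw [formNorm, ← hu, norm_eq_sqrt_re_inner (𝕜 := ℂ)]; rfl
  rw [h, h, h, map_add]
  exact norm_add_le _ _

theorem formNorm_smul (c : ℂ) (x : V) : formNorm q (c • x) = ‖c‖ * formNorm q x := by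
  obtain ⟨H, _, _, _, u, -, hu⟩ := exists_hilbert hq
  have h : ∀ z, formNorm q z = ‖u z‖ := fun z => by
    rw [formNorm, ← hu, norm_eq_sqrt_re_inner (𝕜 := ℂ)]; rfl
  rw [h, h, map_smul, norm_smul]

theorem formNorm_zero : formNorm q 0 = 0 := by simp [formNorm]

theorem formNorm_sum_le {ι : Type*} (s : Finset ι) (x : ι → V) :
    formNorm q (∑ i ∈ s, x i) ≤ ∑ i ∈ s, formNorm q (x i) := by
  classical
  induction s using Finset.induction_on with
  | empty => simp [formNorm_zero hq]
  | insert i s hi ih =>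
    rw [Finset.sum_insert hi, Finset.sum_insert hi]
    exact (formNorm_add_le hq _ _).trans (by gcongr)

theorem tendsto_form {α : Type*} {l : Filter α} {f f' : α → V} {x x' : V}
    (hf : Tendsto (fun n => formNorm q (f n - x)) l (𝓝 0))
    (hf' : Tendsto (fun n => formNorm q (f' n - x')) l (𝓝 0)) :
    Tendsto (fun n => q (f' n) (f n)) l (𝓝 (q x' x)) := by
  obtain ⟨H, _, _, _, u, -, hu⟩ := exists_hilbert hq
  have h : ∀ z, formNorm q z = ‖u z‖ := fun z => by
    rw [formNorm, ← hu, norm_eq_sqrt_re_inner (𝕜 := ℂ)]; rfl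
  simp only [h, map_sub] at hf hf'
  simp only [← hu]
  exact (tendsto_iff_norm_sub_tendsto_zero.2 hf').inner (tendsto_iff_norm_sub_tendsto_zero.2 hf)

end

end PosForm

/-! ### Positive semidefinite kernels -/

section Kernel

/-- The sesquilinear form on finitely supported functions with a given kernel of forms. -/
def kerForm {ι V : Type*} [AddCommGroup V] [Module ℂ V] (K : ι → ι → (V →ₗ⋆[ℂ] V →ₗ[ℂ] ℂ)) :
    (ι →₀ V) →ₗ⋆[ℂ] (ι →₀ V) →ₗ[ℂ] ℂ :=
  LinearMap.mk₂'ₛₗ (starRingEnd ℂ) (RingHom.id ℂ)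
    (fun ψ' ψ => ψ'.sum fun f' η' => ψ.sum fun f η => K f' f η' η)
    (fun a b c => by
      classical
      refine Finsupp.sum_add_index' (by simp) fun f' x y => ?_
      simp [Finsupp.sum_add])
    (fun c a b => by
      rw [Finsupp.sum_smul_index' (by simp)]
      simp [Finsupp.sum, Finset.mul_sum])
    (fun a b c => by
      classical
      rw [← Finsupp.sum_add]
      exact Finsupp.sum_congr fun f' _ => Finsupp.sum_add_index' (by simp) (by simp))
    (fun c a b => by
      have h : ∀ f' η', ((c • b).sum fun f η => K f' f η' η) =
          c * b.sum fun f η => K f' f η' η := fun f' η' => by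
        rw [Finsupp.sum_smul_index' (fun f => map_zero (K f' f η'))]
        simp [Finsupp.sum, Finset.mul_sum]
      simp only [h]
      simp [Finsupp.sum, Finset.mul_sum])

theorem kerForm_apply {ι V : Type*} [AddCommGroup V] [Module ℂ V]
    (K : ι → ι → (V →ₗ⋆[ℂ] V →ₗ[ℂ] ℂ)) (x y : ι →₀ V) :
    kerForm K x y = x.sum fun f' η' => y.sum fun f η => K f' f η' η := rfl

theorem kerForm_single {ι V : Type*} [AddCommGroup V] [Module ℂ V]
    (K : ι → ι → (V →ₗ⋆[ℂ] V →ₗ[ℂ] ℂ)) (i j : ι) (x y : V) :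
    kerForm K (Finsupp.single i x) (Finsupp.single j y) = K i j x y := by
  simp [kerForm_apply]

/-- The form on `ℂ` with value `z` at `(1, 1)`. -/
def scalarForm (z : ℂ) : ℂ →ₗ⋆[ℂ] ℂ →ₗ[ℂ] ℂ :=
  LinearMap.mk₂'ₛₗ (starRingEnd ℂ) (RingHom.id ℂ) (fun c' c => (starRingEnd ℂ) c' * c * z)
    (fun _ _ _ => by rw [map_add]; ring) (fun _ _ _ => by simp; ring) (fun _ _ _ => by ring)
    (fun _ _ _ => by simp; ring)

theorem scalarForm_apply (z c' c : ℂ) : scalarForm z c' c = (starRingEnd ℂ) c' * c * z := rfl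

/-- The sesquilinear form on finitely supported functions with a given scalar kernel. -/
def matForm {ι : Type*} (M : ι → ι → ℂ) : (ι →₀ ℂ) →ₗ⋆[ℂ] (ι →₀ ℂ) →ₗ[ℂ] ℂ :=
  kerForm fun i j => scalarForm (M i j)

theorem matForm_apply {ι : Type*} (M : ι → ι → ℂ) (x y : ι →₀ ℂ) :
    matForm M x y = x.sum fun i c' => y.sum fun j c => (starRingEnd ℂ) c' * c * M i j := rfl

theorem matForm_single {ι : Type*} (M : ι → ι → ℂ) (i j : ι) (c d : ℂ) :
    matForm M (Finsupp.single i c) (Finsupp.single j d) = (starRingEnd ℂ) c * d * M i j := by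
  rw [matForm, kerForm_single, scalarForm_apply]

variable {ι : Type*}

/-- Positive semidefinite kernels on a set. -/
def PosKer (k : ι → ι → ℂ) : Prop := (Matrix.of k).PosSemidef

/-- The Hermitian symmetry contained in `PosSemidef` follows over ℂ from positivity by polarization.
-/
theorem posKer_iff {k : ι → ι → ℂ} : PosKer k ↔ ∀ x, 0 ≤ matForm k x x := by
  have h : ∀ x : ι →₀ ℂ, (x.sum fun i xi => x.sum fun j xj => star xi * Matrix.of k i j * xj) =
      matForm k x x := fun x => by
    rw [matForm_apply]
    exact Finsupp.sum_congr fun i _ => Finsupp.sum_congr fun j _ => by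
      rw [mul_right_comm]; rfl
  constructor
  · intro hM x
    exact h x ▸ hM.2 x
  · intro hM
    refine ⟨Matrix.ext fun i j => ?_, fun x => (h x).symm ▸ hM x⟩
    have := posForm_conj hM (Finsupp.single j 1) (Finsupp.single i 1)
    simpa [matForm_single] using this

/-- The points `a i` may coincide: the form is evaluated at a sum of point masses, which merges
repeated points. -/
theorem PosKer.sum_nonneg {k : ι → ι → ℂ} (hk : PosKer k) {κ : Type*}
    (s : Finset κ) (a : κ → ι) (c : κ → ℂ) :
    0 ≤ ∑ i ∈ s, ∑ j ∈ s, (starRingEnd ℂ) (c i) * c j * k (a i) (a j) := by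
  have h := posKer_iff.1 hk (∑ i ∈ s, Finsupp.single (a i) (c i))
  simp only [map_sum, LinearMap.sum_apply, matForm_single] at h
  rwa [Finset.sum_comm] at h

theorem PosKer.comp {k : ι → ι → ℂ} (hk : PosKer k) {κ : Type*} (a : κ → ι) :
    PosKer fun i j => k (a i) (a j) := hk.submatrix a

theorem posKer_of_sum_nonneg {k : ι → ι → ℂ}
    (h : ∀ (s : Finset ι) (c : ι → ℂ), 0 ≤ ∑ i ∈ s, ∑ j ∈ s, (starRingEnd ℂ) (c i) * c j * k i j) :
    PosKer k :=
  posKer_iff.2 fun x => h x.support x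

theorem posKer_of_form {V : Type*} [AddCommGroup V] [Module ℂ V] {q : V →ₗ⋆[ℂ] V →ₗ[ℂ] ℂ}
    (hq : ∀ x, 0 ≤ q x x) (v : ι → V) : PosKer fun i j => q (v i) (v j) := by
  refine posKer_of_sum_nonneg fun s c => ?_
  have h := hq (∑ i ∈ s, c i • v i)
  simp only [map_sum, LinearMap.sum_apply, map_smul, LinearMap.map_smulₛₗ, LinearMap.smul_apply,
    smul_eq_mul, Finset.mul_sum] at h
  rw [Finset.sum_comm]
  exact h.trans_eq (Finset.sum_congr rfl fun i _ => Finset.sum_congr rfl fun j _ => by ring)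

theorem posKer_of_tendsto {α : Type*} {l : Filter α} [l.NeBot] {k : α → ι → ι → ℂ}
    {k' : ι → ι → ℂ} (hM : ∀ n, PosKer (k n))
    (h : ∀ i j, Tendsto (fun n => k n i j) l (𝓝 (k' i j))) : PosKer k' := by
  refine posKer_of_sum_nonneg fun s c => ?_
  refine ge_of_tendsto' (x := l) (f := fun n =>
    ∑ i ∈ s, ∑ j ∈ s, (starRingEnd ℂ) (c i) * c j * k n i j) ?_
    fun n => (hM n).sum_nonneg s id c
  exact tendsto_finsetSum _ fun i _ => tendsto_finsetSum _ fun j _ => (h i j).const_mul _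

theorem posKer_one : PosKer fun (_ _ : ι) => (1 : ℂ) := by
  refine posKer_of_sum_nonneg fun s c => ?_
  have : ∑ i ∈ s, ∑ j ∈ s, (starRingEnd ℂ) (c i) * c j * 1 =
      (starRingEnd ℂ) (∑ i ∈ s, c i) * ∑ i ∈ s, c i := by
    simp [Finset.sum_mul_sum]
  rw [this, mul_comm, Complex.mul_conj]
  exact_mod_cast Complex.normSq_nonneg _

theorem PosKer.add {k l : ι → ι → ℂ} (hk : PosKer k) (hl : PosKer l) :
    PosKer fun i j => k i j + l i j := Matrix.PosSemidef.add hk hl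

theorem PosKer.mul {k l : ι → ι → ℂ} (hk : PosKer k) (hl : PosKer l) :
    PosKer fun i j => k i j * l i j := Matrix.PosSemidef.hadamard hk hl

theorem PosKer.const_mul {k : ι → ι → ℂ} (hk : PosKer k) {r : ℝ} (hr : 0 ≤ r) :
    PosKer fun i j => (r : ℂ) * k i j :=
  Matrix.PosSemidef.smul hk (α := ℂ) (a := (r : ℂ)) (by exact_mod_cast hr)

theorem posKer_sum {κ : Type*} (s : Finset κ) {k : κ → ι → ι → ℂ} (hk : ∀ n ∈ s, PosKer (k n)) :
    PosKer fun i j => ∑ n ∈ s, k n i j := by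
  have h : Matrix.PosSemidef (∑ n ∈ s, Matrix.of (k n)) :=
    Matrix.posSemidef_sum s (x := fun n => Matrix.of (k n)) hk
  have h' : (∑ n ∈ s, Matrix.of (k n)) = Matrix.of fun i j => ∑ n ∈ s, k n i j := by
    ext i j
    simp [Matrix.sum_apply]
  exact (h' ▸ h :)

theorem PosKer.pow {k : ι → ι → ℂ} (hk : PosKer k) (n : ℕ) : PosKer fun i j => k i j ^ n := by
  induction n with
  | zero => simpa using posKer_one
  | succ n ih => simpa only [pow_succ] using ih.mul hk

theorem PosKer.exp_partial {k : ι → ι → ℂ} (hk : PosKer k) (s : Finset ℕ) :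
    PosKer fun i j => ∑ n ∈ s, k i j ^ n / (n.factorial : ℂ) := by
  refine posKer_sum s fun n _ => ?_
  have := (hk.pow n).const_mul (r := (n.factorial : ℝ)⁻¹) (by positivity)
  simpa [div_eq_inv_mul] using this

/-- The exponential series without its constant term has positive terms by Schur's product theorem,
and positivity passes to pointwise limits. -/
theorem PosKer.exp_sub_one {k : ι → ι → ℂ} (hk : PosKer k) :
    PosKer fun i j => Complex.exp (k i j) - 1 := by
  refine posKer_of_tendsto (l := atTop) (k := fun N i j =>
    ∑ n ∈ (Finset.range (N + 1)).erase 0, k i j ^ n / (n.factorial : ℂ))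
    (fun N => hk.exp_partial _) fun i j => ?_
  have h := (NormedSpace.expSeries_div_hasSum_exp (k i j)).tendsto_sum_nat
  have h2 := ((h.comp (tendsto_add_atTop_nat 1)).sub_const 1)
  rw [← Complex.exp_eq_exp_ℂ] at h2
  refine h2.congr fun N => ?_
  simp only [Function.comp]
  rw [← Finset.add_sum_erase _ _ (Finset.mem_range.2 (Nat.succ_pos N))]
  simp

theorem PosKer.exp {k : ι → ι → ℂ} (hk : PosKer k) : PosKer fun i j => Complex.exp (k i j) := by
  simpa using hk.exp_sub_one.add posKer_one

/-- Since e^l - e^k = e^k (e^(l-k) - 1), an inequality between one-particle inner products lifts to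
the Fock inner products. -/
theorem PosKer.exp_sub_exp {k l : ι → ι → ℂ} (hk : PosKer k)
    (hl : PosKer fun i j => l i j - k i j) :
    PosKer fun i j => Complex.exp (l i j) - Complex.exp (k i j) := by
  simpa [mul_sub, ← Complex.exp_add] using hk.exp.mul hl.exp_sub_one

/-- Kernels of operators: a positive product kernel gives a positive form. -/
theorem kerForm_nonneg {V : Type*} [AddCommGroup V] [Module ℂ V]
    {K : ι → ι → (V →ₗ⋆[ℂ] V →ₗ[ℂ] ℂ)}
    (h : PosKer fun x y : V × ι => K x.2 y.2 x.1 y.1) (ψ : ι →₀ V) : 0 ≤ kerForm K ψ ψ := by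
  simpa [kerForm_apply, Finsupp.sum] using h.sum_nonneg ψ.support (fun i => (ψ i, i)) fun _ => 1

end Kernel

/-! ### Forms on the space of test functions -/

section NoiseForms

variable {E : Type*} [AddCommGroup E] [Module ℂ E] [UniformSpace E] [IsUniformAddGroup E]
  [ContinuousSMul ℂ E] [HilbertScale E]

theorem IsNoise.smul {f : ℝ≥0 → E} (hf : IsNoise f) (c : ℂ) : IsNoise (fun s => c • f s) :=
  hf.map (c • ContinuousLinearMap.id ℂ E)

namespace NoiseFn

@[ext]
theorem ext {f g : NoiseFn E} (h : ∀ s, f s = g s) : f = g := by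
  cases f; cases g; congr; exact funext h

instance : Add (NoiseFn E) := ⟨fun f g => ⟨fun s => f s + g s, f.isNoise.add g.isNoise⟩⟩

instance : SMul ℂ (NoiseFn E) := ⟨fun c f => ⟨fun s => c • f s, f.isNoise.smul c⟩⟩

instance : Neg (NoiseFn E) := ⟨fun f => ⟨fun s => -f s, by simpa using f.isNoise.smul (-1)⟩⟩

@[simp] theorem zero_apply (s : ℝ≥0) : (0 : NoiseFn E) s = 0 := rfl
@[simp] theorem add_apply (f g : NoiseFn E) (s : ℝ≥0) : (f + g) s = f s + g s := rfl
@[simp] theorem smul_apply (c : ℂ) (f : NoiseFn E) (s : ℝ≥0) : (c • f) s = c • f s := rfl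

instance : AddCommGroup (NoiseFn E) where
  add_assoc f g h := ext fun s => add_assoc _ _ _
  zero_add f := ext fun s => zero_add _
  add_zero f := ext fun s => add_zero _
  nsmul := nsmulRec
  zsmul := zsmulRec
  neg_add_cancel f := ext fun s => neg_add_cancel _
  add_comm f g := ext fun s => add_comm _ _

instance : Module ℂ (NoiseFn E) where
  one_smul f := ext fun s => one_smul _ _
  mul_smul c d f := ext fun s => mul_smul _ _ _
  smul_zero c := ext fun s => smul_zero _
  smul_add c f g := ext fun s => smul_add _ _ _
  add_smul c d f := ext fun s => add_smul _ _ _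
  zero_smul f := ext fun s => zero_smul _ _

@[simp] theorem sub_apply (f g : NoiseFn E) (s : ℝ≥0) : (f - g) s = f s - g s := by
  rw [sub_eq_add_neg, sub_eq_add_neg]; rfl

end NoiseFn

theorem coreSeminorm_eq (c : InnerProductSpace.Core ℂ E) (x : E) :
    coreSeminorm c x = √(c.inner x x).re := rfl

theorem core_self (c : InnerProductSpace.Core ℂ E) (x : E) :
    c.inner x x = ((coreSeminorm c x ^ 2 : ℝ) : ℂ) := by
  have h0 : 0 ≤ (c.inner x x).re := c.re_inner_nonneg x
  rw [coreSeminorm_eq, Real.sq_sqrt h0]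
  refine Complex.ext rfl ?_
  have := congrArg Complex.im (c.conj_inner_symm x x)
  simp only [Complex.conj_im] at this
  simp only [Complex.ofReal_im]
  linarith

/-- The inner product of a core as a sesquilinear form. -/
def coreForm (c : InnerProductSpace.Core ℂ E) : E →ₗ⋆[ℂ] E →ₗ[ℂ] ℂ :=
  LinearMap.mk₂'ₛₗ (starRingEnd ℂ) (RingHom.id ℂ) c.inner
    (fun _ _ _ => c.add_left _ _ _) (fun _ _ _ => c.smul_left _ _ _)
    (fun _ _ _ => core_add_right _ _ _ _) (fun _ _ _ => core_smul_right _ _ _ _)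

theorem coreForm_apply (c : InnerProductSpace.Core ℂ E) (x y : E) :
    coreForm c x y = c.inner x y := rfl

theorem coreForm_self_nonneg (c : InnerProductSpace.Core ℂ E) (x : E) : 0 ≤ coreForm c x x := by
  rw [coreForm_apply, core_self]
  exact Complex.zero_le_real.2 (sq_nonneg _)

theorem norm_core_inner_le (c : InnerProductSpace.Core ℂ E) (x y : E) :
    ‖c.inner x y‖ ≤ coreSeminorm c x * coreSeminorm c y :=
  norm_form_le (coreForm_self_nonneg c) x y

/-- The inner product is dominated by the norms of the scale. -/
def Dominated (c : InnerProductSpace.Core ℂ E) : Prop := ∃ ξ, ∀ x, coreSeminorm c x ≤ nrmL ξ x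

theorem dominated_core : Dominated (HilbertScale.core (E := E)) := ⟨0, HilbertScale.core_le 0⟩

theorem dominated_level (ξ : ℕ) : Dominated (HilbertScale.level (E := E) ξ) := ⟨ξ, fun _ => le_rfl⟩

theorem Dominated.continuous {c : InnerProductSpace.Core ℂ E} (hc : Dominated c) :
    Continuous (coreSeminorm c) := by
  obtain ⟨ξ, h⟩ := hc
  exact Seminorm.continuous_of_le (nrmL_continuous ξ)
    (show coreSeminorm c ≤ coreSeminorm (HilbertScale.level ξ) from h)

/-- Domination controls the norm only; joint continuity of the inner product follows by
polarization. -/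
theorem Dominated.continuous_inner {c : InnerProductSpace.Core ℂ E} (hc : Dominated c) :
    Continuous fun x : E × E => c.inner x.1 x.2 := by
  have h : ∀ x y : E, c.inner x y = (((coreSeminorm c (x + y) : ℂ)) ^ 2 -
      (coreSeminorm c (x - y) : ℂ) ^ 2 + ((coreSeminorm c (x - Complex.I • y) : ℂ) ^ 2 -
        (coreSeminorm c (x + Complex.I • y) : ℂ) ^ 2) * Complex.I) / 4 := by
    intro x y
    have h0 : ∀ z, (coreSeminorm c z : ℂ) ^ 2 = coreForm c z z := fun z => by
      rw [coreForm_apply, core_self]; norm_cast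
    simp only [h0, ← coreForm_apply, map_add, map_sub, LinearMap.add_apply, LinearMap.sub_apply,
      map_smul, LinearMap.map_smulₛₗ, LinearMap.smul_apply, smul_eq_mul, Complex.conj_I]
    ring_nf
    simp only [Complex.I_sq]
    ring
  simp only [h]
  have hk := hc.continuous
  have hk' : Continuous fun x : E => (coreSeminorm c x : ℂ) := Complex.continuous_ofReal.comp hk
  have : ∀ F : E × E → E, Continuous F → Continuous fun x => (coreSeminorm c (F x) : ℂ) ^ 2 :=
    fun F hF => (hk'.comp hF).pow 2
  refine Continuous.div_const (((this _ ?_).sub (this _ ?_)).add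
    (((this _ ?_).sub (this _ ?_)).mul_const _)) _ <;> fun_prop

variable {c : InnerProductSpace.Core ℂ E}

theorem Dominated.aesm (hc : Dominated c) {f g : ℝ≥0 → E}
    (hf : AEStronglyMeasurable f timeMeasure) (hg : AEStronglyMeasurable g timeMeasure) :
    AEStronglyMeasurable (fun s => c.inner (f s) (g s)) timeMeasure :=
  hc.continuous_inner.comp_aestronglyMeasurable (hf.prodMk hg)

theorem Dominated.integrable_sq (hc : Dominated c) {f : ℝ≥0 → E} (hf : IsNoise f) :
    Integrable (fun s => coreSeminorm c (f s) ^ 2) timeMeasure := by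
  obtain ⟨ξ, h⟩ := id hc
  refine Integrable.mono' (hf.sq ξ) ((hc.continuous.comp_aestronglyMeasurable hf.aesm).pow 2)
    (Eventually.of_forall fun s => ?_)
  rw [Real.norm_of_nonneg (sq_nonneg _)]
  exact pow_le_pow_left₀ (apply_nonneg _ _) (h _) 2

theorem Dominated.integrable (hc : Dominated c) {f g : ℝ≥0 → E} (hf : IsNoise f)
    (hg : IsNoise g) : Integrable (fun s => c.inner (f s) (g s)) timeMeasure := by
  refine Integrable.mono' ((hc.integrable_sq hf).add (hc.integrable_sq hg))
    (hc.aesm hf.aesm hg.aesm) (Eventually.of_forall fun s => ?_)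
  refine (norm_core_inner_le c _ _).trans ?_
  simp only [Pi.add_apply]
  nlinarith [sq_nonneg (coreSeminorm c (f s) - coreSeminorm c (g s)),
    sq_nonneg (coreSeminorm c (f s)), sq_nonneg (coreSeminorm c (g s))]

theorem integrable_ip {f g : ℝ≥0 → E} (hf : IsNoise f) (hg : IsNoise g) :
    Integrable (fun s => ip (f s) (g s)) timeMeasure := dominated_core.integrable hf hg

/-- The form `∫ ⟨f'(s)|f(s)⟩ ds` on the test functions. -/
def noiseForm (c : InnerProductSpace.Core ℂ E) (hc : Dominated c) :
    NoiseFn E →ₗ⋆[ℂ] NoiseFn E →ₗ[ℂ] ℂ :=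
  LinearMap.mk₂'ₛₗ (starRingEnd ℂ) (RingHom.id ℂ)
    (fun f' f => ∫ s, c.inner (f' s) (f s) ∂timeMeasure)
    (fun f g h => by
      rw [← integral_add (hc.integrable f.isNoise h.isNoise) (hc.integrable g.isNoise h.isNoise)]
      exact integral_congr_ae (Eventually.of_forall fun s => c.add_left _ _ _))
    (fun r f g => by
      rw [smul_eq_mul, ← integral_const_mul]
      exact integral_congr_ae (Eventually.of_forall fun s => c.smul_left _ _ _))
    (fun f g h => by
      rw [← integral_add (hc.integrable f.isNoise g.isNoise) (hc.integrable f.isNoise h.isNoise)]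
      exact integral_congr_ae (Eventually.of_forall fun s => core_add_right _ _ _ _))
    (fun r f g => by
      rw [smul_eq_mul, ← integral_const_mul]
      exact integral_congr_ae (Eventually.of_forall fun s => core_smul_right _ _ _ _))

theorem noiseForm_self (hc : Dominated c) (f : NoiseFn E) :
    noiseForm c hc f f = ((∫ s, coreSeminorm c (f s) ^ 2 ∂timeMeasure : ℝ) : ℂ) := by
  refine Eq.trans ?_ integral_ofReal
  exact integral_congr_ae (Eventually.of_forall fun s => core_self _ _)

theorem noiseForm_nonneg (hc : Dominated c) (f : NoiseFn E) : 0 ≤ noiseForm c hc f f := by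
  rw [noiseForm_self]
  exact Complex.zero_le_real.2 (integral_nonneg fun s => sq_nonneg _)

/-- The form `⟨f'|f⟩` on the test functions. -/
def nForm : NoiseFn E →ₗ⋆[ℂ] NoiseFn E →ₗ[ℂ] ℂ := noiseForm _ dominated_core

/-- The form `⟨f'|f⟩(ξ)` on the test functions. -/
def nFormL (ξ : ℕ) : NoiseFn E →ₗ⋆[ℂ] NoiseFn E →ₗ[ℂ] ℂ := noiseForm _ (dominated_level ξ)

theorem nForm_apply (f' f : NoiseFn E) : nForm f' f = NoiseFn.inner f' f := rfl

theorem nForm_nonneg (f : NoiseFn E) : 0 ≤ nForm f f := noiseForm_nonneg _ f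

theorem nFormL_nonneg (ξ : ℕ) (f : NoiseFn E) : 0 ≤ nFormL ξ f f := noiseForm_nonneg _ f

theorem nFormL_self (ξ : ℕ) (f : NoiseFn E) :
    nFormL ξ f f = ((∫ s, nrmL ξ (f s) ^ 2 ∂timeMeasure : ℝ) : ℂ) := noiseForm_self _ f

theorem formNorm_nFormL_sq (ξ : ℕ) (f : NoiseFn E) :
    formNorm (nFormL ξ) f ^ 2 = ∫ s, nrmL ξ (f s) ^ 2 ∂timeMeasure := by
  rw [formNorm_sq (nFormL_nonneg ξ), nFormL_self, Complex.ofReal_re]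

/-- Convergence of test functions in all the norms. -/
def NTendsto (f : ℕ → NoiseFn E) (g : NoiseFn E) : Prop :=
  ∀ ξ, Tendsto (fun n => formNorm (nFormL ξ) (f n - g)) atTop (𝓝 0)

theorem nrmL_le_succ (ξ : ℕ) (x : E) : nrmL ξ x ≤ nrmL (ξ + 1) x := HilbertScale.level_mono ξ x

theorem nrmL_mono {ξ ζ : ℕ} (h : ξ ≤ ζ) (x : E) : nrmL ξ x ≤ nrmL ζ x :=
  monotone_nat_of_le_succ (f := fun ξ => nrmL ξ x) (fun n => nrmL_le_succ n x) h

theorem nrm_le (ξ : ℕ) (x : E) : nrm x ≤ nrmL ξ x := HilbertScale.core_le ξ x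

theorem nrm_nonneg (x : E) : 0 ≤ nrm x := apply_nonneg _ x

theorem formNorm_nForm_le (ξ : ℕ) (f : NoiseFn E) : formNorm nForm f ≤ formNorm (nFormL ξ) f := by
  refine Real.sqrt_le_sqrt ?_
  rw [nForm, noiseForm_self, nFormL_self, Complex.ofReal_re, Complex.ofReal_re]
  exact integral_mono (dominated_core.integrable_sq f.isNoise) (f.isNoise.sq ξ)
    fun s => pow_le_pow_left₀ (apply_nonneg _ _) (nrm_le ξ _) 2

theorem formNorm_nFormL_mono {ξ ζ : ℕ} (h : ξ ≤ ζ) (f : NoiseFn E) :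
    formNorm (nFormL ξ) f ≤ formNorm (nFormL ζ) f := by
  refine Real.sqrt_le_sqrt ?_
  rw [nFormL_self, nFormL_self, Complex.ofReal_re, Complex.ofReal_re]
  exact integral_mono (f.isNoise.sq ξ) (f.isNoise.sq ζ)
    fun s => pow_le_pow_left₀ (nrmL_nonneg _ _) (nrmL_mono h _) 2

theorem formNorm_nFormL_eq_zero (ξ : ℕ) {f : NoiseFn E} (hf : ∀ᵐ s ∂timeMeasure, f s = 0) :
    formNorm (nFormL ξ) f = 0 := by
  have : ∫ s, nrmL ξ (f s) ^ 2 ∂timeMeasure = 0 := by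
    rw [integral_eq_zero_of_ae]
    filter_upwards [hf] with s hs
    simp [hs, nrmL_zero]
  have h2 := formNorm_nFormL_sq ξ f
  rw [this] at h2
  exact pow_eq_zero_iff two_ne_zero |>.1 h2

theorem NTendsto.nForm {f f' : ℕ → NoiseFn E} {g g' : NoiseFn E} (hf : NTendsto f g)
    (hf' : NTendsto f' g') :
    Tendsto (fun n => QFlow.nForm (f' n) (f n)) atTop (𝓝 (QFlow.nForm g' g)) :=
  tendsto_form nForm_nonneg
    (squeeze_zero (fun _ => formNorm_nonneg _ _) (fun _ => formNorm_nForm_le 0 _) (hf 0))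
    (squeeze_zero (fun _ => formNorm_nonneg _ _) (fun _ => formNorm_nForm_le 0 _) (hf' 0))

theorem NTendsto.nFormL {f f' : ℕ → NoiseFn E} {g g' : NoiseFn E} (hf : NTendsto f g)
    (hf' : NTendsto f' g') (ξ : ℕ) :
    Tendsto (fun n => QFlow.nFormL ξ (f' n) (f n)) atTop (𝓝 (QFlow.nFormL ξ g' g)) :=
  tendsto_form (nFormL_nonneg ξ) (hf ξ) (hf' ξ)

end NoiseForms

/-! ### Fock norms -/

section FockNorm

variable {E : Type*} [AddCommGroup E] [Module ℂ E] [UniformSpace E] [IsUniformAddGroup E]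
  [ContinuousSMul ℂ E] [HilbertScale E]

/-- The kernel `exp ⟨f'|f⟩(ξ)` of the coherent vectors. -/
def fockKer (ξ : ℕ) (f' f : NoiseFn E) : ℂ := Complex.exp (nFormL ξ f' f)

theorem posKer_fockKer (ξ : ℕ) : PosKer (fockKer (E := E) ξ) :=
  (posKer_of_form (nFormL_nonneg ξ) id).exp

/-- The inner product number `ξ` of the Fock scale. -/
def fockForm (ξ : ℕ) : CoherentSpan E →ₗ⋆[ℂ] CoherentSpan E →ₗ[ℂ] ℂ := matForm (fockKer ξ)

theorem fockForm_nonneg (ξ : ℕ) (φ : CoherentSpan E) : 0 ≤ fockForm ξ φ φ :=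
  posKer_iff.1 (posKer_fockKer ξ) φ

theorem fockForm_single (ξ : ℕ) (f' f : NoiseFn E) (c' c : ℂ) :
    fockForm ξ (Finsupp.single f' c') (Finsupp.single f c) =
      (starRingEnd ℂ) c' * c * fockKer ξ f' f := matForm_single _ _ _ _ _

theorem fockNorm_eq (ξ : ℕ) (φ : CoherentSpan E) : fockNorm ξ φ = formNorm (fockForm ξ) φ := rfl

theorem fockNorm_nonneg (ξ : ℕ) (φ : CoherentSpan E) : 0 ≤ fockNorm ξ φ := Real.sqrt_nonneg _

theorem matForm_sub {ι : Type*} (k l : ι → ι → ℂ) (x : ι →₀ ℂ) :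
    matForm (fun i j => k i j - l i j) x x = matForm k x x - matForm l x x := by
  simp [matForm_apply, Finsupp.sum, mul_sub]

theorem PosKer.formNorm_le {ι : Type*} {k l : ι → ι → ℂ} (h : PosKer fun i j => l i j - k i j)
    (x : ι →₀ ℂ) : formNorm (matForm k) x ≤ formNorm (matForm l) x := by
  refine Real.sqrt_le_sqrt ?_
  have := (Complex.nonneg_iff.1 (posKer_iff.1 h x)).1
  rw [matForm_sub, Complex.sub_re] at this
  linarith

theorem posKer_nFormL_sub {ξ ζ : ℕ} (h : ξ ≤ ζ) :
    PosKer fun f' f : NoiseFn E => nFormL ζ f' f - nFormL ξ f' f := by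
  refine posKer_of_form (q := nFormL ζ - nFormL ξ) (fun f : NoiseFn E => ?_) id
  rw [LinearMap.sub_apply, LinearMap.sub_apply, ← formNorm_sq_complex (nFormL_nonneg ζ),
    ← formNorm_sq_complex (nFormL_nonneg ξ), ← Complex.ofReal_sub]
  exact Complex.zero_le_real.2 (sub_nonneg.2
    (pow_le_pow_left₀ (formNorm_nonneg _ _) (formNorm_nFormL_mono h f) 2))

theorem fockNorm_mono {ξ ζ : ℕ} (h : ξ ≤ ζ) (φ : CoherentSpan E) : fockNorm ξ φ ≤ fockNorm ζ φ :=
  (PosKer.exp_sub_exp (posKer_of_form (nFormL_nonneg ξ) id) (posKer_nFormL_sub h)).formNorm_le φ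

theorem fockNorm_single (ξ : ℕ) (f : NoiseFn E) (c : ℂ) :
    fockNorm ξ (Finsupp.single f c) = ‖c‖ * Real.exp (formNorm (nFormL ξ) f ^ 2 / 2) := by
  rw [fockNorm_eq, formNorm, fockForm_single, fockKer,
    ← formNorm_sq_complex (nFormL_nonneg ξ), mul_comm _ c, Complex.mul_conj, ← Complex.ofReal_exp,
    ← Complex.ofReal_mul, Complex.ofReal_re, Complex.normSq_eq_norm_sq, Real.exp_half,
    Real.sqrt_mul (sq_nonneg _), Real.sqrt_sq (norm_nonneg _)]

theorem fockNorm_smul (ξ : ℕ) (c : ℂ) (φ : CoherentSpan E) :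
    fockNorm ξ (c • φ) = ‖c‖ * fockNorm ξ φ := formNorm_smul (fockForm_nonneg ξ) _ _

theorem fockNorm_single_sub_sq (ξ : ℕ) (f g : NoiseFn E) :
    fockNorm ξ (Finsupp.single f 1 - Finsupp.single g 1) ^ 2 =
      (fockKer ξ f f - fockKer ξ f g - fockKer ξ g f + fockKer ξ g g).re := by
  rw [fockNorm_eq, formNorm_sq (fockForm_nonneg ξ)]
  simp only [map_sub, LinearMap.sub_apply, fockForm_single]
  simp
  ring

/-- The squared distance of two coherent vectors is a continuous expression in four inner products,
which all tend to ⟨h|h⟩(ξ). Having two families f and g serves both for Cauchy sequences and for the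
independence of a limit from the approximating sequence. -/
theorem tendsto_fockNorm_sub {ξ : ℕ} {α : Type*} {l : Filter α} {f g : α → NoiseFn E}
    {h : NoiseFn E}
    (hf : Tendsto (fun n => formNorm (nFormL ξ) (f n - h)) l (𝓝 0))
    (hg : Tendsto (fun n => formNorm (nFormL ξ) (g n - h)) l (𝓝 0)) :
    Tendsto (fun n => fockNorm ξ (Finsupp.single (f n) 1 - Finsupp.single (g n) 1)) l (𝓝 0) := by
  have hk : ∀ {a b : α → NoiseFn E},
      Tendsto (fun n => formNorm (nFormL ξ) (a n - h)) l (𝓝 0) →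
      Tendsto (fun n => formNorm (nFormL ξ) (b n - h)) l (𝓝 0) →
      Tendsto (fun n => fockKer ξ (a n) (b n)) l (𝓝 (fockKer ξ h h)) := fun ha hb =>
    (Complex.continuous_exp.tendsto _).comp (tendsto_form (nFormL_nonneg ξ) hb ha)
  have h1 := (((hk hf hf).sub (hk hf hg)).sub (hk hg hf)).add (hk hg hg)
  have h2 := (Complex.continuous_re.tendsto _).comp h1
  have h3 := (Real.continuous_sqrt.tendsto _).comp h2
  simp only [sub_self, zero_sub, neg_add_cancel, Complex.zero_re, Real.sqrt_zero] at h3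
  refine h3.congr fun n => ?_
  simp only [Function.comp]
  rw [← fockNorm_single_sub_sq, Real.sqrt_sq (fockNorm_nonneg _ _)]

/-- In the formal span, functions which agree almost everywhere still index different generators;
every Fock norm identifies them. -/
theorem fockNorm_sub_eq_zero (ξ : ℕ) {f g : NoiseFn E} (h : ∀ᵐ s ∂timeMeasure, f s = g s) :
    fockNorm ξ (Finsupp.single f 1 - Finsupp.single g 1) = 0 := by
  have h0 : formNorm (nFormL ξ) (f - g) = 0 := formNorm_nFormL_eq_zero ξ (by
    filter_upwards [h] with s hs
    simp [hs])
  have h1 : formNorm (nFormL ξ) (g - g) = 0 := by rw [sub_self]; exact formNorm_zero (nFormL_nonneg ξ)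
  have := tendsto_fockNorm_sub (ξ := ξ) (l := (atTop : Filter ℕ)) (f := fun _ => f)
    (g := fun _ => g) (h := g) (by simp only [h0]; exact tendsto_const_nhds)
    (by simp only [h1]; exact tendsto_const_nhds)
  exact tendsto_nhds_unique tendsto_const_nhds this

/-- Continuous functionals of the coherent vector `(f + μ k)^⊗` are entire functions of `μ`. -/
theorem differentiable_coherent {ξ : ℕ} {ℓ : CoherentSpan E →ₗ[ℂ] ℂ} {C : ℝ}
    (hℓ : ∀ φ, ‖ℓ φ‖ ≤ C * fockNorm ξ φ) (f k : NoiseFn E) :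
    Differentiable ℂ fun μ : ℂ => ℓ (Finsupp.single (f + μ • k) 1) := by
  obtain ⟨H, _, _, _, u, hd, hu⟩ := exists_hilbert (fockForm_nonneg (E := E) ξ)
  have hn : ∀ φ, ‖u φ‖ = fockNorm ξ φ := fun φ => by
    rw [norm_eq_sqrt_re_inner (𝕜 := ℂ), hu]; rfl
  have hb : ∀ φ, ‖ℓ φ‖ ≤ C * ‖u φ‖ := fun φ => by rw [hn]; exact hℓ φ
  set L := ℓ.extendOfNorm u
  have hL : ∀ φ, ℓ φ = L (u φ) := fun φ => (LinearMap.extendOfNorm_eq hd ⟨C, hb⟩ φ).symm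
  let v := (InnerProductSpace.toDual ℂ H).symm L
  have hv : ∀ φ, ℓ φ = inner ℂ v (u φ) := fun φ => by
    rw [hL, InnerProductSpace.toDual_symm_apply]
  -- The functional is the inner product with v, a limit of finite sums of coherent vectors. Pairing
  -- such a sum with the coherent vector of f + μk gives a finite sum of exponentials of affine
  -- functions of μ.
  have hw : ∀ n : ℕ, ∃ φ, ‖u φ - v‖ < 1 / ((n : ℝ) + 1) := fun n => by
    obtain ⟨φ, hφ⟩ := hd.exists_dist_lt v (by positivity : (0 : ℝ) < 1 / ((n : ℝ) + 1))
    exact ⟨φ, by rwa [dist_comm, dist_eq_norm] at hφ⟩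
  choose w hw using hw
  have hcont : Continuous fun μ : ℂ => formNorm (nFormL ξ) (f + μ • k) := by
    refine Real.continuous_sqrt.comp (Complex.continuous_re.comp ?_)
    simp only [map_add, LinearMap.add_apply, map_smul, LinearMap.map_smulₛₗ, LinearMap.smul_apply]
    have := Complex.continuous_conj
    fun_prop
  have hlim : TendstoLocallyUniformlyOn
      (fun (n : ℕ) (μ : ℂ) => inner ℂ (u (w n)) (u (Finsupp.single (f + μ • k) 1)))
      (fun μ => ℓ (Finsupp.single (f + μ • k) 1)) atTop Set.univ := by
    rw [tendstoLocallyUniformlyOn_univ, Metric.tendstoLocallyUniformly_iff]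
    intro ε hε μ
    -- A bound of the coherent vectors near μ; with it the convergence of u (w n) to v becomes
    -- locally uniform convergence of entire functions.
    set B := Real.exp (formNorm (nFormL ξ) (f + μ • k) ^ 2 / 2) + 1
    have hB : ∀ᶠ μ' in 𝓝 μ, Real.exp (formNorm (nFormL ξ) (f + μ' • k) ^ 2 / 2) < B :=
      ((Real.continuous_exp.comp ((hcont.pow 2).div_const 2)).tendsto μ).eventually_lt_const
        (by simp [B])
    refine ⟨_, hB, ?_⟩
    have hB0 : 0 < B := by positivity
    have ht := (tendsto_one_div_add_atTop_nhds_zero_nat (𝕜 := ℝ)).eventually_lt_const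
      (show 0 < ε / B by positivity)
    filter_upwards [ht] with n hn' μ' hμ'
    rw [hv, dist_comm, dist_eq_norm, ← inner_sub_left]
    refine (norm_inner_le_norm _ _).trans_lt ?_
    rw [hn, fockNorm_single, norm_one, one_mul]
    calc _ ≤ ‖u (w n) - v‖ * B := by gcongr
      _ < ε / B * B := by gcongr; exact (hw n).trans hn'
      _ = ε := by field_simp
  have hdiff : ∀ n : ℕ, DifferentiableOn ℂ
      (fun μ : ℂ => (inner ℂ (u (w n)) (u (Finsupp.single (f + μ • k) 1)) : ℂ)) Set.univ := by
    intro n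
    have : ∀ μ : ℂ, (inner ℂ (u (w n)) (u (Finsupp.single (f + μ • k) 1)) : ℂ) =
        ∑ f' ∈ (w n).support, (starRingEnd ℂ) (w n f') *
          Complex.exp (nFormL ξ f' f + μ * nFormL ξ f' k) := fun μ => by
      rw [hu, fockForm, matForm_apply, Finsupp.sum]
      refine Finset.sum_congr rfl fun f' _ => ?_
      simp [fockKer]
    simp only [this]
    fun_prop
  exact differentiableOn_univ.1 (hlim.differentiableOn (Eventually.of_forall hdiff) isOpen_univ)

end FockNorm

/-! ### Projective norms -/

section ProjNorm

variable {D E : Type*} [AddCommGroup D] [Module ℂ D] [UniformSpace D] [IsUniformAddGroup D]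
  [ContinuousSMul ℂ D] [HilbertScale D] [AddCommGroup E] [Module ℂ E] [UniformSpace E]
  [IsUniformAddGroup E] [ContinuousSMul ℂ E] [HilbertScale E]

theorem coh_smul (c : ℂ) (η : D) (f : NoiseFn E) : coh (c • η) f = c • coh η f :=
  (Finsupp.smul_single _ _ _).symm

theorem coh_zero (f : NoiseFn E) : coh (0 : D) f = 0 := Finsupp.single_zero _

/-- The map `φ ↦ η ⊗ φ`. -/
def tensMap (η : D) : CoherentSpan E →ₗ[ℂ] DSpan D E :=
  Finsupp.mapRange.linearMap (LinearMap.toSpanSingleton ℂ D η)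

theorem tensMap_apply (η : D) (φ : CoherentSpan E) : tensMap η φ = tens η φ := rfl

theorem tens_single (η : D) (f : NoiseFn E) (c : ℂ) :
    tens η (Finsupp.single f c) = coh (c • η) f := Finsupp.mapRange_single

theorem tens_eq_sum (η : D) (φ : CoherentSpan E) : tens η φ = φ.sum fun f c => coh (c • η) f := by
  conv_lhs => rw [← Finsupp.sum_single φ, ← tensMap_apply, Finsupp.sum, map_sum]
  exact Finset.sum_congr rfl fun f _ => tens_single _ _ _

theorem eq_sum_coh (ψ : DSpan D E) : ψ = ψ.sum fun f η => coh η f := (Finsupp.sum_single ψ).symm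

theorem exists_tens (ψ : DSpan D E) : ∃ (n : ℕ) (η : Fin n → D) (φ : Fin n → CoherentSpan E),
    ψ = ∑ i, tens (η i) (φ i) := by
  let e := ψ.support.equivFin
  refine ⟨_, fun i => ψ (e.symm i).1, fun i => Finsupp.single (e.symm i).1 1, ?_⟩
  conv_lhs => rw [eq_sum_coh ψ, Finsupp.sum, ← Finset.sum_coe_sort]
  rw [← e.symm.sum_comp]
  simp [tens_single]

theorem projNorm_term_nonneg (p ξ : ℕ) {n : ℕ} (η : Fin n → D) (φ : Fin n → CoherentSpan E) :
    0 ≤ ∑ i, nrmL p (η i) * fockNorm ξ (φ i) :=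
  Finset.sum_nonneg fun _ _ => mul_nonneg (nrmL_nonneg _ _) (fockNorm_nonneg _ _)

theorem projNorm_nonneg (p ξ : ℕ) (ψ : DSpan D E) : 0 ≤ projNorm p ξ ψ := by
  refine Real.sInf_nonneg ?_
  rintro _ ⟨n, η, φ, -, rfl⟩
  exact projNorm_term_nonneg _ _ _ _

theorem projNorm_le_sum (p ξ : ℕ) {n : ℕ} (η : Fin n → D) (φ : Fin n → CoherentSpan E) :
    projNorm p ξ (∑ i, tens (η i) (φ i)) ≤ ∑ i, nrmL p (η i) * fockNorm ξ (φ i) := by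
  refine csInf_le ⟨0, ?_⟩ ⟨n, η, φ, rfl, rfl⟩
  rintro _ ⟨n, η, φ, -, rfl⟩
  exact projNorm_term_nonneg _ _ _ _

theorem projNorm_tens_le (p ξ : ℕ) (η : D) (φ : CoherentSpan E) :
    projNorm p ξ (tens η φ) ≤ nrmL p η * fockNorm ξ φ := by
  simpa using projNorm_le_sum p ξ (fun _ : Fin 1 => η) fun _ => φ

theorem le_projNorm {p ξ : ℕ} {r : ℝ} {ψ : DSpan D E}
    (h : ∀ (n : ℕ) (η : Fin n → D) (φ : Fin n → CoherentSpan E), ψ = ∑ i, tens (η i) (φ i) →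
      r ≤ ∑ i, nrmL p (η i) * fockNorm ξ (φ i)) : r ≤ projNorm p ξ ψ := by
  refine le_csInf ?_ ?_
  · obtain ⟨n, η, φ, hψ⟩ := exists_tens ψ
    exact ⟨_, n, η, φ, hψ, rfl⟩
  · rintro _ ⟨n, η, φ, hψ, rfl⟩
    exact h n η φ hψ

theorem projNorm_mono {p p' ξ ξ' : ℕ} (hp : p ≤ p') (hξ : ξ ≤ ξ') (ψ : DSpan D E) :
    projNorm p ξ ψ ≤ projNorm p' ξ' ψ := by
  refine le_projNorm fun n η φ hψ => ?_
  rw [hψ]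
  refine (projNorm_le_sum p ξ η φ).trans (Finset.sum_le_sum fun i _ => ?_)
  exact mul_le_mul (nrmL_mono hp _) (fockNorm_mono hξ _) (fockNorm_nonneg _ _) (nrmL_nonneg _ _)

theorem projNorm_smul_le (p ξ : ℕ) (c : ℂ) (ψ : DSpan D E) :
    projNorm p ξ (c • ψ) ≤ ‖c‖ * projNorm p ξ ψ := by
  rcases eq_or_ne c 0 with rfl | hc
  · have := projNorm_le_sum p ξ (fun i : Fin 0 => (0 : D)) (fun _ => (0 : CoherentSpan E))
    simpa using this
  · rw [← div_le_iff₀' (norm_pos_iff.2 hc)]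
    refine le_projNorm fun n η φ hψ => ?_
    rw [div_le_iff₀' (norm_pos_iff.2 hc), hψ, Finset.smul_sum, Finset.mul_sum]
    have := projNorm_le_sum p ξ η fun i => c • φ i
    simp only [← tensMap_apply, map_smul] at this ⊢
    refine this.trans_eq (Finset.sum_congr rfl fun i _ => ?_)
    rw [fockNorm_smul]
    ring

/-- The projective norm is the largest seminorm with these values on the product vectors, so an
estimate there suffices by the triangle inequality. The case C = 0 is separate because the argument
divides by C. -/
theorem formNorm_le_projNorm {q : QForm D E} (hq : ∀ ψ, 0 ≤ q ψ ψ) {p ξ : ℕ} {C : ℝ} (hC : 0 ≤ C)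
    (h : ∀ η φ, formNorm q (tens η φ) ≤ C * nrmL p η * fockNorm ξ φ) (ψ : DSpan D E) :
    formNorm q ψ ≤ C * projNorm p ξ ψ := by
  rcases hC.eq_or_lt with rfl | hC
  · obtain ⟨n, η, φ, hψ⟩ := exists_tens ψ
    rw [hψ, zero_mul]
    refine (formNorm_sum_le hq _ _).trans (Finset.sum_nonpos fun i _ => ?_)
    simpa using h (η i) (φ i)
  · rw [← div_le_iff₀' hC]
    refine le_projNorm fun n η φ hψ => ?_
    rw [div_le_iff₀' hC, hψ, Finset.mul_sum]
    refine (formNorm_sum_le hq _ _).trans (Finset.sum_le_sum fun i _ => ?_)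
    simpa only [mul_assoc] using h (η i) (φ i)

theorem QContinuous.exists_bound {Y : QForm D E} (hY : QContinuous Y) : ∃ (p ξ : ℕ) (C : ℝ),
    0 ≤ C ∧ ∀ ψ' ψ, ‖Y ψ' ψ‖ ≤ C * projNorm p ξ ψ' * projNorm p ξ ψ := by
  obtain ⟨p, ξ, C, h⟩ := hY
  refine ⟨p, ξ, |C|, abs_nonneg _, fun ψ' ψ => (h ψ' ψ).trans ?_⟩
  have := le_abs_self C
  have h1 := projNorm_nonneg p ξ ψ'
  have h2 := projNorm_nonneg p ξ ψ
  gcongr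

/-- The bounds of a continuous form in the right argument. -/
theorem QContinuous.right_bound {Y : QForm D E} (hY : QContinuous Y) (ψ' : DSpan D E) (η : D) :
    ∃ (ξ : ℕ) (C : ℝ), 0 ≤ C ∧ ∀ φ, ‖Y ψ' (tens η φ)‖ ≤ C * fockNorm ξ φ := by
  obtain ⟨p, ξ, C, hC, h⟩ := hY.exists_bound
  refine ⟨ξ, C * projNorm p ξ ψ' * nrmL p η, by
    have h1 := projNorm_nonneg p ξ ψ'
    have h2 := nrmL_nonneg p η
    positivity, fun φ => (h _ _).trans ?_⟩
  rw [mul_assoc _ (nrmL p η)]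
  have h1 := projNorm_nonneg p ξ ψ'
  gcongr
  exact projNorm_tens_le _ _ _ _

/-- The transposed conjugate form. -/
def formAdj {V : Type*} [AddCommGroup V] [Module ℂ V] (Y : V →ₗ⋆[ℂ] V →ₗ[ℂ] ℂ) :
    V →ₗ⋆[ℂ] V →ₗ[ℂ] ℂ :=
  LinearMap.mk₂'ₛₗ (starRingEnd ℂ) (RingHom.id ℂ) (fun ψ' ψ => (starRingEnd ℂ) (Y ψ ψ'))
    (by simp) (by simp) (by simp) (by simp)

theorem formAdj_apply {V : Type*} [AddCommGroup V] [Module ℂ V] (Y : V →ₗ⋆[ℂ] V →ₗ[ℂ] ℂ)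
    (ψ' ψ : V) : formAdj Y ψ' ψ = (starRingEnd ℂ) (Y ψ ψ') := rfl

/-- Statements proved for the right argument of a continuous form reach the left one through the
adjoint form. -/
theorem QContinuous.formAdj {Y : QForm D E} (hY : QContinuous Y) : QContinuous (formAdj Y) := by
  obtain ⟨p, ξ, C, h⟩ := hY
  refine ⟨p, ξ, C, fun ψ' ψ => ?_⟩
  rw [formAdj_apply, RCLike.norm_conj]
  exact (h ψ ψ').trans_eq (by ring)

theorem QContinuous.right_congr {Y : QForm D E} (hY : QContinuous Y) (ψ' : DSpan D E) (η : D)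
    {f g : NoiseFn E} (h : ∀ᵐ s ∂timeMeasure, f s = g s) :
    Y ψ' (coh η f) = Y ψ' (coh η g) := by
  obtain ⟨ξ, C, -, hb⟩ := hY.right_bound ψ' η
  have := hb (Finsupp.single f 1 - Finsupp.single g 1)
  rw [fockNorm_sub_eq_zero ξ h, mul_zero, ← tensMap_apply, map_sub, tensMap_apply, tensMap_apply,
    tens_single, tens_single, one_smul, map_sub, norm_le_zero_iff, sub_eq_zero] at this
  exact this

theorem QContinuous.differentiable {Y : QForm D E} (hY : QContinuous Y) (ψ' : DSpan D E) (η : D)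
    (f k : NoiseFn E) : Differentiable ℂ fun μ : ℂ => Y ψ' (coh η (f + μ • k)) := by
  obtain ⟨ξ, C, -, hb⟩ := hY.right_bound ψ' η
  have := differentiable_coherent (ℓ := (Y ψ').comp (tensMap η)) hb f k
  simpa [tensMap_apply, tens_single] using this

theorem QContinuous.norm_coh_le {Y : QForm D E} (hY : QContinuous Y) (ψ' : DSpan D E) (η : D) :
    ∃ (ξ : ℕ) (C : ℝ), 0 ≤ C ∧
      ∀ f, ‖Y ψ' (coh η f)‖ ≤ C * Real.exp (formNorm (nFormL ξ) f ^ 2 / 2) := by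
  obtain ⟨ξ, C, hC, hb⟩ := hY.right_bound ψ' η
  refine ⟨ξ, C, hC, fun f => ?_⟩
  simpa [tens_single, fockNorm_single] using hb (Finsupp.single f 1)

end ProjNorm

/-! ### Exponential operators of step functions -/

section Weyl

namespace HPAlg

variable {E : Type*} [AddCommGroup E] [Module ℂ E] [UniformSpace E] [IsUniformAddGroup E]
  [ContinuousSMul ℂ E] [HilbertScale E]

instance : IsScalarTower ℂ (HPAlg E) (HPAlg E) :=
  ⟨fun c a b => by ext <;> simp [ip_smul_left]⟩

instance : SMulCommClass ℂ (HPAlg E) (HPAlg E) :=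
  ⟨fun c a b => by ext <;> simp [ip_smul_right]⟩

instance : StarModule ℂ (HPAlg E) := ⟨fun c a => by ext <;> simp⟩

end HPAlg

variable {E : Type*} [AddCommGroup E] [Module ℂ E] [UniformSpace E] [IsUniformAddGroup E]
  [ContinuousSMul ℂ E] [HilbertScale E] {𝔞 : NonUnitalStarSubalgebra ℂ (HPAlg E)}

namespace StepFn

@[simp] theorem zero_apply (s : ℝ≥0) : (0 : StepFn 𝔞) s = 0 := rfl

@[simp] theorem star_apply (g : StepFn 𝔞) (s : ℝ≥0) : (star g) s = star (g s) := rfl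

theorem starProd_apply (g h : StepFn 𝔞) (s : ℝ≥0) :
    (g.starProd h) s = h s + star (g s) * h s + star (g s) := rfl

theorem ext' {g h : StepFn 𝔞} (H : ∀ s, g s = h s) : g = h := StepFn.ext (funext H)

theorem const_apply (t : ℝ≥0) (a : 𝔞) (s : ℝ≥0) : (const t a) s = if s < t then a else 0 := by
  simp only [const]

@[simp] theorem star_star (g : StepFn 𝔞) : star (star g) = g := ext' fun s => _root_.star_star _

theorem star_starProd (g h : StepFn 𝔞) : star (g.starProd h) = h.starProd g := ext' fun s => by
  simp only [star_apply, starProd_apply, star_add, star_mul, _root_.star_star]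
  abel

/-- With a formal unit, 1 + g ⋆ h = (1 + g)^⋆(1 + h); both sides here correspond to (1 + k)^⋆(1 +
g)(1 + h). This identity is what makes the reconstructed form commute with W(g). -/
theorem starProd_starProd (g k h : StepFn 𝔞) :
    k.starProd ((star g).starProd h) = (g.starProd k).starProd h := ext' fun s => by
  simp only [star_apply, starProd_apply, star_add, star_mul, _root_.star_star, mul_add, add_mul,
    mul_assoc]
  abel

theorem star_const (t : ℝ≥0) (a : 𝔞) : star (const t a) = const t (star a) := ext' fun s => by
  simp only [star_apply, const_apply]
  split_ifs <;> simp

/-- The function equal to `b` on `[0, s)`, to `a` on `[s, t)` and to `0` on `[t, ∞)`. -/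
def twoStep (s t : ℝ≥0) (b a : 𝔞) : StepFn 𝔞 :=
  ⟨fun r => open Classical in if r < s then b else if r < t then a else 0,
    ⟨{s, t}, fun r r' h => by simp [(h s (by simp)).1, (h t (by simp)).1]⟩,
    ⟨max s t, fun r hr => by
      simp [not_lt.2 ((le_max_left _ _).trans hr), not_lt.2 ((le_max_right _ _).trans hr)]⟩⟩

theorem twoStep_apply (s t : ℝ≥0) (b a : 𝔞) (r : ℝ≥0) :
    (twoStep s t b a) r = if r < s then b else if r < t then a else 0 := by
  simp only [twoStep]

theorem star_twoStep (s t : ℝ≥0) (b a : 𝔞) :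
    star (twoStep s t b a) = twoStep s t (star b) (star a) := ext' fun r => by
  simp only [star_apply, twoStep_apply]
  split_ifs <;> simp

/-- The restriction of a step function to `[0, t)`. -/
def cut (t : ℝ≥0) (g : StepFn 𝔞) : StepFn 𝔞 :=
  ⟨fun s => open Classical in if s < t then g s else 0,
    (show IsStep (fun s : ℝ≥0 => open Classical in if s < t then True else False) from
      ⟨{t}, fun s s' h => by simp [(h t (by simp)).1]⟩).map₂ g.isStep
        (fun p a => open Classical in if p then a else 0) |> fun h => by
        convert h using 2 with s
        simp,
    ⟨t, fun s hs => by simp [not_lt.2 hs]⟩⟩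

theorem cut_apply (t : ℝ≥0) (g : StepFn 𝔞) (s : ℝ≥0) : (cut t g) s = if s < t then g s else 0 := by
  simp only [cut]

end StepFn

theorem zero_mem_stepsBefore (t : ℝ≥0) : (0 : StepFn 𝔞) ∈ stepsBefore 𝔞 t := fun _ _ => rfl

theorem cut_mem_stepsBefore (t : ℝ≥0) (g : StepFn 𝔞) : g.cut t ∈ stepsBefore 𝔞 t := fun s hs => by
  rw [StepFn.cut_apply, if_neg (not_lt.2 hs)]

theorem star_mem_stepsBefore {t : ℝ≥0} {g : StepFn 𝔞} (hg : g ∈ stepsBefore 𝔞 t) :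
    star g ∈ stepsBefore 𝔞 t := fun s hs => by simp [hg s hs]

theorem starProd_mem_stepsBefore {t : ℝ≥0} {g h : StepFn 𝔞} (hg : g ∈ stepsBefore 𝔞 t)
    (hh : h ∈ stepsBefore 𝔞 t) : g.starProd h ∈ stepsBefore 𝔞 t := fun s hs => by
  simp [StepFn.starProd_apply, hg s hs, hh s hs]

theorem stepsBefore_mono {s t : ℝ≥0} (h : s ≤ t) : stepsBefore 𝔞 s ⊆ stepsBefore 𝔞 t :=
  fun _ hg r hr => hg r (h.trans hr)

theorem integrable_step (g : StepFn 𝔞) (φ : 𝔞 → ℂ) (hφ : φ 0 = 0) :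
    Integrable (fun s => φ (g s)) timeMeasure := by
  obtain ⟨hfin, hmeas⟩ := g.isStep.factor
  obtain ⟨t, ht⟩ := g.bounded
  have hm : Measurable fun s => φ (g s) := fun B _ => hmeas (φ ⁻¹' B)
  obtain ⟨M, hM⟩ := (hfin.image fun a => ‖φ a‖).bddAbove
  have hon : IntegrableOn (fun s => φ (g s)) (Set.Iio t) timeMeasure :=
    Measure.integrableOn_of_bounded (M := M) (timeMeasure_Iio_lt_top t).ne
      hm.aestronglyMeasurable (Eventually.of_forall fun s => hM ⟨_, ⟨s, rfl⟩, rfl⟩)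
  refine (integrable_indicator_iff measurableSet_Iio |>.2 hon).congr
    (Eventually.of_forall fun s => ?_)
  by_cases hs : s < t
  · simp [Set.indicator, hs]
  · simp [Set.indicator, hs, ht s (not_lt.1 hs), hφ]

theorem isNoise_crea (g : StepFn 𝔞) : IsNoise fun s => (g s).1.crea := by
  simpa using isNoise_shift g 0

theorem isNoise_anni (g : StepFn 𝔞) : IsNoise fun s => (g s).1.anni := isNoise_crea (star g)

theorem isNoise_gauge (g : StepFn 𝔞) (f : NoiseFn E) : IsNoise fun s => (g s).1.gauge (f s) := by
  have h := ((isNoise_shift g f).add ((f.isNoise.smul (-1)))).add ((isNoise_crea g).smul (-1))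
  convert h using 2 with s
  simp
  abel

/-- The test function `g^•_+`. -/
def creaFn (g : StepFn 𝔞) : NoiseFn E := ⟨_, isNoise_crea g⟩

@[simp] theorem creaFn_apply (g : StepFn 𝔞) (s : ℝ≥0) : creaFn g s = (g s).1.crea := rfl

theorem weylShift_apply (g : StepFn 𝔞) (f : NoiseFn E) (s : ℝ≥0) :
    weylShift g f s = f s + (g s).1.gauge (f s) + (g s).1.crea := rfl

theorem weylShift_zero_right (g : StepFn 𝔞) : weylShift g 0 = creaFn g := NoiseFn.ext fun s => by
  simp [weylShift_apply]

theorem weylShift_zero_left (f : NoiseFn E) : weylShift (0 : StepFn 𝔞) f = f :=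
  NoiseFn.ext fun s => by simp [weylShift_apply]

/-- The exponent of `weylFactor`. -/
def weylExp (g : StepFn 𝔞) (f : NoiseFn E) : ℂ :=
  ∫ s, (ip (g s).1.anni (f s) + (g s).1.time) ∂timeMeasure

theorem weylFactor_eq (g : StepFn 𝔞) (f : NoiseFn E) :
    weylFactor g f = Complex.exp (weylExp g f) := rfl

theorem integrable_weylExp (g : StepFn 𝔞) (f : NoiseFn E) :
    Integrable (fun s => ip (g s).1.anni (f s) + (g s).1.time) timeMeasure :=
  (integrable_ip (isNoise_anni g) f.isNoise).add
    (integrable_step g (fun a => a.1.time) rfl)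

theorem weylFactor_zero (f : NoiseFn E) : weylFactor (0 : StepFn 𝔞) f = 1 := by
  simp [weylFactor, ip_zero_left]

theorem weylShift_starProd (g h : StepFn 𝔞) (f : NoiseFn E) :
    weylShift (g.starProd h) f = weylShift (star g) (weylShift h f) := NoiseFn.ext fun s => by
  simp [weylShift_apply, StepFn.starProd_apply]
  abel

/-- The cocycle identity behind W(g ⋆ h) = W(g^⋆)W(h): the cross terms match after moving the gauge
part of h across the inner product. -/
theorem weylExp_starProd (g h : StepFn 𝔞) (f : NoiseFn E) :
    weylExp (g.starProd h) f = weylExp (star g) (weylShift h f) + weylExp h f := by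
  rw [weylExp, weylExp, weylExp, ← integral_add (integrable_weylExp _ _) (integrable_weylExp _ _)]
  refine integral_congr_ae (Eventually.of_forall fun s => ?_)
  simp [weylShift_apply, StepFn.starProd_apply, HPAlg.ip_add_left, HPAlg.ip_add_right,
    (h s).1.adjoint]
  ring

theorem weylExp_zero_right (g : StepFn 𝔞) :
    weylExp g 0 = ∫ s, (g s).1.time ∂timeMeasure := by
  simp [weylExp, HPAlg.ip_zero_right]

/-- Linear dependence of the shift on the step function. -/
theorem weylShift_comb {g g₁ g₂ : StepFn 𝔞} {ν μ : ℂ} (h : ∀ s, g s = ν • g₁ s + μ • g₂ s)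
    (f : NoiseFn E) :
    weylShift g f = f + ν • (weylShift g₁ f - f) + μ • (weylShift g₂ f - f) :=
  NoiseFn.ext fun s => by
    simp [weylShift_apply, h]
    module

theorem weylExp_comb {g g₁ g₂ : StepFn 𝔞} {ν μ : ℂ} (h : ∀ s, g s = ν • g₁ s + μ • g₂ s)
    (f : NoiseFn E) : weylExp g f = ν * weylExp g₁ f + μ * weylExp g₂ f := by
  simp only [weylExp]
  rw [← integral_const_mul, ← integral_const_mul,
    ← integral_add ((integrable_weylExp _ _).const_mul _) ((integrable_weylExp _ _).const_mul _)]
  refine integral_congr_ae (Eventually.of_forall fun s => ?_)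
  simp [h, HPAlg.ip_add_left, HPAlg.ip_smul_left]
  ring

variable {D : Type*} [AddCommGroup D] [Module ℂ D] [UniformSpace D] [IsUniformAddGroup D]
  [ContinuousSMul ℂ D] [HilbertScale D]

theorem DSpan.hom_ext {M : Type*} [AddCommGroup M] [Module ℂ M] {S T : DSpan D E →ₗ[ℂ] M}
    (h : ∀ η f, S (coh η f) = T (coh η f)) : S = T :=
  Finsupp.lhom_ext fun f η => h η f

theorem weyl_starProd (g h : StepFn 𝔞) (ψ : DSpan D E) :
    weyl (g.starProd h) ψ = weyl (star g) (weyl h ψ) := by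
  have : (weyl (g.starProd h) : DSpan D E →ₗ[ℂ] DSpan D E) = weyl (star g) ∘ₗ weyl h := by
    refine DSpan.hom_ext fun η f => ?_
    rw [LinearMap.comp_apply, weyl_coh, weyl_coh, map_smul, weyl_coh, smul_smul,
      weylShift_starProd, weylFactor_eq, weylFactor_eq, weylFactor_eq, ← Complex.exp_add,
      weylExp_starProd, add_comm]
  rw [this]; rfl

theorem weyl_zero (ψ : DSpan D E) : weyl (0 : StepFn 𝔞) ψ = ψ := by
  have : (weyl (0 : StepFn 𝔞) : DSpan D E →ₗ[ℂ] DSpan D E) = LinearMap.id := by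
    refine DSpan.hom_ext fun η f => ?_
    rw [weyl_coh, weylFactor_zero, weylShift_zero_left, one_smul]; rfl
  rw [this]; rfl

/-- The form `Y` commutes with the exponential operator `W(g)`. -/
def CommutesWeyl (Y : QForm D E) (g : StepFn 𝔞) : Prop :=
  ∀ ψ' ψ, Y ψ' (weyl g ψ) = Y (weyl (star g) ψ') ψ

theorem commutesWeyl_iff {Y : QForm D E} {g : StepFn 𝔞} :
    CommutesWeyl Y g ↔ ∀ η' f' η f,
      weylFactor g f * Y (coh η' f') (coh η (weylShift g f)) =
        (starRingEnd ℂ) (weylFactor (star g) f') *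
          Y (coh η' (weylShift (star g) f')) (coh η f) := by
  have h : ∀ η' f' η f, (Y (coh η' f') (weyl g (coh η f)) =
      Y (weyl (star g) (coh η' f')) (coh η f)) ↔
      (weylFactor g f * Y (coh η' f') (coh η (weylShift g f)) =
        (starRingEnd ℂ) (weylFactor (star g) f') *
          Y (coh η' (weylShift (star g) f')) (coh η f)) := fun η' f' η f => by
    rw [weyl_coh, weyl_coh, map_smul, LinearMap.map_smulₛₗ, LinearMap.smul_apply, smul_eq_mul,
      smul_eq_mul]
  simp only [← h]
  refine ⟨fun H η' f' η f => H _ _, fun H ψ' ψ => ?_⟩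
  rw [eq_sum_coh ψ, eq_sum_coh ψ']
  simp only [Finsupp.sum, map_sum, LinearMap.sum_apply, H]

/-- The function g^⋆ ⋆ h = g + h + gh belongs to the product W(g)W(h), so the step functions
commuting with Y are closed under this composition. -/
theorem CommutesWeyl.starProd {Y : QForm D E} {g h : StepFn 𝔞} (hg : CommutesWeyl Y g)
    (hh : CommutesWeyl Y h) : CommutesWeyl Y ((star g).starProd h) := fun ψ' ψ => by
  rw [weyl_starProd, StepFn.star_star, hg, hh, StepFn.star_starProd, weyl_starProd]

theorem commutesWeyl_zero (Y : QForm D E) : CommutesWeyl Y (0 : StepFn 𝔞) := fun ψ' ψ => by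
  have : star (0 : StepFn 𝔞) = 0 := StepFn.ext' fun s => by simp
  rw [this, weyl_zero, weyl_zero]

theorem weyl_congr_ae {Y : QForm D E} (hY : QContinuous Y) {g h : StepFn 𝔞}
    (H : ∀ᵐ s ∂timeMeasure, g s = h s) (ψ' : DSpan D E) (η : D) (f : NoiseFn E) :
    Y ψ' (weyl g (coh η f)) = Y ψ' (weyl h (coh η f)) := by
  rw [weyl_coh, weyl_coh, map_smul, map_smul]
  congr 1
  · rw [weylFactor, weylFactor]
    congr 1
    refine integral_congr_ae ?_
    filter_upwards [H] with s hs
    simp only [hs]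
  · refine hY.right_congr _ _ ?_
    filter_upwards [H] with s hs
    simp only [weylShift_apply, hs]

/-- A step function may take arbitrary values at its breakpoints, which products of functions on
half-open intervals do not reproduce; continuous forms ignore null sets. -/
theorem CommutesWeyl.congr_ae {Y : QForm D E} (hY : QContinuous Y) {g h : StepFn 𝔞}
    (hg : CommutesWeyl Y g) (H : ∀ᵐ s ∂timeMeasure, g s = h s) : CommutesWeyl Y h := by
  have H' : ∀ᵐ s ∂timeMeasure, (star g) s = (star h) s := by
    filter_upwards [H] with s hs
    simp [hs]
  intro ψ' ψ
  rw [eq_sum_coh ψ, eq_sum_coh ψ']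
  simp only [Finsupp.sum, map_sum, LinearMap.sum_apply]
  refine Finset.sum_congr rfl fun f _ => Finset.sum_congr rfl fun f' _ => ?_
  rw [← weyl_congr_ae hY H, hg]
  have := weyl_congr_ae hY.formAdj H' (coh (ψ f) f) (ψ' f') f'
  simp only [formAdj_apply] at this
  exact (starRingEnd ℂ).injective this

end Weyl

/-! ### Commutation with the exponential operators of all step functions -/

section CommuteSteps

/-- An entire function vanishing to infinite order at `0` is zero. -/
theorem eq_zero_of_infinite_order {h : ℂ → ℂ} (hd : Differentiable ℂ h)
    (hb : ∀ N : ℕ, ∃ M : ℝ, ∀ μ, ‖μ‖ ≤ 1 → ‖h μ‖ ≤ M * ‖μ‖ ^ N) (μ : ℂ) : h μ = 0 := by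
  have han : AnalyticOnNhd ℂ h Set.univ := fun z _ => hd.analyticAt z
  have h0 : ∀ᶠ z in 𝓝 (0 : ℂ), h z = 0 := by
    -- Otherwise h(z) = z^n g(z) near 0 with g(0) ≠ 0, and the estimate of order n + 1 forces ‖g(z)‖
    -- ≤ M‖z‖, hence g(0) = 0.
    by_contra hcon
    obtain ⟨n, g, hg, hg0, heq⟩ :=
      (hd.analyticAt 0).exists_eventuallyEq_pow_smul_nonzero_iff.2 hcon
    obtain ⟨M, hM⟩ := hb (n + 1)
    have hlim : Tendsto (fun z => ‖g z‖) (𝓝[≠] (0 : ℂ)) (𝓝 ‖g 0‖) :=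
      (hg.continuousAt.norm.tendsto).mono_left nhdsWithin_le_nhds
    have hlim2 : Tendsto (fun z : ℂ => M * ‖z‖) (𝓝[≠] (0 : ℂ)) (𝓝 0) := by
      have : Tendsto (fun z : ℂ => M * ‖z‖) (𝓝 0) (𝓝 (M * ‖(0 : ℂ)‖)) :=
        (continuous_const.mul continuous_norm).tendsto _
      rw [norm_zero, mul_zero] at this
      exact this.mono_left nhdsWithin_le_nhds
    have hle : ∀ᶠ z in 𝓝[≠] (0 : ℂ), ‖g z‖ ≤ M * ‖z‖ := by
      have hball : ∀ᶠ z in 𝓝 (0 : ℂ), ‖z‖ < 1 :=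
        (continuous_norm.tendsto (0 : ℂ)).eventually_lt_const (by simp)
      filter_upwards [heq.filter_mono nhdsWithin_le_nhds, hball.filter_mono nhdsWithin_le_nhds,
        self_mem_nhdsWithin] with z hz hz1 hz0
      have hz0' : 0 < ‖z‖ := norm_pos_iff.2 hz0
      have := hM z hz1.le
      rw [hz, sub_zero, norm_smul, norm_pow, pow_succ] at this
      have hp : 0 < ‖z‖ ^ n := by positivity
      nlinarith [le_of_mul_le_mul_left (show ‖z‖ ^ n * ‖g z‖ ≤ ‖z‖ ^ n * (M * ‖z‖) by linarith) hp]
    have := le_of_tendsto_of_tendsto hlim hlim2 hle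
    exact hg0 (norm_le_zero_iff.1 this)
  exact congrFun (han.eq_of_eventuallyEq (g := fun _ => 0) (fun z _ => analyticAt_const) h0) μ

variable {E : Type*} [AddCommGroup E] [Module ℂ E] [UniformSpace E] [IsUniformAddGroup E]
  [ContinuousSMul ℂ E] [HilbertScale E] {𝔞 : NonUnitalStarSubalgebra ℂ (HPAlg E)}
  {D : Type*} [AddCommGroup D] [Module ℂ D] [UniformSpace D] [IsUniformAddGroup D]
  [ContinuousSMul ℂ D] [HilbertScale D]

/-- The function `⟨ψ'|Y W(ν g₁ + μ g₂) (η ⊗ f^⊗)⟩` of the parameters. -/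
def weylPair (Y : QForm D E) (ψ' : DSpan D E) (η : D) (f : NoiseFn E) (g₁ g₂ : StepFn 𝔞)
    (ν μ : ℂ) : ℂ :=
  Complex.exp (ν * weylExp g₁ f + μ * weylExp g₂ f) *
    Y ψ' (coh η (f + ν • (weylShift g₁ f - f) + μ • (weylShift g₂ f - f)))

theorem weylPair_eq {g g₁ g₂ : StepFn 𝔞} {ν μ : ℂ} (h : ∀ s, g s = ν • g₁ s + μ • g₂ s)
    (Y : QForm D E) (ψ' : DSpan D E) (η : D) (f : NoiseFn E) :
    weylPair Y ψ' η f g₁ g₂ ν μ = Y ψ' (weyl g (coh η f)) := by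
  rw [weyl_coh, map_smul, weylShift_comb h, weylFactor_eq, weylExp_comb h, smul_eq_mul, weylPair]

theorem differentiable_weylPair_right {Y : QForm D E} (hY : QContinuous Y) (ψ' : DSpan D E)
    (η : D) (f : NoiseFn E) (g₁ g₂ : StepFn 𝔞) (ν : ℂ) :
    Differentiable ℂ (weylPair Y ψ' η f g₁ g₂ ν) := by
  have h := hY.differentiable ψ' η (f + ν • (weylShift g₁ f - f)) (weylShift g₂ f - f)
  exact (by fun_prop : Differentiable ℂ fun μ : ℂ =>
    Complex.exp (ν * weylExp g₁ f + μ * weylExp g₂ f)).mul h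

theorem differentiable_weylPair_left {Y : QForm D E} (hY : QContinuous Y) (ψ' : DSpan D E)
    (η : D) (f : NoiseFn E) (g₁ g₂ : StepFn 𝔞) (μ : ℂ) :
    Differentiable ℂ fun ν => weylPair Y ψ' η f g₁ g₂ ν μ := by
  have h := hY.differentiable ψ' η (f + μ • (weylShift g₂ f - f)) (weylShift g₁ f - f)
  have h' := (by fun_prop : Differentiable ℂ fun ν : ℂ =>
    Complex.exp (ν * weylExp g₁ f + μ * weylExp g₂ f)).mul h
  simp only [add_right_comm f (μ • (weylShift g₂ f - f))] at h'
  exact h'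

/-- A Lipschitz estimate in ν, uniform for μ in the unit disc. The uniformity allows ν to be chosen
later as a power of μ. -/
theorem weylPair_sub_le {Y : QForm D E} (hY : QContinuous Y) (ψ' : DSpan D E)
    (η : D) (f : NoiseFn E) (g₁ g₂ : StepFn 𝔞) : ∃ M : ℝ, ∀ ν μ : ℂ, ‖ν‖ ≤ 1 → ‖μ‖ ≤ 1 →
      ‖weylPair Y ψ' η f g₁ g₂ ν μ - weylPair Y ψ' η f g₁ g₂ 0 μ‖ ≤ M * ‖ν‖ := by
  obtain ⟨ξ, C, hC, hb⟩ := hY.norm_coh_le ψ' η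
  set k₁ := weylShift g₁ f - f with hk₁
  set k₂ := weylShift g₂ f - f with hk₂
  set N : NoiseFn E → ℝ := formNorm (nFormL ξ)
  have hN0 : ∀ x, 0 ≤ N x := fun x => formNorm_nonneg _ _
  set M₀ := Real.exp (2 * ‖weylExp g₁ f‖ + ‖weylExp g₂ f‖) *
    (C * Real.exp ((N f + 2 * N k₁ + N k₂) ^ 2 / 2)) with hM₀
  have hbound : ∀ ν μ : ℂ, ‖ν‖ ≤ 2 → ‖μ‖ ≤ 1 → ‖weylPair Y ψ' η f g₁ g₂ ν μ‖ ≤ M₀ := by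
    intro ν μ hν hμ
    rw [weylPair, norm_mul, ← hk₁, ← hk₂]
    have h1 : ‖Complex.exp (ν * weylExp g₁ f + μ * weylExp g₂ f)‖ ≤
        Real.exp (2 * ‖weylExp g₁ f‖ + ‖weylExp g₂ f‖) := by
      rw [Complex.norm_exp]
      refine Real.exp_le_exp.2 ((Complex.re_le_norm _).trans ((norm_add_le _ _).trans ?_))
      rw [norm_mul, norm_mul]
      have := mul_le_mul_of_nonneg_right hν (norm_nonneg (weylExp g₁ f))
      have := mul_le_mul_of_nonneg_right hμ (norm_nonneg (weylExp g₂ f))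
      linarith
    have h2 : N (f + ν • k₁ + μ • k₂) ≤ N f + 2 * N k₁ + N k₂ := by
      have e1 := formNorm_add_le (nFormL_nonneg ξ) (f + ν • k₁) (μ • k₂)
      have e2 := formNorm_add_le (nFormL_nonneg ξ) f (ν • k₁)
      rw [formNorm_smul (nFormL_nonneg ξ)] at e1 e2
      have := mul_le_mul_of_nonneg_right hν (hN0 k₁)
      have := mul_le_mul_of_nonneg_right hμ (hN0 k₂)
      simp only [N] at *
      linarith
    refine mul_le_mul h1 ((hb _).trans ?_) (norm_nonneg _) (Real.exp_pos _).le
    have := hN0 (f + ν • k₁ + μ • k₂)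
    gcongr
  refine ⟨M₀, fun ν μ hν hμ => ?_⟩
  -- Schwarz's lemma on the disc of radius 2: two values bounded by M₀ differ by at most 2M₀, and
  -- 2M₀/2 is the constant.
  have h := Complex.dist_le_div_mul_dist_of_mapsTo_ball (c := (0 : ℂ)) (R₁ := 2) (R₂ := 2 * M₀)
    (z := ν) (f := fun ν => weylPair Y ψ' η f g₁ g₂ ν μ)
    (differentiable_weylPair_left hY ψ' η f g₁ g₂ μ).differentiableOn
    (fun z hz => by
      rw [Metric.mem_closedBall, dist_eq_norm]
      rw [Metric.mem_ball, dist_zero_right] at hz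
      have e1 := hbound z μ hz.le hμ
      have e2 := hbound 0 μ (by simp) hμ
      exact (norm_sub_le _ _).trans (by linarith))
    (by rw [Metric.mem_ball, dist_zero_right]; linarith)
  rw [dist_eq_norm, dist_zero_right] at h
  convert h using 2
  ring

/-- The iterated squares of an element. -/
def iterSq (a : 𝔞) : ℕ → 𝔞
  | 0 => a
  | n + 1 => iterSq a n * iterSq a n

/-- On [0, s) the factor 1 + μa is multiplied by 1 - μa, which leaves 1 - (μa)²; multiplying next by
1 + (μa)² leaves 1 - (μa)⁴, and so on. These multipliers vanish on [s, t), where the value μa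
survives. -/
theorem commutesWeyl_iterSq {Y : QForm D E} {s t : ℝ≥0} (hst : s ≤ t)
    (hs : ∀ a : 𝔞, CommutesWeyl Y (StepFn.const s a))
    (ht : ∀ a : 𝔞, CommutesWeyl Y (StepFn.const t a)) (a : 𝔞) (μ : ℂ) (n : ℕ) :
    CommutesWeyl Y (StepFn.twoStep s t (-(μ ^ 2 ^ (n + 1)) • iterSq a (n + 1)) (μ • a)) := by
  induction n with
  | zero =>
    convert (hs (-(μ • a))).starProd (ht (μ • a)) using 1
    refine StepFn.ext' fun r => ?_
    simp only [StepFn.starProd_apply, StepFn.twoStep_apply, StepFn.const_apply,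
      StepFn.star_apply, _root_.star_star, iterSq]
    by_cases h : r < s
    · have h' := h.trans_le hst
      simp only [h, h', if_true]
      apply Subtype.ext
      simp [pow_two, smul_mul_smul_comm]
    · by_cases h' : r < t <;> simp [h, h']
  | succ n ih =>
    convert (hs (μ ^ 2 ^ (n + 1) • iterSq a (n + 1))).starProd ih using 1
    refine StepFn.ext' fun r => ?_
    simp only [StepFn.starProd_apply, StepFn.twoStep_apply, StepFn.const_apply,
      StepFn.star_apply, _root_.star_star]
    by_cases h : r < s
    · have h' := h.trans_le hst
      simp only [h, if_true]
      apply Subtype.ext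
      rw [show iterSq a (n + 1 + 1) = iterSq a (n + 1) * iterSq a (n + 1) from rfl,
        show μ ^ 2 ^ (n + 1 + 1) = μ ^ 2 ^ (n + 1) * μ ^ 2 ^ (n + 1) by ring]
      simp [smul_mul_smul_comm]
    · by_cases h' : r < t <;> simp [h, h']

/-- The functions of `commutesWeyl_iterSq` differ from μa·1_[s,t) by a term of arbitrarily high
order in μ on [0, s), so the entire commutation defect vanishes to infinite order at μ = 0. -/
theorem commutesWeyl_interval {Y : QForm D E} (hY : QContinuous Y) {s t : ℝ≥0} (hst : s ≤ t)
    (hs : ∀ a : 𝔞, CommutesWeyl Y (StepFn.const s a))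
    (ht : ∀ a : 𝔞, CommutesWeyl Y (StepFn.const t a)) (a : 𝔞) :
    CommutesWeyl Y (StepFn.twoStep s t 0 a) := by
  have hcoh : ∀ η' f' η f, Y (coh η' f') (weyl (StepFn.twoStep s t 0 a) (coh η f)) =
      Y (weyl (star (StepFn.twoStep s t 0 a)) (coh η' f')) (coh η f) := by
    intro η' f' η f
    have hcomb : ∀ (b a : 𝔞) (ν μ : ℂ) (r : ℝ≥0), StepFn.twoStep s t (ν • b) (μ • a) r =
        ν • StepFn.twoStep s t b 0 r + μ • StepFn.twoStep s t 0 a r := fun b a ν μ r => by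
      simp only [StepFn.twoStep_apply]
      split_ifs <;> simp
    let R (b : 𝔞) (ν μ : ℂ) : ℂ := weylPair Y (coh η' f') η f
      (StepFn.twoStep s t b 0) (StepFn.twoStep s t 0 a) ν μ
    let Q (b : 𝔞) (ν μ : ℂ) : ℂ := weylPair (formAdj Y) (coh η f) η' f'
      (StepFn.twoStep s t (star b) 0) (StepFn.twoStep s t 0 (star a)) ν μ
    have hR : ∀ b ν μ, R b ν μ =
        Y (coh η' f') (weyl (StepFn.twoStep s t (ν • b) (μ • a)) (coh η f)) := fun b ν μ =>
      weylPair_eq (hcomb b a ν μ) _ _ _ _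
    have hQ : ∀ b ν μ, (starRingEnd ℂ) (Q b ((starRingEnd ℂ) ν) ((starRingEnd ℂ) μ)) =
        Y (weyl (star (StepFn.twoStep s t (ν • b) (μ • a))) (coh η' f')) (coh η f) :=
      fun b ν μ => by
        have e := weylPair_eq (hcomb (star b) (star a) ((starRingEnd ℂ) ν) ((starRingEnd ℂ) μ))
          (formAdj Y) (coh η f) η' f'
        simp only [Q]
        rw [StepFn.star_twoStep, star_smul, star_smul, e, formAdj_apply, Complex.conj_conj]
        rfl
    -- The commutation defect for μa on [s, t). The left action of W enters through the adjoint
    -- form, whose Q is entire; conjugating both argument and value of Q keeps h entire.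
    let h (μ : ℂ) : ℂ := R 0 0 μ - (starRingEnd ℂ) (Q 0 0 ((starRingEnd ℂ) μ))
    -- At ν = 0 the auxiliary element b drops out, so the estimates for all the iterated squares
    -- refer to the same function h.
    have hR0 : ∀ b μ, R b 0 μ = R 0 0 μ := fun b μ => by rw [hR, hR, zero_smul, zero_smul]
    have hQ0 : ∀ b μ, Q b 0 μ = Q 0 0 μ := fun b μ => by
      have e1 := hQ b 0 ((starRingEnd ℂ) μ)
      have e2 := hQ 0 0 ((starRingEnd ℂ) μ)
      rw [zero_smul, map_zero, Complex.conj_conj] at e1 e2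
      exact (starRingEnd ℂ).injective (e1.trans e2.symm)
    have hdiff : Differentiable ℂ h := by
      refine (differentiable_weylPair_right hY _ _ _ _ _ _).sub ?_
      have := differentiable_weylPair_right hY.formAdj (coh η f) η' f'
        (StepFn.twoStep s t (star (0 : 𝔞)) 0) (StepFn.twoStep s t 0 (star a)) 0
      intro z
      have h2 := (this ((starRingEnd ℂ) z)).conj_conj
      rw [Complex.conj_conj] at h2
      exact h2
    have hzero : ∀ μ, h μ = 0 := by
      refine eq_zero_of_infinite_order hdiff fun N => ?_
      obtain ⟨M₁, hM₁⟩ := weylPair_sub_le hY (coh η' f') η f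
        (StepFn.twoStep s t (iterSq a (N + 1)) 0) (StepFn.twoStep s t 0 a)
      obtain ⟨M₂, hM₂⟩ := weylPair_sub_le hY.formAdj (coh η f) η' f'
        (StepFn.twoStep s t (star (iterSq a (N + 1))) 0) (StepFn.twoStep s t 0 (star a))
      refine ⟨|M₁| + |M₂|, fun μ hμ => ?_⟩
      -- Commutation is exact at this ν, and ‖ν‖ ≤ ‖μ‖^N because N ≤ 2^(N+1) and ‖μ‖ ≤ 1. Replacing
      -- ν by 0 costs O(‖ν‖) on each side, with constants which may depend on N.
      set ν := -(μ ^ 2 ^ (N + 1)) with hν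
      have hνμ : ‖ν‖ ≤ ‖μ‖ ^ N := by
        rw [hν, norm_neg, norm_pow]
        exact pow_le_pow_of_le_one (norm_nonneg _) hμ
          ((Nat.lt_two_pow_self (n := N)).le.trans (Nat.pow_le_pow_right (by norm_num) (by omega)))
      have hν1 : ‖ν‖ ≤ 1 := hνμ.trans (pow_le_one₀ (norm_nonneg _) hμ)
      have e0 : R (iterSq a (N + 1)) ν μ =
          (starRingEnd ℂ) (Q (iterSq a (N + 1)) ((starRingEnd ℂ) ν) ((starRingEnd ℂ) μ)) := by
        rw [hR, hQ]
        exact commutesWeyl_iterSq hst hs ht a μ N _ _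
      have e1 := hM₁ ν μ hν1 hμ
      have e2 := hM₂ ((starRingEnd ℂ) ν) ((starRingEnd ℂ) μ) (by simpa using hν1) (by simpa using hμ)
      change ‖R _ _ _ - R _ _ _‖ ≤ _ at e1
      change ‖Q _ _ _ - Q _ _ _‖ ≤ _ at e2
      rw [hR0] at e1
      rw [hQ0, ← RCLike.norm_conj, map_sub, ← e0, RCLike.norm_conj] at e2
      have e3 : ‖h μ‖ ≤ M₁ * ‖ν‖ + M₂ * ‖ν‖ := by
        have : h μ = (R (iterSq a (N + 1)) ν μ - (starRingEnd ℂ) (Q 0 0 ((starRingEnd ℂ) μ))) -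
            (R (iterSq a (N + 1)) ν μ - R 0 0 μ) := by simp only [h]; ring
        rw [this]
        exact (norm_sub_le _ _).trans (by linarith)
      calc ‖h μ‖ ≤ M₁ * ‖ν‖ + M₂ * ‖ν‖ := e3
        _ ≤ |M₁| * ‖ν‖ + |M₂| * ‖ν‖ := by gcongr <;> exact le_abs_self _
        _ = (|M₁| + |M₂|) * ‖ν‖ := by ring
        _ ≤ _ := by gcongr
    have hfin := sub_eq_zero.1 (hzero 1)
    have e := hQ 0 0 1
    rw [map_zero] at e
    rw [hR, e, zero_smul, one_smul] at hfin
    exact hfin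
  intro ψ' ψ
  rw [eq_sum_coh ψ, eq_sum_coh ψ']
  simp only [Finsupp.sum, map_sum, LinearMap.sum_apply, hcoh]

theorem twoStep_self (t : ℝ≥0) (a : 𝔞) : StepFn.twoStep t t 0 a = 0 := StepFn.ext' fun r => by
  rw [StepFn.twoStep_apply]
  split_ifs <;> simp

theorem twoStep_zero_left (t : ℝ≥0) (a : 𝔞) : StepFn.twoStep 0 t 0 a = StepFn.const t a :=
  StepFn.ext' fun r => by
    simp [StepFn.twoStep_apply, StepFn.const_apply]

theorem ae_ne_time (r : ℝ≥0) : ∀ᵐ s ∂timeMeasure, s ≠ r := by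
  have hemb : MeasurableEmbedding ((↑) : ℝ≥0 → ℝ) :=
    MeasurableEmbedding.subtype_coe measurableSet_Ici
  rw [ae_iff]
  simp [timeMeasure, hemb.comap_apply]

/-- Induction on the breakpoints: the last interval is split off as a factor with support disjoint
from the remaining one. -/
theorem commutesWeyl_of_const {Y : QForm D E} (hY : QContinuous Y)
    (hc : ∀ (t : ℝ≥0) (a : 𝔞), 0 < t → CommutesWeyl Y (StepFn.const t a)) (g : StepFn 𝔞) :
    CommutesWeyl Y g := by
  classical
  have hint : ∀ (s t : ℝ≥0) (a : 𝔞), s ≤ t → CommutesWeyl Y (StepFn.twoStep s t 0 a) := by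
    intro s t a hst
    rcases hst.eq_or_lt with rfl | hlt
    · rw [twoStep_self]; exact commutesWeyl_zero Y
    · have ht : 0 < t := (show (0 : ℝ≥0) ≤ s from zero_le).trans_lt hlt
      rcases (show (0 : ℝ≥0) ≤ s from zero_le).eq_or_lt with rfl | hs
      · rw [twoStep_zero_left]; exact hc t a ht
      · exact commutesWeyl_interval hY hst (fun a => hc s a hs) (fun a => hc t a ht) a
  obtain ⟨S, hS⟩ := g.isStep
  induction S using Finset.induction_on_max generalizing g with
  | empty =>
    have : g = 0 := StepFn.ext' fun s => by
      obtain ⟨t, ht⟩ := g.bounded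
      rw [hS s t (by simp), ht t le_rfl]; rfl
    rw [this]; exact commutesWeyl_zero Y
  | insert r S hr ih =>
    -- The last breakpoint before r. Without one this is 0, the supremum of the empty set in ℝ≥0,
    -- and the cut function is then zero.
    set r' := S.sup id with hr'
    have hr'r : r' ≤ r := Finset.sup_le fun x hx => (hr x hx).le
    have hle : ∀ x ∈ S, x ≤ r' := fun x hx => Finset.le_sup (f := id) hx
    have hmem : S.Nonempty → r' ∈ S := fun hne => by
      obtain ⟨x, hx, hx'⟩ := Finset.exists_mem_eq_sup S hne id
      rw [hr', hx']; exact hx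
    have hg1 := ih (g.cut r') fun s s' h => by
      show (g.cut r') s = (g.cut r') s'
      rw [StepFn.cut_apply, StepFn.cut_apply]
      rcases S.eq_empty_or_nonempty with hemp | hne
      · have : r' = 0 := by rw [hr', hemp]; rfl
        simp [this]
      · have h1 := (h r' (hmem hne)).1
        by_cases hs : s < r'
        · rw [if_pos hs, if_pos (h1.1 hs)]
          refine hS s s' fun x hx => ?_
          rcases Finset.mem_insert.1 hx with rfl | hx
          · have e1 := hs.trans_le hr'r
            have e2 := (h1.1 hs).trans_le hr'r
            simp [e1, e2, e1.not_gt, e2.not_gt]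
          · exact h x hx
        · rw [if_neg hs, if_neg fun h' => hs (h1.2 h')]
    -- The midpoint represents the value of g on (r', r). If that interval is empty, the choice is
    -- immaterial.
    set a := g ((r' + r) / 2)
    -- The supports are disjoint, so the composition g + h + gh is a sum; it agrees with g away from
    -- the points r' and r.
    refine (hg1.starProd (hint r' r a hr'r)).congr_ae hY ?_
    have hae : ∀ᵐ s ∂timeMeasure, s ≠ r' ∧ s ≠ r := (ae_ne_time r').and (ae_ne_time r)
    filter_upwards [hae] with s hs
    simp only [StepFn.starProd_apply, StepFn.star_apply, _root_.star_star, StepFn.twoStep_apply,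
      StepFn.cut_apply]
    rcases lt_trichotomy s r' with h | h | h
    · simp [h]
    · exact absurd h hs.1
    · rcases lt_trichotomy s r with h' | h' | h'
      · simp only [h.not_gt, h', if_false, if_true]
        simp only [zero_mul, add_zero]
        have hrr : r' < r := h.trans h'
        have m1 : r' < (r' + r) / 2 := by
          rw [← NNReal.coe_lt_coe] at *; push_cast; linarith
        have m2 : (r' + r) / 2 < r := by
          rw [← NNReal.coe_lt_coe] at *; push_cast; linarith
        refine hS _ _ fun x hx => ?_
        rcases Finset.mem_insert.1 hx with rfl | hx
        · simp [h', m2, h'.not_gt, m2.not_gt]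
        · have e1 := (hle x hx).trans_lt h
          have e2 := (hle x hx).trans_lt m1
          simp [e1, e2, e1.not_gt, e2.not_gt]
      · exact absurd h' hs.2
      · simp only [h.not_gt, h'.not_gt, if_false]
        simp only [zero_mul, add_zero]
        -- Beyond the last breakpoint g is constant, and bounded support makes this constant zero.
        obtain ⟨t, ht⟩ := g.bounded
        have e0 : g s = g (max s t) := hS _ _ fun x hx => by
          have hxr : x ≤ r := by
            rcases Finset.mem_insert.1 hx with rfl | hx
            exacts [le_rfl, (hr x hx).le]
          have e1 := hxr.trans_lt h'
          have e2 := e1.trans_le (le_max_left s t)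
          simp only [e1, e2, e1.le.not_gt, e2.le.not_gt, iff_self, and_self]
        rw [e0, ht _ (le_max_right _ _)]

end CommuteSteps

/-! ### Generating functions of positive submartingales -/

section Generating

variable {E : Type*} [AddCommGroup E] [Module ℂ E] [UniformSpace E] [IsUniformAddGroup E]
  [ContinuousSMul ℂ E] [HilbertScale E] {𝔞 : NonUnitalStarSubalgebra ℂ (HPAlg E)}
  {D : Type*} [AddCommGroup D] [Module ℂ D] [UniformSpace D] [IsUniformAddGroup D]
  [ContinuousSMul ℂ D] [HilbertScale D] {𝒜 : NonUnitalSubalgebra ℂ (D →L[ℂ] D)}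

theorem genFun_apply (R : QForm D E) (g : StepFn 𝔞) (η' η : D) :
    genFun R g η' η = R (coh η' 0) (weyl g (coh η 0)) := rfl

theorem commutesWeyl_of_mem {Y : QForm D E} (hY : Y ∈ commutingForms 𝒜 𝔞) (g : StepFn 𝔞) :
    CommutesWeyl Y g :=
  commutesWeyl_of_const hY.1 (fun t a ht ψ' ψ => by
    rw [hY.2.2 t a ht, StepFn.star_const]) g

/-- W(g ⋆ h) = W(g^⋆)W(h), and commutation moves W(g^⋆) to the left argument as W(g). -/
theorem genFun_starProd {Y : QForm D E} (hY : Y ∈ commutingForms 𝒜 𝔞) (g h : StepFn 𝔞) (η' η : D) :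
    genFun Y (g.starProd h) η' η = Y (weyl g (coh η' 0)) (weyl h (coh η 0)) := by
  rw [genFun_apply, weyl_starProd, commutesWeyl_of_mem hY, StepFn.star_star]

theorem weyl_vacuum (g : StepFn 𝔞) (η : D) :
    weyl g (coh η 0) = weylFactor g 0 • coh η (creaFn g) := by
  rw [weyl_coh, weylShift_zero_right]

theorem genFun_zero (R : QForm D E) (η' η : D) :
    genFun R (0 : StepFn 𝔞) η' η = R (coh η' 0) (coh η 0) := by
  rw [genFun_apply, weyl_zero]

theorem condExp_coh (t : ℝ≥0) (Z : QForm D E) (η' η : D) (f' f : NoiseFn E) :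
    condExp t Z (coh η' f') (coh η f) =
      Complex.exp (NoiseFn.inner (f'.future t) (f.future t)) *
        Z (coh η' (f'.past t)) (coh η (f.past t)) := by
  rw [condExp, ofKernel_coh]; rfl

theorem NoiseFn.past_apply (t : ℝ≥0) (f : NoiseFn E) (s : ℝ≥0) :
    f.past t s = if s < t then f s else 0 := by
  simp [NoiseFn.past, Set.indicator]

theorem NoiseFn.future_apply (t : ℝ≥0) (f : NoiseFn E) (s : ℝ≥0) :
    f.future t s = if t ≤ s then f s else 0 := by
  simp [NoiseFn.future, Set.indicator]

theorem condExp_coh_of_past {t : ℝ≥0} (Z : QForm D E) (η' η : D) {f' f : NoiseFn E}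
    (hf' : ∀ s, t ≤ s → f' s = 0) (hf : ∀ s, t ≤ s → f s = 0) :
    condExp t Z (coh η' f') (coh η f) = Z (coh η' f') (coh η f) := by
  have h : ∀ f : NoiseFn E, (∀ s, t ≤ s → f s = 0) → f.future t = 0 ∧ f.past t = f := fun f hf => by
    constructor
    · refine NoiseFn.ext fun s => ?_
      rw [NoiseFn.future_apply]
      split_ifs with hs
      · rw [hf s hs]; rfl
      · rfl
    · refine NoiseFn.ext fun s => ?_
      rw [NoiseFn.past_apply]
      split_ifs with hs
      · rfl
      · rw [hf s (not_lt.1 hs)]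
  rw [condExp_coh, (h f hf).1, (h f hf).2, (h f' hf').1, (h f' hf').2, ← nForm_apply, map_zero,
    Complex.exp_zero, one_mul]

theorem creaFn_of_mem {t : ℝ≥0} {g : StepFn 𝔞} (hg : g ∈ stepsBefore 𝔞 t) (s : ℝ≥0) (hs : t ≤ s) :
    creaFn g s = 0 := by
  rw [creaFn_apply, hg s hs]; rfl

/-- For g ∈ 𝔤_t the vector W(g)(η ⊗ δ_∅) is a multiple of a coherent vector whose function vanishes
after t, so the future factor in ε_t is 1. -/
theorem condExp_vacuum {t : ℝ≥0} (Z : QForm D E) (η' η : D) {g h : StepFn 𝔞}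
    (hg : g ∈ stepsBefore 𝔞 t) (hh : h ∈ stepsBefore 𝔞 t) :
    condExp t Z (weyl g (coh η' 0)) (weyl h (coh η 0)) =
      Z (weyl g (coh η' 0)) (weyl h (coh η 0)) := by
  simp only [weyl_vacuum, map_smul, LinearMap.map_smulₛₗ, LinearMap.smul_apply]
  rw [condExp_coh_of_past Z η' η (creaFn_of_mem hg) (creaFn_of_mem hh)]

theorem genFun_condExp {t : ℝ≥0} (Z : QForm D E) {g : StepFn 𝔞} (hg : g ∈ stepsBefore 𝔞 t) :
    genFun (condExp t Z) g = genFun Z g := by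
  ext η' η
  have := condExp_vacuum Z η' η (zero_mem_stepsBefore t) hg
  rw [weyl_zero] at this
  exact this

theorem genFun_idForm_zero : genFun (idForm D E) (0 : StepFn 𝔞) = ipForm D := by
  ext η' η
  rw [genFun_zero, idForm, ofKernel_coh, ← nForm_apply, map_zero, Complex.exp_zero, one_smul]

theorem coh_norm_le (p ξ : ℕ) (η : D) (f : NoiseFn E) :
    projNorm p ξ (coh η f) ≤ nrmL p η * fockNorm ξ (Finsupp.single f 1) := by
  have := projNorm_tens_le p ξ η (Finsupp.single f 1)
  rwa [tens_single, one_smul] at this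

theorem ampl_coh (A : D →L[ℂ] D) (η : D) (f : NoiseFn E) : ampl A (coh η f) = coh (A η) f :=
  Finsupp.mapRange_single (hf := map_zero A)

theorem genFun_mem_commutant {Y : QForm D E} (hY : Y ∈ commutingForms 𝒜 𝔞) (g : StepFn 𝔞) :
    genFun Y g ∈ commutant 𝒜 := by
  constructor
  · obtain ⟨p, ξ, C, hC, h⟩ := hY.1.exists_bound
    refine ⟨p, ‖weylFactor g (0 : NoiseFn E)‖ * (C * fockNorm ξ (Finsupp.single (0 : NoiseFn E) 1) *
      fockNorm ξ (Finsupp.single (creaFn g) 1)), fun η' η => ?_⟩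
    rw [genFun_apply, weyl_vacuum, map_smul, smul_eq_mul, norm_mul, mul_assoc, mul_assoc]
    refine mul_le_mul_of_nonneg_left ((h _ _).trans ?_) (norm_nonneg _)
    have e1 := coh_norm_le p ξ η' (0 : NoiseFn E)
    have e2 := coh_norm_le p ξ η (creaFn g)
    have e3 := projNorm_nonneg p ξ (coh η (creaFn g))
    have e4 := nrmL_nonneg p η'
    have e5 := fockNorm_nonneg ξ (Finsupp.single (0 : NoiseFn E) 1)
    calc _ ≤ C * (nrmL p η' * fockNorm ξ (Finsupp.single (0 : NoiseFn E) 1)) *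
          (nrmL p η * fockNorm ξ (Finsupp.single (creaFn g) 1)) := by gcongr
      _ = _ := by ring
  · intro A hA A' hA' hAA' η' η
    have := hY.2.1 A hA A' hA' hAA' (coh η' 0) (weyl g (coh η 0))
    rw [weyl_vacuum, map_smul, ampl_coh, ampl_coh] at this
    rw [genFun_apply, genFun_apply, weyl_vacuum, weyl_vacuum, this]

theorem sum_genFun {Y : QForm D E} (hY : Y ∈ commutingForms 𝒜 𝔞) {n : ℕ} (g : Fin n → StepFn 𝔞)
    (η : Fin n → D) : ∑ k, ∑ l, genFun Y ((g k).starProd (g l)) (η k) (η l) =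
      Y (∑ k, weyl (g k) (coh (η k) 0)) (∑ k, weyl (g k) (coh (η k) 0)) := by
  simp only [genFun_starProd hY, map_sum, LinearMap.sum_apply]
  exact Finset.sum_comm

theorem posDefOn_genFun {Y : QForm D E} (hY : Y ∈ commutingForms 𝒜 𝔞) (hp : QPos Y) (t : ℝ≥0) :
    PosDefOn (𝔞 := 𝔞) t (genFun Y) := fun n g η _ => by
  rw [sum_genFun hY]
  exact hp _

/-- Only vectors W(g)(η ⊗ δ_∅) with g ∈ 𝔤_t enter, and on them Z may be replaced by ε_t(Z), which is
comparable with Y. -/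
theorem posDefOn_genFun_sub {Y Z : QForm D E} (hY : Y ∈ commutingForms 𝒜 𝔞)
    (hZ : Z ∈ commutingForms 𝒜 𝔞) {t : ℝ≥0} (h : QLe (condExp t Z) Y) :
    PosDefOn (𝔞 := 𝔞) t (fun g => genFun Y g - genFun Z g) := fun n g η hg => by
  have e : ∑ k, ∑ l, (genFun Y ((g k).starProd (g l)) - genFun Z ((g k).starProd (g l)))
      (η k) (η l) = (Y - condExp t Z) (∑ k, weyl (g k) (coh (η k) 0))
        (∑ k, weyl (g k) (coh (η k) 0)) := by
    simp only [LinearMap.sub_apply, Finset.sum_sub_distrib]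
    rw [sum_genFun hY, sum_genFun hZ]
    congr 1
    simp only [map_sum, LinearMap.sum_apply]
    exact Finset.sum_congr rfl fun k _ => Finset.sum_congr rfl fun l _ =>
      (condExp_vacuum Z _ _ (hg _) (hg _)).symm
  rw [e]
  exact h _

theorem absContOn_genFun {Y : QForm D E} (hY : Y ∈ commutingForms 𝒜 𝔞) (t : ℝ≥0) :
    AbsContOn (𝔞 := 𝔞) t (genFun Y) := by
  intro η _ hlim
  obtain ⟨p, ξ, C, hC, h⟩ := hY.1.exists_bound
  have e : ∀ n, ((η n).sum fun g x => (η n).sum fun h y => genFun Y (g.starProd h) x y) =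
      Y ((η n).sum fun g x => weyl g (coh x (0 : NoiseFn E)))
        ((η n).sum fun g x => weyl g (coh x (0 : NoiseFn E))) := fun n => by
    simp only [genFun_starProd hY, Finsupp.sum, map_sum, LinearMap.sum_apply]
    exact Finset.sum_comm
  simp only [e]
  rw [tendsto_zero_iff_norm_tendsto_zero]
  refine squeeze_zero (fun _ => norm_nonneg _) (fun n => h _ _) ?_
  have := ((hlim p ξ).const_mul C).mul (hlim p ξ)
  simpa using this

theorem genFun_zero_le {R : ℝ≥0 → QForm D E} (hR : IsPosSubmartingale 𝒜 𝔞 R)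
    (h0 : R 0 = idForm D E) (t : ℝ≥0) (η : D) :
    genFun (R t) (0 : StepFn 𝔞) η η ≤ ip η η := by
  have h := hR.2.2 0 t zero_le (coh η 0)
  rw [LinearMap.sub_apply, LinearMap.sub_apply, sub_nonneg] at h
  have e1 := congrArg (fun B : DForm D => B η η)
    (genFun_condExp (R t) (zero_mem_stepsBefore (𝔞 := 𝔞) 0))
  have e2 := congrArg (fun B : DForm D => B η η) (genFun_idForm_zero (D := D) (𝔞 := 𝔞))
  simp only [genFun_zero, ipForm_apply] at e1 e2
  rw [genFun_zero, ← e1, ← e2, ← h0]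
  exact h

end Generating

/-! ### Density of step functions -/

section Density

open scoped ENNReal symmDiff

variable {E : Type*} [AddCommGroup E] [Module ℂ E] [UniformSpace E] [IsUniformAddGroup E]
  [ContinuousSMul ℂ E] [HilbertScale E] {𝔞 : NonUnitalStarSubalgebra ℂ (HPAlg E)}

/-- The space `E` with the norm number `ξ`. -/
def LevelSpace (E : Type*) [AddCommGroup E] [Module ℂ E] [UniformSpace E] [HilbertScale E]
    (_ : ℕ) : Type _ := E

instance (ξ : ℕ) : NormedAddCommGroup (LevelSpace E ξ) :=
  (HilbertScale.level (E := E) ξ).toNormedAddCommGroup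

instance (ξ : ℕ) : NormedSpace ℂ (LevelSpace E ξ) :=
  @InnerProductSpace.Core.toNormedSpace ℂ E _ _ _ (HilbertScale.level (E := E) ξ).toCore

/-- The identity map to the space with the norm number `ξ`. -/
def toLevel (ξ : ℕ) : E →ₗ[ℂ] LevelSpace E ξ where
  toFun x := x
  map_add' _ _ := rfl
  map_smul' _ _ := rfl

theorem norm_toLevel (ξ : ℕ) (x : E) : ‖toLevel ξ x‖ = nrmL ξ x := rfl

theorem continuous_toLevel (ξ : ℕ) : Continuous (toLevel (E := E) ξ) := by
  refine continuous_of_continuousAt_zero (toLevel (E := E) ξ).toAddMonoidHom ?_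
  rw [ContinuousAt, map_zero, tendsto_zero_iff_norm_tendsto_zero]
  have := (nrmL_continuous (E := E) ξ).tendsto 0
  rwa [nrmL_zero] at this

/-- The sets which are finite unions of intervals and points. -/
def stepSets : Set (Set ℝ≥0) := {A | IsStep fun s => s ∈ A}

theorem isSetAlgebra_stepSets : IsSetAlgebra stepSets where
  empty_mem := ⟨∅, fun _ _ _ => by simp⟩
  compl_mem _ hs := hs.map Not
  union_mem _ _ hs ht := hs.map₂ ht Or

/-- The step sets form an algebra containing the intervals [0, r), which generate the Borel sets;
restriction to [0, t) makes the measure finite. -/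
theorem measureDense_stepSets (t : ℝ≥0) :
    (timeMeasure.restrict (Set.Iio t)).MeasureDense stepSets := by
  have : IsFiniteMeasure (timeMeasure.restrict (Set.Iio t)) :=
    ⟨by simpa using timeMeasure_Iio_lt_top t⟩
  refine Measure.MeasureDense.of_generateFrom_isSetAlgebra_finite _ isSetAlgebra_stepSets ?_
  apply le_antisymm
  · rw [BorelSpace.measurable_eq (α := ℝ≥0), borel_eq_generateFrom_Iio]
    refine MeasurableSpace.generateFrom_mono ?_
    rintro _ ⟨r, rfl⟩
    exact ⟨{r}, fun s s' h => by simpa using (h r (by simp)).1⟩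
  · refine MeasurableSpace.generateFrom_le fun A hA => ?_
    have h := hA.factor.2 {True}
    convert h using 1
    ext s
    simp

/-- The set of the vectors `a^•_+`. -/
def creaSet (𝔞 : NonUnitalStarSubalgebra ℂ (HPAlg E)) : Set E := {k | ∃ a ∈ 𝔞, a.crea = k}

/-- Density of simple functions in L² of the closed span of the vectors a^•_+ in the norm ξ, with
measurable sets replaced by step sets and values by vectors a^•_+. -/
theorem exists_approx_level {t : ℝ≥0} {f : NoiseFn E}
    (hf : ∀ s, f s ∈ closure (creaSet 𝔞)) (hft : ∀ s, t ≤ s → f s = 0) (ξ : ℕ) {ε : ℝ}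
    (hε : 0 < ε) :
    ∃ g ∈ stepsBefore 𝔞 t, formNorm (nFormL ξ) (creaFn g - f) ≤ ε := by
  classical
  let K₀ : Submodule ℂ (LevelSpace E ξ) :=
    { carrier := {k | ∃ a ∈ 𝔞, toLevel ξ a.crea = k}
      add_mem' := by
        rintro _ _ ⟨a, ha, rfl⟩ ⟨b, hb, rfl⟩
        exact ⟨a + b, add_mem ha hb, rfl⟩
      zero_mem' := ⟨0, zero_mem 𝔞, rfl⟩
      smul_mem' := by
        rintro c _ ⟨a, ha, rfl⟩
        exact ⟨c • a, SMulMemClass.smul_mem c ha, rfl⟩ }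
  let K := K₀.topologicalClosure
  let μ := timeMeasure.restrict (Set.Iio t)
  have hμ : IsFiniteMeasure μ := ⟨by simpa [μ] using timeMeasure_Iio_lt_top t⟩
  -- The norm ξ gives a coarser topology than that of E, so limits in E are limits in this norm.
  have hmem : ∀ x ∈ closure (creaSet 𝔞), toLevel ξ x ∈ K := fun x hx => by
    have h1 := image_closure_subset_closure_image (continuous_toLevel ξ) (Set.mem_image_of_mem _ hx)
    refine closure_mono ?_ h1
    rintro _ ⟨_, ⟨a, ha, rfl⟩, rfl⟩
    exact ⟨a, ha, rfl⟩
  have haesm : ∀ {φ : ℝ≥0 → K} (h : NoiseFn E), (∀ s, (φ s : LevelSpace E ξ) = toLevel ξ (h s)) →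
      AEStronglyMeasurable φ μ := fun {φ} h hφ => by
    rw [← (Topology.IsEmbedding.subtypeVal (p := (· ∈ K))).aestronglyMeasurable_comp_iff]
    have : (fun s => (φ s : LevelSpace E ξ)) = fun s => toLevel ξ (h s) := funext hφ
    exact this ▸ ((continuous_toLevel ξ).comp_aestronglyMeasurable h.isNoise.aesm).restrict
  let P : (ℝ≥0 → K) → Prop := fun φ => ∃ g ∈ stepsBefore 𝔞 t,
    ∀ s, (φ s : LevelSpace E ξ) = toLevel ξ (creaFn g s)
  let F : ℝ≥0 → K := fun s => ⟨toLevel ξ (f s), hmem _ (hf s)⟩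
  have hFm : AEStronglyMeasurable F μ := haesm f fun s => rfl
  have hF : MemLp F 2 μ := by
    rw [memLp_two_iff_integrable_sq_norm hFm]
    exact (f.isNoise.sq ξ).restrict
  -- It suffices to approximate c·1_S with c ∈ K: one half of the error goes to replacing S by a
  -- step set, the other to replacing c by some a^•_+. As F is K-valued, the value c can indeed be
  -- taken in K.
  obtain ⟨φ, hφ, g, hg, hgφ⟩ := hF.induction_dense (by simp) P
    (by
      intro c S hS _ δ hδ
      have hδ2 : δ / 2 ≠ 0 := (ENNReal.half_pos hδ).ne'
      obtain ⟨κ, hκ, hκS⟩ := exists_eLpNorm_indicator_le (μ := μ) (p := 2) (by simp) c hδ2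
      obtain ⟨A, hA, hAS⟩ := (measureDense_stepSets t).approx S hS (measure_ne_top μ S) κ
        (by exact_mod_cast hκ)
      have hAm := (measureDense_stepSets t).measurable A hA
      obtain ⟨k, hk, hklim⟩ := mem_closure_iff_seq_limit.1 c.2
      have hlim : Tendsto (fun n => ‖k n - c‖ₑ * μ Set.univ ^ (1 / (2 : ℝ≥0∞).toReal)) atTop
          (𝓝 0) := by
        have h1 : Tendsto (fun n => ‖k n - c‖ₑ) atTop (𝓝 0) := by
          have := (hklim.sub_const (c : LevelSpace E ξ)).enorm
          simpa using this
        have h2 := ENNReal.Tendsto.mul_const h1 (b := μ Set.univ ^ (1 / (2 : ℝ≥0∞).toReal))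
          (Or.inr (ENNReal.rpow_ne_top_of_nonneg (by simp) (measure_ne_top _ _)))
        simpa using h2
      obtain ⟨n, hn⟩ := (hlim.eventually_lt_const (pos_iff_ne_zero.2 hδ2)).exists
      obtain ⟨a, ha, hak⟩ := hk n
      let kK : K := ⟨k n, K₀.le_topologicalClosure (hk n)⟩
      let g : StepFn 𝔞 := ⟨fun s => if s ∈ A ∧ s < t then ⟨a, ha⟩ else 0,
        (IsStep.map₂ (show IsStep fun s => s ∈ A from hA)
          (show IsStep fun s : ℝ≥0 => s < t from
            ⟨{t}, fun s s' h => by simpa using (h t (by simp)).1⟩)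
          fun p q => if p ∧ q then (⟨a, ha⟩ : 𝔞) else 0),
        ⟨t, fun s hs => by simp [not_lt.2 hs]⟩⟩
      have hg : ∀ s, g s = if s ∈ A ∧ s < t then ⟨a, ha⟩ else 0 := fun s => rfl
      let φ : ℝ≥0 → K := (A ∩ Set.Iio t).indicator fun _ => kK
      refine ⟨φ, ?_, g, fun s hs => by rw [hg, if_neg fun h => not_lt.2 hs h.2], fun s => ?_⟩
      · have hae : φ - S.indicator (fun _ => c) =ᵐ[μ]
            A.indicator (fun _ => kK - c) + (A.indicator (fun _ => c) - S.indicator fun _ => c) := by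
          filter_upwards [ae_restrict_mem measurableSet_Iio] with s hs
          have hs' : s < t := hs
          simp only [φ, Pi.sub_apply, Pi.add_apply, Set.indicator, Set.mem_inter_iff, Set.mem_Iio,
            hs', and_true]
          split_ifs <;> simp
        rw [eLpNorm_congr_ae hae]
        refine (eLpNorm_add_le (aestronglyMeasurable_const.indicator hAm)
          ((aestronglyMeasurable_const.indicator hAm).sub
            (aestronglyMeasurable_const.indicator hS)) (by norm_num)).trans ?_
        rw [← ENNReal.add_halves δ]
        refine add_le_add ?_ ?_
        · refine eLpNorm_indicator_const_le (c := kK - c) 2 |>.trans (le_trans ?_ hn.le)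
          gcongr
          · exact le_rfl
          · exact Set.subset_univ A
        · rw [eLpNorm_indicator_sub_indicator]
          refine hκS _ ?_
          rw [symmDiff_comm]
          refine hAS.le.trans_eq ?_
          exact ENNReal.ofReal_coe_nnreal
      · rw [creaFn_apply, hg]
        by_cases h : s ∈ A ∧ s < t
        · rw [if_pos h]
          have : φ s = kK := Set.indicator_of_mem (show s ∈ A ∩ Set.Iio t from h) _
          rw [this]
          exact hak.symm
        · rw [if_neg h]
          have : φ s = 0 := Set.indicator_of_notMem (show s ∉ A ∩ Set.Iio t from h) _
          rw [this]
          rfl)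
    (by
      rintro φ ψ ⟨g, hg, hgφ⟩ ⟨h, hh, hhψ⟩
      obtain ⟨u, hu⟩ := g.bounded
      obtain ⟨v, hv⟩ := h.bounded
      refine ⟨⟨fun s => g s + h s, g.isStep.map₂ h.isStep (· + ·), ⟨max u v, fun s hs => by
        simp [hu s ((le_max_left _ _).trans hs), hv s ((le_max_right _ _).trans hs)]⟩⟩,
        fun s hs => ?_, fun s => ?_⟩
      · change g s + h s = 0
        rw [hg s hs, hh s hs, add_zero]
      · change (φ s : LevelSpace E ξ) + ψ s = _
        rw [hgφ, hhψ]
        rfl)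
    (by
      rintro φ ⟨g, -, hgφ⟩
      exact haesm _ hgφ) (ε := ENNReal.ofReal ε) (by simpa using hε)
  refine ⟨g, hg, ?_⟩
  have hsub : ∀ s, ‖(F - φ) s‖ = nrmL ξ ((creaFn g - f) s) := fun s => by
    have : (((F - φ) s : K) : LevelSpace E ξ) = -toLevel ξ ((creaFn g - f) s) := by
      change toLevel ξ (f s) - (φ s : LevelSpace E ξ) = _
      rw [hgφ, NoiseFn.sub_apply, map_sub]
      abel
    rw [← norm_toLevel, ← norm_neg (toLevel ξ _), ← this]
    rfl
  have hmemLp : MemLp (F - φ) 2 μ := hF.sub ((memLp_two_iff_integrable_sq_norm (haesm _ hgφ)).2 (by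
    have : ∀ s, ‖φ s‖ = nrmL ξ (creaFn g s) := fun s => by
      rw [← norm_toLevel, ← hgφ]; rfl
    simp only [this]
    exact ((creaFn g).isNoise.sq ξ).restrict))
  have h1 := hmemLp.eLpNorm_eq_integral_rpow_norm (by simp) (by simp)
  rw [h1] at hφ
  have h2 := (ENNReal.ofReal_le_ofReal_iff hε.le).1 hφ
  simp only [hsub, ENNReal.toReal_ofNat, Real.rpow_ofNat] at h2
  have h3 : ∫ s, nrmL ξ ((creaFn g - f) s) ^ 2 ∂μ = formNorm (nFormL ξ) (creaFn g - f) ^ 2 := by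
    rw [formNorm_nFormL_sq]
    refine setIntegral_eq_integral_of_forall_compl_eq_zero fun s hs => ?_
    have hs' : t ≤ s := not_lt.1 hs
    rw [NoiseFn.sub_apply, creaFn_of_mem hg s hs', hft s hs', sub_zero, nrmL_zero]
    norm_num
  rwa [h3, ← one_div, ← Real.sqrt_eq_rpow, Real.sqrt_sq (formNorm_nonneg _ _)] at h2

/-- A diagonal choice: the n-th function is 1/(n + 1)-close in the norm n, which dominates all the
earlier norms. -/
theorem exists_approx {t : ℝ≥0} {f : NoiseFn E} (hf : ∀ s, f s ∈ closure (creaSet 𝔞))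
    (hft : ∀ s, t ≤ s → f s = 0) :
    ∃ g : ℕ → StepFn 𝔞, (∀ n, g n ∈ stepsBefore 𝔞 t) ∧ NTendsto (fun n => creaFn (g n)) f := by
  have h := fun n : ℕ => exists_approx_level hf hft n
    (show (0 : ℝ) < 1 / ((n : ℝ) + 1) by positivity)
  choose g hg hgf using h
  refine ⟨g, hg, fun ξ => ?_⟩
  refine squeeze_zero' (Eventually.of_forall fun n => formNorm_nonneg _ _) ?_
    tendsto_one_div_add_atTop_nhds_zero_nat
  filter_upwards [eventually_ge_atTop ξ] with n hn
  exact (formNorm_nFormL_mono hn _).trans (hgf n)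

end Density

/-! ### The reconstruction of a form from its generating function -/

section Reconstruction

variable {E : Type*} [AddCommGroup E] [Module ℂ E] [UniformSpace E] [IsUniformAddGroup E]
  [ContinuousSMul ℂ E] [HilbertScale E] {𝔞 : NonUnitalStarSubalgebra ℂ (HPAlg E)}
  {D : Type*} [AddCommGroup D] [Module ℂ D] [UniformSpace D] [IsUniformAddGroup D]
  [ContinuousSMul ℂ D] [HilbertScale D]

theorem expand_form {V ι : Type*} [AddCommGroup V] [Module ℂ V] (q : V →ₗ⋆[ℂ] V →ₗ[ℂ] ℂ)
    (s : Finset ι) (c : ι → ℂ) (v : ι → V) :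
    q (∑ i ∈ s, c i • v i) (∑ i ∈ s, c i • v i) =
      ∑ i ∈ s, ∑ j ∈ s, (starRingEnd ℂ) (c i) * c j * q (v i) (v j) := by
  simp only [map_sum, LinearMap.sum_apply, map_smul, LinearMap.map_smulₛₗ, LinearMap.smul_apply,
    smul_eq_mul, Finset.mul_sum]
  rw [Finset.sum_comm]
  refine Finset.sum_congr rfl fun i _ => ?_
  exact Finset.sum_congr rfl fun j _ => by ring

/-- The GNS form of a function on `𝔤_t`. -/
def gnsForm (t : ℝ≥0) (θ : StepFn 𝔞 → DForm D) :
    (stepsBefore 𝔞 t →₀ D) →ₗ⋆[ℂ] (stepsBefore 𝔞 t →₀ D) →ₗ[ℂ] ℂ :=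
  kerForm fun g h => θ (g.1.starProd h.1)

theorem gnsForm_nonneg {t : ℝ≥0} {θ : StepFn 𝔞 → DForm D} (h : PosDefOn t θ)
    (x : stepsBefore 𝔞 t →₀ D) : 0 ≤ gnsForm t θ x x := by
  let e := x.support.equivFin
  have h1 := h _ (fun k => (e.symm k).1.1) (fun k => x (e.symm k).1) fun k => (e.symm k).1.2
  have h2 : ∀ F : stepsBefore 𝔞 t → ℂ, ∑ k, F (e.symm k).1 = ∑ a ∈ x.support, F a := fun F => by
    rw [e.symm.sum_comp fun a : x.support => F a.1]
    exact Finset.sum_coe_sort _ _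
  rw [gnsForm, kerForm_apply, Finsupp.sum, ← h2]
  refine h1.trans_eq (Finset.sum_congr rfl fun k _ => ?_)
  exact h2 fun b => θ ((e.symm k).1.1.starProd b.1) (x (e.symm k).1) (x b)

/-- The map `∑ η_g ↦ ∑ W(g) (η_g ⊗ δ_∅)`. -/
def vacMap (D : Type*) [AddCommGroup D] [Module ℂ D] [UniformSpace D] [IsUniformAddGroup D]
    [ContinuousSMul ℂ D] [HilbertScale D] (𝔞 : NonUnitalStarSubalgebra ℂ (HPAlg E)) (t : ℝ≥0) :
    (stepsBefore 𝔞 t →₀ D) →ₗ[ℂ] DSpan D E :=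
  Finsupp.lsum ℂ fun g => weyl g.1 ∘ₗ Finsupp.lsingle 0

theorem vacMap_apply (t : ℝ≥0) (x : stepsBefore 𝔞 t →₀ D) :
    vacMap D 𝔞 t x = x.sum fun g η => weyl g.1 (coh η 0) := rfl

/-- If no bound held, normalized counterexamples would tend to 0 in 𝔇 while the GNS form stays equal
to 1 on them, against absolute continuity. -/
theorem gnsForm_bound {t : ℝ≥0} {θ : StepFn 𝔞 → DForm D} (h : PosDefOn t θ)
    (habs : AbsContOn t θ) : ∃ (p ξ : ℕ) (C : ℝ), 0 ≤ C ∧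
      ∀ x, formNorm (gnsForm t θ) x ≤ C * projNorm p ξ (vacMap D 𝔞 t x) := by
  by_contra! hcon
  have hq := gnsForm_nonneg h
  -- Both norm indices and the constant are set to n: after normalization the projective norm number
  -- (n, n) is at most 1/n, and by monotonicity every fixed projective norm tends to 0.
  have hx := fun n : ℕ => hcon n n n n.cast_nonneg
  choose x hx using hx
  have hpos : ∀ n, 0 < formNorm (gnsForm t θ) (x n) := fun n =>
    (mul_nonneg n.cast_nonneg (projNorm_nonneg _ _ _)).trans_lt (hx n)
  let y : ℕ → stepsBefore 𝔞 t →₀ D := fun n =>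
    (((formNorm (gnsForm t θ) (x n))⁻¹ : ℝ) : ℂ) • x n
  have hc : ∀ n, ‖(((formNorm (gnsForm t θ) (x n))⁻¹ : ℝ) : ℂ)‖ =
      (formNorm (gnsForm t θ) (x n))⁻¹ := fun n => by
    rw [Complex.norm_real, Real.norm_of_nonneg (inv_nonneg.2 (hpos n).le)]
  have hy1 : ∀ n, gnsForm t θ (y n) (y n) = 1 := fun n => by
    rw [← formNorm_sq_complex hq, formNorm_smul hq, hc, inv_mul_cancel₀ (hpos n).ne']
    norm_num
  have hy0 : ∀ n : ℕ, n * projNorm n n (vacMap D 𝔞 t (y n)) ≤ 1 := fun n => by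
    have h1 := projNorm_smul_le n n (((formNorm (gnsForm t θ) (x n))⁻¹ : ℝ) : ℂ)
      (vacMap D 𝔞 t (x n))
    rw [← map_smul, hc] at h1
    calc (n : ℝ) * projNorm n n (vacMap D 𝔞 t (y n)) ≤
        n * ((formNorm (gnsForm t θ) (x n))⁻¹ * projNorm n n (vacMap D 𝔞 t (x n))) := by gcongr
      _ = (formNorm (gnsForm t θ) (x n))⁻¹ * (n * projNorm n n (vacMap D 𝔞 t (x n))) := by ring
      _ ≤ (formNorm (gnsForm t θ) (x n))⁻¹ * formNorm (gnsForm t θ) (x n) := by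
          have := (hx n).le
          have := (inv_pos.2 (hpos n)).le
          gcongr
      _ = 1 := inv_mul_cancel₀ (hpos n).ne'
  -- `AbsContOn` speaks of families indexed by all step functions, so those on 𝔤_t are extended by
  -- zero.
  let ι := Function.Embedding.subtype (· ∈ stepsBefore 𝔞 t)
  have hlim := habs (fun n => (y n).embDomain ι) (fun n g hg => by
    rw [Finsupp.support_embDomain, Finset.mem_map] at hg
    obtain ⟨g, -, rfl⟩ := hg
    exact g.2) (fun p ξ => by
    have hs : ∀ n, ((y n).embDomain ι).sum (fun g x => weyl g (coh x (0 : NoiseFn E))) =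
        vacMap D 𝔞 t (y n) := fun n => Finsupp.sum_embDomain
    simp only [hs]
    refine squeeze_zero' (Eventually.of_forall fun n => projNorm_nonneg _ _ _) ?_
      tendsto_one_div_atTop_nhds_zero_nat
    filter_upwards [eventually_ge_atTop p, eventually_ge_atTop ξ, eventually_gt_atTop 0]
      with n hp hξ hn
    refine (projNorm_mono hp hξ _).trans ?_
    rw [le_div_iff₀' (by exact_mod_cast hn)]
    exact hy0 n)
  have hone : Tendsto (fun _ : ℕ => (1 : ℂ)) atTop (𝓝 0) := hlim.congr fun n => by
    rw [← hy1 n, Finsupp.sum_embDomain, gnsForm, kerForm_apply]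
    exact Finsupp.sum_congr fun g _ => Finsupp.sum_embDomain
  exact one_ne_zero (tendsto_nhds_unique tendsto_const_nhds hone)

/-- The normalized vectors with `W(g)(η ⊗ δ_∅) = exp(∫ g^-_+) η ⊗ (g^•_+)^⊗`. -/
def gnsVec {t : ℝ≥0} (g : stepsBefore 𝔞 t) (η : D) : stepsBefore 𝔞 t →₀ D :=
  Complex.exp (-weylExp g.1 0) • Finsupp.single g η

theorem vacMap_gnsVec {t : ℝ≥0} (g : stepsBefore 𝔞 t) (η : D) :
    vacMap D 𝔞 t (gnsVec g η) = coh η (creaFn g.1) := by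
  rw [gnsVec, map_smul, vacMap_apply, Finsupp.sum_single_index (by rw [coh_zero, map_zero]),
    weyl_vacuum, smul_smul, weylFactor_eq, ← Complex.exp_add, neg_add_cancel, Complex.exp_zero,
    one_smul]

theorem gnsForm_gnsVec {t : ℝ≥0} (θ : StepFn 𝔞 → DForm D) (g' g : stepsBefore 𝔞 t) (η' η : D) :
    gnsForm t θ (gnsVec g' η') (gnsVec g η) =
      (starRingEnd ℂ) (Complex.exp (-weylExp g'.1 0)) * Complex.exp (-weylExp g.1 0) *
        θ (g'.1.starProd g.1) η' η := by
  simp only [gnsVec, LinearMap.map_smulₛₗ, LinearMap.smul_apply, gnsForm, kerForm_single,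
    smul_eq_mul, RingHom.id_apply]
  ring

/-- For a fixed η the GNS bound is an inequality between two quadratic forms in the coefficients. As
a statement on kernels it survives pointwise limits. -/
theorem posKer_gns_bound {t : ℝ≥0} {θ : StepFn 𝔞 → DForm D} (h : PosDefOn t θ) {p ξ : ℕ} {C : ℝ}
    (hC : 0 ≤ C) (hb : ∀ x, formNorm (gnsForm t θ) x ≤ C * projNorm p ξ (vacMap D 𝔞 t x)) (η : D) :
    PosKer fun g' g : stepsBefore 𝔞 t => (((C * nrmL p η) ^ 2 : ℝ) : ℂ) *
      fockKer ξ (creaFn g'.1) (creaFn g.1) - gnsForm t θ (gnsVec g' η) (gnsVec g η) := by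
  refine posKer_of_sum_nonneg fun s c => ?_
  have hq := gnsForm_nonneg h
  set φ : CoherentSpan E := ∑ g ∈ s, c g • Finsupp.single (creaFn g.1) 1 with hφ
  set x := ∑ g ∈ s, c g • gnsVec g η with hx
  have e1 : vacMap D 𝔞 t x = tens η φ := by
    rw [hx, hφ, ← tensMap_apply, map_sum, map_sum]
    refine Finset.sum_congr rfl fun g _ => ?_
    rw [map_smul, map_smul, vacMap_gnsVec, tensMap_apply, tens_single, one_smul]
  have e2 : formNorm (gnsForm t θ) x ≤ C * nrmL p η * fockNorm ξ φ := by
    refine (hb x).trans ?_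
    rw [e1, mul_assoc]
    exact mul_le_mul_of_nonneg_left (projNorm_tens_le _ _ _ _) hC
  have e3 : ∑ i ∈ s, ∑ j ∈ s, (starRingEnd ℂ) (c i) * c j * ((((C * nrmL p η) ^ 2 : ℝ) : ℂ) *
      fockKer ξ (creaFn i.1) (creaFn j.1) - gnsForm t θ (gnsVec i η) (gnsVec j η)) =
      (((C * nrmL p η) ^ 2 : ℝ) : ℂ) * fockForm ξ φ φ - gnsForm t θ x x := by
    rw [hx, hφ, expand_form, expand_form, Finset.mul_sum, ← Finset.sum_sub_distrib]
    refine Finset.sum_congr rfl fun i _ => ?_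
    rw [Finset.mul_sum, ← Finset.sum_sub_distrib]
    refine Finset.sum_congr rfl fun j _ => ?_
    rw [fockForm_single, map_one]
    ring
  rw [e3, ← formNorm_sq_complex (fockForm_nonneg ξ), ← formNorm_sq_complex hq,
    ← Complex.ofReal_mul, ← Complex.ofReal_sub]
  refine Complex.zero_le_real.2 (sub_nonneg.2 ?_)
  rw [← mul_pow]
  exact pow_le_pow_left₀ (formNorm_nonneg _ _) e2 2

/-- Test functions which are approximated by the functions `g^•_+`, `g ∈ 𝔤_t`. -/
def StepApprox (𝔞 : NonUnitalStarSubalgebra ℂ (HPAlg E)) (t : ℝ≥0) (f : NoiseFn E) : Prop :=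
  ∃ g : ℕ → StepFn 𝔞, (∀ n, g n ∈ stepsBefore 𝔞 t) ∧ NTendsto (fun n => creaFn (g n)) f

theorem NTendsto.fockKer {f f' : ℕ → NoiseFn E} {g g' : NoiseFn E} (hf : NTendsto f g)
    (hf' : NTendsto f' g') (ξ : ℕ) :
    Tendsto (fun n => QFlow.fockKer ξ (f' n) (f n)) atTop (𝓝 (QFlow.fockKer ξ g' g)) :=
  (Complex.continuous_exp.tendsto _).comp (hf.nFormL hf' ξ)

/-- The coherent matrix elements `B(f', f)` of the form with the generating function `θ`. -/
structure IsReconstruction (t : ℝ≥0) (θ : StepFn 𝔞 → DForm D)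
    (B : NoiseFn E → NoiseFn E → DForm D) : Prop where
  tendsto : ∀ {g' g : ℕ → StepFn 𝔞} {f' f : NoiseFn E}, (∀ n, g' n ∈ stepsBefore 𝔞 t) →
    (∀ n, g n ∈ stepsBefore 𝔞 t) → NTendsto (fun n => creaFn (g' n)) f' →
    NTendsto (fun n => creaFn (g n)) f → ∀ η' η,
    Tendsto (fun n => (starRingEnd ℂ) (Complex.exp (-weylExp (g' n) 0)) *
      Complex.exp (-weylExp (g n) 0) * θ ((g' n).starProd (g n)) η' η) atTop (𝓝 (B f' f η' η))
  posKer : PosKer fun x y : D × NoiseFn E => B x.2 y.2 x.1 y.1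
  bound : ∃ (p ξ : ℕ) (C : ℝ), 0 ≤ C ∧ ∀ η,
    PosKer fun f' f : {f : NoiseFn E // StepApprox 𝔞 t f} =>
      (((C * nrmL p η) ^ 2 : ℝ) : ℂ) * fockKer ξ f'.1 f.1 - B f'.1 f.1 η η

/-- The GNS bound makes the normalized vectors uniformly controlled by the Fock distance of the
coherent vectors of g^•_+, so they converge whenever these functions do. B is the Gram kernel of the
limits. -/
theorem exists_reconstruction {t : ℝ≥0} {θ : StepFn 𝔞 → DForm D} (h : PosDefOn t θ)
    (habs : AbsContOn t θ) : ∃ B, IsReconstruction t θ B := by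
  classical
  obtain ⟨p, ξ, C, hC, hb⟩ := gnsForm_bound h habs
  have hq := gnsForm_nonneg h
  obtain ⟨H, _, _, _, u, -, hu⟩ := exists_hilbert hq
  have hn : ∀ x, ‖u x‖ = formNorm (gnsForm t θ) x := fun x => by
    rw [norm_eq_sqrt_re_inner (𝕜 := ℂ), hu]; rfl
  have hdist : ∀ (g' g : stepsBefore 𝔞 t) (η : D), dist (u (gnsVec g' η)) (u (gnsVec g η)) ≤
      C * nrmL p η * fockNorm ξ (Finsupp.single (creaFn g'.1) 1 - Finsupp.single (creaFn g.1) 1) :=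
    fun g' g η => by
      rw [dist_eq_norm, ← map_sub, hn]
      refine (hb _).trans ?_
      have : vacMap D 𝔞 t (gnsVec g' η - gnsVec g η) =
          tens η (Finsupp.single (creaFn g'.1) 1 - Finsupp.single (creaFn g.1) 1) := by
        rw [map_sub, vacMap_gnsVec, vacMap_gnsVec, ← tensMap_apply, map_sub, tensMap_apply,
          tensMap_apply, tens_single, tens_single, one_smul]
      rw [this, mul_assoc]
      exact mul_le_mul_of_nonneg_left (projNorm_tens_le _ _ _ _) hC
  let vec : stepsBefore 𝔞 t → D →ₗ[ℂ] H := fun g =>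
    u ∘ₗ (Complex.exp (-weylExp g.1 0) • Finsupp.lsingle g)
  have hvec : ∀ g η, vec g η = u (gnsVec g η) := fun g η => rfl
  -- J is the limit along one approximating sequence, linear in η as a pointwise limit of linear
  -- maps; any other sequence has the same limit by `hdist`.
  have hJ : ∀ f : NoiseFn E, ∃ J : D →ₗ[ℂ] H, ∀ g : ℕ → stepsBefore 𝔞 t,
      NTendsto (fun n => creaFn (g n).1) f → ∀ η,
        Tendsto (fun n => u (gnsVec (g n) η)) atTop (𝓝 (J η)) := by
    intro f
    by_cases hf : StepApprox 𝔞 t f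
    · obtain ⟨g₀, hg₀, hlim₀⟩ := hf
      let g₁ : ℕ → stepsBefore 𝔞 t := fun n => ⟨g₀ n, hg₀ n⟩
      have hcauchy : ∀ η, ∃ v, Tendsto (fun n => vec (g₁ n) η) atTop (𝓝 v) := fun η => by
        refine cauchySeq_tendsto_of_complete (cauchySeq_iff_tendsto_dist_atTop_0.2 ?_)
        have h1 := tendsto_fockNorm_sub (ξ := ξ) (l := (atTop : Filter (ℕ × ℕ)))
          (f := fun n => creaFn (g₁ n.1).1) (g := fun n => creaFn (g₁ n.2).1) (h := f)
          (by rw [← prod_atTop_atTop_eq]; exact (hlim₀ ξ).comp tendsto_fst)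
          (by rw [← prod_atTop_atTop_eq]; exact (hlim₀ ξ).comp tendsto_snd)
        refine squeeze_zero (fun _ => dist_nonneg) (fun n => hdist (g₁ n.1) (g₁ n.2) η) ?_
        simpa using h1.const_mul (C * nrmL p η)
      choose J₀ hJ₀ using hcauchy
      refine ⟨linearMapOfTendsto J₀ (fun n => vec (g₁ n)) (tendsto_pi_nhds.2 hJ₀),
        fun g hg η => ?_⟩
      refine tendsto_of_tendsto_of_dist (hJ₀ η) ?_
      have h1 := tendsto_fockNorm_sub (ξ := ξ) (l := (atTop : Filter ℕ))
          (f := fun n => creaFn (g₁ n).1) (g := fun n => creaFn (g n).1) (h := f) (hlim₀ ξ) (hg ξ)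
      refine squeeze_zero (fun _ => dist_nonneg) (fun n => hdist (g₁ n) (g n) η) ?_
      simpa using h1.const_mul (C * nrmL p η)
    -- Functions without approximation get the vector 0, so that B is a positive kernel on all test
    -- functions.
    · exact ⟨0, fun g hg => absurd ⟨fun n => (g n).1, fun n => (g n).2, hg⟩ hf⟩
  choose J hJ using hJ
  let B : NoiseFn E → NoiseFn E → DForm D := fun f' f =>
    LinearMap.mk₂'ₛₗ (starRingEnd ℂ) (RingHom.id ℂ) (fun η' η => inner ℂ (J f' η') (J f η))
      (fun _ _ _ => by rw [map_add, inner_add_left])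
      (fun _ _ _ => by rw [map_smul, inner_smul_left, smul_eq_mul])
      (fun _ _ _ => by rw [map_add, inner_add_right])
      (fun _ _ _ => by rw [map_smul, inner_smul_right, smul_eq_mul, RingHom.id_apply])
  have hB : ∀ f' f η' η, B f' f η' η = inner ℂ (J f' η') (J f η) := fun _ _ _ _ => rfl
  refine ⟨B, ?_, ?_, ⟨p, ξ, C, hC, fun η => ?_⟩⟩
  · intro g' g f' f hg' hg hf' hf η' η
    have h1 := (hJ f' (fun n => ⟨g' n, hg' n⟩) hf' η').inner (𝕜 := ℂ)
      (hJ f (fun n => ⟨g n, hg n⟩) hf η)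
    rw [hB]
    simpa only [hu, gnsForm_gnsVec] using h1
  · exact posKer_of_form (q := innerₛₗ ℂ) (fun x => by
      rw [innerₛₗ_apply_apply, inner_self_eq_norm_sq_to_K]
      simp) fun x : D × NoiseFn E => J x.2 x.1
  · choose a ha hlim using fun f : {f : NoiseFn E // StepApprox 𝔞 t f} => f.2
    refine posKer_of_tendsto (l := (atTop : Filter ℕ)) (k := fun n f' f =>
      (((C * nrmL p η) ^ 2 : ℝ) : ℂ) * fockKer ξ (creaFn (a f' n)) (creaFn (a f n)) -
        gnsForm t θ (gnsVec ⟨a f' n, ha f' n⟩ η) (gnsVec ⟨a f n, ha f n⟩ η))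
      (fun n => (posKer_gns_bound h hC hb η).comp fun f => (⟨a f n, ha f n⟩ : stepsBefore 𝔞 t))
      fun f' f => ?_
    refine (((hlim f).fockKer (hlim f') ξ).const_mul _).sub ?_
    have h1 := (hJ f'.1 (fun n => ⟨a f' n, ha f' n⟩) (hlim f') η).inner (𝕜 := ℂ)
      (hJ f.1 (fun n => ⟨a f n, ha f n⟩) (hlim f) η)
    rw [hB]
    simpa only [hu] using h1

end Reconstruction

/-! ### The splitting of the noise space -/

section Splitting

variable {E : Type*} [AddCommGroup E] [Module ℂ E] [UniformSpace E] [IsUniformAddGroup E]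
  [ContinuousSMul ℂ E] [HilbertScale E] {𝔞 : NonUnitalStarSubalgebra ℂ (HPAlg E)}
  {D : Type*} [AddCommGroup D] [Module ℂ D] [UniformSpace D] [IsUniformAddGroup D]
  [ContinuousSMul ℂ D] [HilbertScale D]

/-- `P` is the orthogonal projection onto the closure of `{a^•_+ : a ∈ 𝔞}`, and `P ⊕ (1 - P)` is
a projective contraction. -/
structure IsCreaProj (𝔞 : NonUnitalStarSubalgebra ℂ (HPAlg E)) (P : E →L[ℂ] E) : Prop where
  mem : ∀ e, P e ∈ closure (creaSet 𝔞)
  orth : ∀ e, ∀ a ∈ 𝔞, ip a.crea (e - P e) = 0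
  bound : ∀ ζ, ∃ ξ, ∀ e, nrmL ζ (P e) ^ 2 + nrm (e - P e) ^ 2 ≤ nrmL ξ e ^ 2

theorem NoiseComplemented.exists_isCreaProj (h : NoiseComplemented 𝔞) :
    ∃ P : E →L[ℂ] E, IsCreaProj 𝔞 P := by
  obtain ⟨P, h1, h2, h3⟩ := h
  have hW := HilbertScale.withSeminorms (E := E)
  refine ⟨⟨P, WithSeminorms.continuous_of_isBounded hW hW P fun ζ => ?_⟩, h1, h2, h3⟩
  obtain ⟨ξ, hξ⟩ := h3 ζ
  refine ⟨{ξ}, 1, fun e => ?_⟩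
  rw [Finset.sup_singleton, one_smul]
  exact (pow_le_pow_iff_left₀ (nrmL_nonneg ζ (P e)) (nrmL_nonneg ξ e) two_ne_zero).1
    ((le_add_of_nonneg_right (sq_nonneg _)).trans (hξ e))

theorem HPAlg.ip_sub_right (x y z : E) : ip x (y - z) = ip x y - ip x z := by
  simp [← ipForm_apply]

theorem HPAlg.ip_sub_left (x y z : E) : ip (x - y) z = ip x z - ip y z := by
  simp [← ipForm_apply]

theorem ip_eq_zero_of_mem_closure {S : Set E} {k e : E} (hk : k ∈ closure S)
    (h : ∀ x ∈ S, ip x e = 0) : ip k e = 0 := by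
  have hc : Continuous fun x : E => ip x e :=
    (dominated_core.continuous_inner).comp (continuous_id.prodMk continuous_const)
  exact closure_minimal h (isClosed_singleton.preimage hc) hk

variable {P : E →L[ℂ] E}

namespace IsCreaProj

/-- Uniqueness of the orthogonal projection: P e - x lies in the closure K and is orthogonal to K,
so it vanishes because the pre-Hilbert product is definite. -/
theorem eq_of_orth (hP : IsCreaProj 𝔞 P) {x e : E} (hx : x ∈ closure (creaSet 𝔞))
    (h : ∀ a ∈ 𝔞, ip a.crea (e - x) = 0) : P e = x := by
  have h1 : ∀ k ∈ closure (creaSet 𝔞), ip k (P e - x) = 0 := fun k hk =>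
    ip_eq_zero_of_mem_closure hk fun y hy => by
      obtain ⟨a, ha, rfl⟩ := hy
      have : P e - x = (e - x) - (e - P e) := by abel
      rw [this, HPAlg.ip_sub_right, h a ha, hP.orth e a ha, sub_zero]
  have h2 : ip (P e - x) (P e - x) = 0 := by
    rw [HPAlg.ip_sub_left, h1 _ (hP.mem e), h1 _ hx, sub_zero]
  exact sub_eq_zero.1 ((HilbertScale.core (E := E)).definite _ h2)

theorem map_crea (hP : IsCreaProj 𝔞 P) (a : 𝔞) : P a.1.crea = a.1.crea :=
  hP.eq_of_orth (subset_closure ⟨a.1, a.2, rfl⟩) fun b _ => by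
    rw [sub_self, HPAlg.ip_zero_right]

theorem gauge_mem {x : E} (hx : x ∈ closure (creaSet 𝔞)) (a : 𝔞) :
    a.1.gauge x ∈ closure (creaSet 𝔞) :=
  map_mem_closure a.1.gauge.continuous hx fun y hy => by
    obtain ⟨b, hb, rfl⟩ := hy
    exact ⟨a.1 * b, mul_mem a.2 hb, rfl⟩

/-- The gauge operator maps K into K since (ab)^•_+ = a^•_• b^•_+, and preserves the orthogonal
complement by the same formula for a^⋆b. -/
theorem map_gauge (hP : IsCreaProj 𝔞 P) (a : 𝔞) (e : E) : P (a.1.gauge e) = a.1.gauge (P e) :=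
  hP.eq_of_orth (gauge_mem (hP.mem e) a) fun b hb => by
    rw [← map_sub, ← a.1.adjoint]
    exact hP.orth e (star a.1 * b) (mul_mem (star_mem a.2) hb)

theorem ip_anni_rest (hP : IsCreaProj 𝔞 P) (a : 𝔞) (e : E) : ip a.1.anni (e - P e) = 0 :=
  hP.orth e (star a.1) (star_mem a.2)

end IsCreaProj

/-- The part `1_[0, t) P f` of a test function. -/
def mainPart (P : E →L[ℂ] E) (t : ℝ≥0) : NoiseFn E →ₗ[ℂ] NoiseFn E where
  toFun f := ⟨fun s => P (f.past t s), (f.past t).isNoise.map P⟩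
  map_add' f g := NoiseFn.ext fun s => by
    change P ((f + g).past t s) = P (f.past t s) + P (g.past t s)
    simp only [NoiseFn.past_apply, NoiseFn.add_apply]
    split_ifs <;> simp
  map_smul' c f := NoiseFn.ext fun s => by
    change P ((c • f).past t s) = c • P (f.past t s)
    simp only [NoiseFn.past_apply, NoiseFn.smul_apply]
    split_ifs <;> simp

theorem mainPart_apply (P : E →L[ℂ] E) (t : ℝ≥0) (f : NoiseFn E) (s : ℝ≥0) :
    mainPart P t f s = if s < t then P (f s) else 0 := by
  change P (f.past t s) = _
  rw [NoiseFn.past_apply]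
  split_ifs <;> simp

/-- The part of a test function complementary to `mainPart`. -/
def restPart (P : E →L[ℂ] E) (t : ℝ≥0) : NoiseFn E →ₗ[ℂ] NoiseFn E :=
  LinearMap.id - mainPart P t

theorem restPart_apply (P : E →L[ℂ] E) (t : ℝ≥0) (f : NoiseFn E) (s : ℝ≥0) :
    restPart P t f s = if s < t then f s - P (f s) else f s := by
  rw [restPart, LinearMap.sub_apply, LinearMap.id_apply, NoiseFn.sub_apply, mainPart_apply]
  split_ifs <;> simp

theorem IsCreaProj.stepApprox (hP : IsCreaProj 𝔞 P) (t : ℝ≥0) (f : NoiseFn E) :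
    StepApprox 𝔞 t (mainPart P t f) :=
  exists_approx (fun s => by
    rw [mainPart_apply]
    split_ifs
    · exact hP.mem _
    · exact subset_closure ⟨0, zero_mem 𝔞, rfl⟩) fun s hs => by
    rw [mainPart_apply, if_neg (not_lt.2 hs)]

theorem mainPart_zero_time (P : E →L[ℂ] E) (f : NoiseFn E) : mainPart P 0 f = 0 :=
  NoiseFn.ext fun s => by
    rw [mainPart_apply, if_neg not_lt_zero]; rfl

theorem restPart_zero_time (P : E →L[ℂ] E) (f : NoiseFn E) : restPart P 0 f = f :=
  NoiseFn.ext fun s => by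
    rw [restPart_apply, if_neg not_lt_zero]

theorem mainPart_past (P : E →L[ℂ] E) {t s : ℝ≥0} (h : t ≤ s) (f : NoiseFn E) :
    mainPart P s (f.past t) = mainPart P t f := NoiseFn.ext fun r => by
  rw [mainPart_apply, mainPart_apply, NoiseFn.past_apply]
  by_cases hr : r < t
  · simp [hr, hr.trans_le h]
  · simp [hr]

/-- The rest at time s of f_t is (1 - P)f on [0, t) and zero afterwards; the future f_{[t} supplies
exactly what is missing from the rest at time t. -/
theorem nForm_restPart_past (P : E →L[ℂ] E) {t s : ℝ≥0} (h : t ≤ s) (f' f : NoiseFn E) :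
    nForm (f'.future t) (f.future t) +
      nForm (restPart P s (f'.past t)) (restPart P s (f.past t)) =
      nForm (restPart P t f') (restPart P t f) := by
  simp only [nForm_apply, NoiseFn.inner]
  rw [← integral_add (integrable_ip (NoiseFn.isNoise _) (NoiseFn.isNoise _))
    (integrable_ip (NoiseFn.isNoise _) (NoiseFn.isNoise _))]
  refine integral_congr_ae (Eventually.of_forall fun r => ?_)
  simp only [restPart_apply, NoiseFn.past_apply, NoiseFn.future_apply]
  by_cases hr : r < t
  · simp [hr, hr.trans_le h, not_le.2 hr, HPAlg.ip_zero_right]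
  · simp [hr, not_lt.1 hr, HPAlg.ip_zero_right]

theorem IsCreaProj.mainPart_creaFn (hP : IsCreaProj 𝔞 P) {t : ℝ≥0} {g : StepFn 𝔞}
    (hg : g ∈ stepsBefore 𝔞 t) : mainPart P t (creaFn g) = creaFn g := NoiseFn.ext fun s => by
  rw [mainPart_apply]
  split_ifs with hs
  · exact hP.map_crea _
  · exact (creaFn_of_mem hg s (not_lt.1 hs)).symm

theorem IsCreaProj.mainPart_weylShift (hP : IsCreaProj 𝔞 P) (t : ℝ≥0) (g : StepFn 𝔞)
    (f : NoiseFn E) : mainPart P t (weylShift g f) = weylShift (g.cut t) (mainPart P t f) :=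
  NoiseFn.ext fun s => by
    simp only [mainPart_apply, weylShift_apply, StepFn.cut_apply]
    split_ifs
    · rw [map_add, map_add, hP.map_crea, hP.map_gauge]
    · simp

theorem StepFn.star_cut (t : ℝ≥0) (g : StepFn 𝔞) : star (g.cut t) = (star g).cut t :=
  StepFn.ext' fun s => by
    simp only [StepFn.star_apply, StepFn.cut_apply]
    split_ifs <;> simp

theorem conj_weylExp_star (g : StepFn 𝔞) (f : NoiseFn E) :
    (starRingEnd ℂ) (weylExp (star g) f) =
      ∫ s, (ip (f s) (g s).1.crea + (g s).1.time) ∂timeMeasure := by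
  rw [weylExp, ← integral_conj]
  refine integral_congr_ae (Eventually.of_forall fun s => ?_)
  simp [ip_conj]

theorem integrable_conj_weylExp_star (g : StepFn 𝔞) (f : NoiseFn E) :
    Integrable (fun s => ip (f s) (g s).1.crea + (g s).1.time) timeMeasure :=
  (integrable_ip f.isNoise (isNoise_crea g)).add (integrable_step g (fun a => a.1.time) rfl)

/-- The balance of exponents needed for commutation with W(g), arranged so that both terms of the
cut function g·1_[0,t) on the main parts can be matched with `IsReconstruction.weyl`. -/
theorem IsCreaProj.weylExp_rest (hP : IsCreaProj 𝔞 P) (t : ℝ≥0) (g : StepFn 𝔞)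
    (f' f : NoiseFn E) :
    weylExp g f + nForm (restPart P t f') (restPart P t (weylShift g f)) +
      (starRingEnd ℂ) (weylExp (star (g.cut t)) (mainPart P t f')) =
    (starRingEnd ℂ) (weylExp (star g) f') +
      nForm (restPart P t (weylShift (star g) f')) (restPart P t f) +
      weylExp (g.cut t) (mainPart P t f) := by
  simp only [conj_weylExp_star, nForm_apply, NoiseFn.inner]
  simp only [weylExp]
  have i1 := integrable_weylExp g f
  have i2 := integrable_ip (restPart P t f').isNoise (restPart P t (weylShift g f)).isNoise
  have i3 := integrable_conj_weylExp_star (g.cut t) (mainPart P t f')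
  have i4 := integrable_conj_weylExp_star g f'
  have i5 := integrable_ip (restPart P t (weylShift (star g) f')).isNoise (restPart P t f).isNoise
  have i6 := integrable_weylExp (g.cut t) (mainPart P t f)
  have j1 := integral_add (i1.add i2) i3
  have j2 := integral_add (i4.add i5) i6
  simp only [Pi.add_apply] at j1 j2
  rw [← integral_add i1 i2, ← j1, ← integral_add i4 i5, ← j2]
  refine integral_congr_ae (Eventually.of_forall fun s => ?_)
  simp only [restPart_apply, mainPart_apply, weylShift_apply, StepFn.cut_apply,
    StepFn.star_apply]
  have hstar : ∀ a : 𝔞, (star a : 𝔞).1 = star a.1 := fun _ => rfl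
  split_ifs with hs
  -- Before t the vector g^•_+ lies in K and disappears from the rest, where W(g) acts by 1 + g^•_•;
  -- this moves across by the adjoint. The leftover terms pair the rest with g^-_• and g^•_+ and
  -- vanish by orthogonality.
  · have e1 : f s + (g s).1.gauge (f s) + (g s).1.crea -
        P (f s + (g s).1.gauge (f s) + (g s).1.crea) =
        (f s - P (f s)) + (g s).1.gauge (f s - P (f s)) := by
      rw [map_add, map_add, map_sub, hP.map_crea, hP.map_gauge]
      abel
    have e2 : f' s + (star (g s)).1.gauge (f' s) + (star (g s)).1.crea -
        P (f' s + (star (g s)).1.gauge (f' s) + (star (g s)).1.crea) =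
        (f' s - P (f' s)) + (g s).1.gaugeAdj (f' s - P (f' s)) := by
      rw [map_add, map_add, hP.map_crea, hP.map_gauge, hstar, HPAlg.star_gauge, map_sub]
      abel
    have e3 := hP.ip_anni_rest (g s) (f s)
    have e4 : ip (f' s - P (f' s)) (g s).1.crea = 0 := by
      rw [← ip_conj, hP.orth _ _ (g s).2, map_zero]
    rw [e1, e2, HPAlg.ip_add_left, HPAlg.ip_add_right, (g s).1.adjoint]
    rw [HPAlg.ip_sub_right] at e3
    rw [HPAlg.ip_sub_left] at e4
    linear_combination e3 - e4
  · simp only [hstar, HPAlg.star_gauge, HPAlg.star_crea, HPAlg.ip_add_left, HPAlg.ip_add_right,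
      (g s).1.adjoint, ZeroMemClass.coe_zero, HPAlg.zero_crea, HPAlg.zero_anni, HPAlg.zero_time,
      HPAlg.ip_zero_right]
    ring

/-- The bound on P is integrated over [0, t). After t the main part vanishes and the pre-Hilbert
norm is dominated by the norm ξ, so ξ does not depend on t. -/
theorem IsCreaProj.posKer_split (hP : IsCreaProj 𝔞 P) (ζ : ℕ) : ∃ ξ, ∀ t,
    PosKer fun f' f : NoiseFn E => nFormL ξ f' f -
      (nFormL ζ (mainPart P t f') (mainPart P t f) +
        nForm (restPart P t f') (restPart P t f)) := by
  obtain ⟨ξ, hξ⟩ := hP.bound ζ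
  refine ⟨ξ, fun t => posKer_of_sum_nonneg fun S c => ?_⟩
  set F := ∑ i ∈ S, c i • i with hF
  have e : ∑ i ∈ S, ∑ j ∈ S, (starRingEnd ℂ) (c i) * c j * (nFormL ξ i j -
      (nFormL ζ (mainPart P t i) (mainPart P t j) +
        nForm (restPart P t i) (restPart P t j))) =
      nFormL ξ F F - (nFormL ζ (mainPart P t F) (mainPart P t F) +
        nForm (restPart P t F) (restPart P t F)) := by
    simp only [hF, map_sum (mainPart P t), map_sum (restPart P t), map_smul (mainPart P t),
      map_smul (restPart P t), expand_form, ← Finset.sum_sub_distrib, ← Finset.sum_add_distrib]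
    exact Finset.sum_congr rfl fun i _ => Finset.sum_congr rfl fun j _ => by ring
  have e2 : nForm (restPart P t F) (restPart P t F) =
      ((∫ s, nrm (restPart P t F s) ^ 2 ∂timeMeasure : ℝ) : ℂ) := noiseForm_self _ _
  have i1 := (mainPart P t F).isNoise.sq ζ
  have i2 : Integrable (fun s => nrm (restPart P t F s) ^ 2) timeMeasure :=
    dominated_core.integrable_sq (restPart P t F).isNoise
  rw [e, nFormL_self, nFormL_self, e2, ← Complex.ofReal_add, ← Complex.ofReal_sub,
    ← integral_add i1 i2]
  refine Complex.zero_le_real.2 (sub_nonneg.2 (integral_mono (i1.add i2) (F.isNoise.sq ξ)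
    fun s => ?_))
  change nrmL ζ (mainPart P t F s) ^ 2 + nrm (restPart P t F s) ^ 2 ≤ _
  rw [mainPart_apply, restPart_apply]
  split_ifs
  · exact hξ _
  · rw [nrmL_zero, zero_pow two_ne_zero, zero_add]
    exact pow_le_pow_left₀ (nrm_nonneg _) (nrm_le _ _) 2

end Splitting

/-! ### Properties of the reconstructed coherent matrix elements -/

section ReconstructionProperties

variable {E : Type*} [AddCommGroup E] [Module ℂ E] [UniformSpace E] [IsUniformAddGroup E]
  [ContinuousSMul ℂ E] [HilbertScale E] {𝔞 : NonUnitalStarSubalgebra ℂ (HPAlg E)}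
  {D : Type*} [AddCommGroup D] [Module ℂ D] [UniformSpace D] [IsUniformAddGroup D]
  [ContinuousSMul ℂ D] [HilbertScale D]

theorem nTendsto_const (f : NoiseFn E) : NTendsto (fun _ => f) f := fun ξ => by
  have h : formNorm (nFormL ξ) (f - f) = 0 := by
    rw [sub_self]
    exact formNorm_nFormL_eq_zero ξ (Eventually.of_forall fun _ => rfl)
  simp only [h, tendsto_const_nhds]

/-- A step function takes finitely many values, so finitely many operator bounds combine into one.
-/
theorem exists_gauge_bound (g : StepFn 𝔞) (ξ : ℕ) : ∃ (ζ : ℕ) (C : ℝ), 0 ≤ C ∧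
    ∀ s e, nrmL ξ ((g s).1.gauge e) ≤ C * nrmL ζ e := by
  classical
  have hfin := g.isStep.factor.1
  choose ζ C hC h using fun a : 𝔞 => exists_bound a.1.gauge ξ
  refine ⟨hfin.toFinset.sup ζ, ∑ a ∈ hfin.toFinset, C a, Finset.sum_nonneg fun a _ => hC a,
    fun s e => ?_⟩
  have hs : g s ∈ hfin.toFinset := hfin.mem_toFinset.2 ⟨s, rfl⟩
  refine (h (g s) e).trans (mul_le_mul ?_ (nrmL_mono (Finset.le_sup hs) e) (nrmL_nonneg _ _)
    (Finset.sum_nonneg fun a _ => hC a))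
  exact Finset.single_le_sum (f := C) (fun a _ => hC a) hs

theorem nTendsto_weylShift {f : ℕ → NoiseFn E} {f₀ : NoiseFn E} (hf : NTendsto f f₀)
    (g : StepFn 𝔞) : NTendsto (fun n => weylShift g (f n)) (weylShift g f₀) := by
  intro ξ
  obtain ⟨ζ, C, hC, h⟩ := exists_gauge_bound g ξ
  have hb : ∀ n, formNorm (nFormL ξ) (weylShift g (f n) - weylShift g f₀) ≤
      formNorm (nFormL ξ) (f n - f₀) + C * formNorm (nFormL ζ) (f n - f₀) := fun n => by
    have e : weylShift g (f n) - weylShift g f₀ =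
        (f n - f₀) + ⟨_, isNoise_gauge g (f n - f₀)⟩ := NoiseFn.ext fun s => by
      rw [NoiseFn.add_apply]
      change _ = _ + (g s).1.gauge ((f n - f₀) s)
      simp only [NoiseFn.sub_apply, weylShift_apply, map_sub]
      abel
    rw [e]
    refine (formNorm_add_le (nFormL_nonneg ξ) _ _).trans (add_le_add_right ?_ _)
    refine (pow_le_pow_iff_left₀ (formNorm_nonneg _ _)
      (mul_nonneg hC (formNorm_nonneg _ _)) two_ne_zero).1 ?_
    rw [mul_pow, formNorm_nFormL_sq, formNorm_nFormL_sq, ← integral_const_mul]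
    refine integral_mono ((isNoise_gauge g (f n - f₀)).sq ξ)
      (((f n - f₀).isNoise.sq ζ).const_mul _) fun s => ?_
    simp only [← mul_pow]
    exact pow_le_pow_left₀ (nrmL_nonneg _ _) (h s _) 2
  refine squeeze_zero (fun _ => formNorm_nonneg _ _) hb ?_
  simpa using (hf ξ).add ((hf ζ).const_mul C)

theorem weylExp_eq (g : StepFn 𝔞) (f : NoiseFn E) :
    weylExp g f = nForm (creaFn (star g)) f + weylExp g 0 := by
  rw [weylExp_zero_right, nForm_apply, NoiseFn.inner, weylExp,
    ← integral_add (integrable_ip (creaFn (star g)).isNoise f.isNoise)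
      (integrable_step g (fun a => a.1.time) rfl)]
  rfl

theorem tendsto_weylExp {f : ℕ → NoiseFn E} {f₀ : NoiseFn E} (hf : NTendsto f f₀)
    (g : StepFn 𝔞) :
    Tendsto (fun n => weylExp g (f n)) atTop (𝓝 (weylExp g f₀)) := by
  simp only [weylExp_eq g (f _), weylExp_eq g f₀]
  exact (hf.nForm (nTendsto_const (creaFn (star g)))).add_const _

theorem weylExp_zero_left (f : NoiseFn E) : weylExp (0 : StepFn 𝔞) f = 0 := by
  simp [weylExp, ip_zero_left]

theorem StepFn.zero_starProd (g : StepFn 𝔞) : (0 : StepFn 𝔞).starProd g = g :=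
  StepFn.ext' fun s => by simp [StepFn.starProd_apply]

theorem creaFn_zero : creaFn (0 : StepFn 𝔞) = 0 := NoiseFn.ext fun _ => rfl

namespace IsReconstruction

variable {t : ℝ≥0} {θ : StepFn 𝔞 → DForm D} {B : NoiseFn E → NoiseFn E → DForm D}

theorem apply_creaFn (hB : IsReconstruction t θ B) {g : StepFn 𝔞} (hg : g ∈ stepsBefore 𝔞 t)
    (η' η : D) : B 0 (creaFn g) η' η = Complex.exp (-weylExp g 0) * θ g η' η := by
  have h := hB.tendsto (g' := fun _ => 0) (g := fun _ => g) (fun _ => zero_mem_stepsBefore t)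
    (fun _ => hg) (nTendsto_const _) (nTendsto_const _) η' η
  rw [creaFn_zero] at h
  rw [tendsto_nhds_unique h tendsto_const_nhds, StepFn.zero_starProd, weylExp_zero_left, neg_zero,
    Complex.exp_zero, map_one, one_mul]

theorem commutes (hB : IsReconstruction t θ B) {A A' : D →L[ℂ] D}
    (hA : ∀ g ∈ stepsBefore 𝔞 t, ∀ η' η, θ g η' (A η) = θ g (A' η') η) {f' f : NoiseFn E}
    (hf' : StepApprox 𝔞 t f') (hf : StepApprox 𝔞 t f) (η' η : D) :
    B f' f η' (A η) = B f' f (A' η') η := by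
  obtain ⟨g', hg', hlim'⟩ := hf'
  obtain ⟨g, hg, hlim⟩ := hf
  refine tendsto_nhds_unique (hB.tendsto hg' hg hlim' hlim η' (A η)) ?_
  simp only [hA _ (starProd_mem_stepsBefore (hg' _) (hg _))]
  exact hB.tendsto hg' hg hlim' hlim (A' η') η

/-- The functions k^⋆ ⋆ g_n have creation parts converging to `weylShift k f`, and the cocycle
identity turns their normalization into that of g_n times the exponential of `weylExp k`. -/
theorem weyl_right (hB : IsReconstruction t θ B) {k : StepFn 𝔞} (hk : k ∈ stepsBefore 𝔞 t)
    {g' g : ℕ → StepFn 𝔞} {f' f : NoiseFn E} (hg' : ∀ n, g' n ∈ stepsBefore 𝔞 t)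
    (hg : ∀ n, g n ∈ stepsBefore 𝔞 t) (hlim' : NTendsto (fun n => creaFn (g' n)) f')
    (hlim : NTendsto (fun n => creaFn (g n)) f) (η' η : D) :
    Tendsto (fun n => (starRingEnd ℂ) (Complex.exp (-weylExp (g' n) 0)) *
      Complex.exp (-weylExp (g n) 0) * θ ((g' n).starProd ((star k).starProd (g n))) η' η) atTop
      (𝓝 (Complex.exp (weylExp k f) * B f' (weylShift k f) η' η)) := by
  have e : ∀ n, creaFn ((star k).starProd (g n)) = weylShift k (creaFn (g n)) := fun n => by
    rw [← weylShift_zero_right, weylShift_starProd, StepFn.star_star, weylShift_zero_right]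
  have h1 := hB.tendsto hg'
    (fun n => starProd_mem_stepsBefore (star_mem_stepsBefore hk) (hg n)) hlim'
    (by simp only [e]; exact nTendsto_weylShift hlim k) η' η
  have h2 := ((Complex.continuous_exp.tendsto _).comp (tendsto_weylExp hlim k)).mul h1
  refine h2.congr fun n => ?_
  rw [weylExp_starProd, StepFn.star_star, weylShift_zero_right, neg_add, Complex.exp_add,
    Complex.exp_neg (weylExp k _), Function.comp_apply]
  have := Complex.exp_ne_zero (weylExp k (creaFn (g n)))
  field_simp

theorem weyl_left (hB : IsReconstruction t θ B) {k : StepFn 𝔞} (hk : k ∈ stepsBefore 𝔞 t)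
    {g' g : ℕ → StepFn 𝔞} {f' f : NoiseFn E} (hg' : ∀ n, g' n ∈ stepsBefore 𝔞 t)
    (hg : ∀ n, g n ∈ stepsBefore 𝔞 t) (hlim' : NTendsto (fun n => creaFn (g' n)) f')
    (hlim : NTendsto (fun n => creaFn (g n)) f) (η' η : D) :
    Tendsto (fun n => (starRingEnd ℂ) (Complex.exp (-weylExp (g' n) 0)) *
      Complex.exp (-weylExp (g n) 0) * θ (((star k).starProd (g' n)).starProd (g n)) η' η) atTop
      (𝓝 ((starRingEnd ℂ) (Complex.exp (weylExp k f')) * B (weylShift k f') f η' η)) := by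
  have e : ∀ n, creaFn ((star k).starProd (g' n)) = weylShift k (creaFn (g' n)) := fun n => by
    rw [← weylShift_zero_right, weylShift_starProd, StepFn.star_star, weylShift_zero_right]
  have h1 := hB.tendsto
    (fun n => starProd_mem_stepsBefore (star_mem_stepsBefore hk) (hg' n)) hg
    (by simp only [e]; exact nTendsto_weylShift hlim' k) hlim η' η
  have h2 := ((Complex.continuous_conj.tendsto _).comp
    ((Complex.continuous_exp.tendsto _).comp (tendsto_weylExp hlim' k))).mul h1
  refine h2.congr fun n => ?_
  rw [weylExp_starProd, StepFn.star_star, weylShift_zero_right, neg_add, Complex.exp_add,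
    Complex.exp_neg (weylExp k _), Function.comp_apply, Function.comp_apply, map_mul, map_inv₀]
  have : (starRingEnd ℂ) (Complex.exp (weylExp k (creaFn (g' n)))) ≠ 0 :=
    (map_ne_zero _).2 (Complex.exp_ne_zero _)
  field_simp

/-- Both sides are limits of the same sequence, because g' ⋆ (k^⋆ ⋆ g) = (k ⋆ g') ⋆ g. -/
theorem weyl (hB : IsReconstruction t θ B) {k : StepFn 𝔞} (hk : k ∈ stepsBefore 𝔞 t)
    {f' f : NoiseFn E} (hf' : StepApprox 𝔞 t f') (hf : StepApprox 𝔞 t f) (η' η : D) :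
    Complex.exp (weylExp k f) * B f' (weylShift k f) η' η =
      (starRingEnd ℂ) (Complex.exp (weylExp (star k) f')) *
        B (weylShift (star k) f') f η' η := by
  obtain ⟨g', hg', hlim'⟩ := hf'
  obtain ⟨g, hg, hlim⟩ := hf
  refine tendsto_nhds_unique (hB.weyl_right hk hg' hg hlim' hlim η' η) ?_
  simp only [StepFn.starProd_starProd]
  have := hB.weyl_left (star_mem_stepsBefore hk) hg' hg hlim' hlim η' η
  simpa only [StepFn.star_star] using this

/-- One approximation in 𝔤_t serves both times since 𝔤_t ⊆ 𝔤_s, so the difference is a limit of Gram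
kernels of the GNS form of θ - θ'. -/
theorem posKer_sub (hB : IsReconstruction t θ B) {s : ℝ≥0} (hts : t ≤ s)
    {θ' : StepFn 𝔞 → DForm D} {B' : NoiseFn E → NoiseFn E → DForm D}
    (hB' : IsReconstruction s θ' B') (h : PosDefOn t fun g => θ g - θ' g) :
    PosKer fun x y : D × {f : NoiseFn E // StepApprox 𝔞 t f} =>
      (B x.2.1 y.2.1 - B' x.2.1 y.2.1) x.1 y.1 := by
  choose a ha hlim using fun f : {f : NoiseFn E // StepApprox 𝔞 t f} => f.2
  have hpos : ∀ n, PosKer fun x y : D × {f : NoiseFn E // StepApprox 𝔞 t f} =>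
      gnsForm t (fun g => θ g - θ' g) (gnsVec ⟨a x.2 n, ha x.2 n⟩ x.1)
        (gnsVec ⟨a y.2 n, ha y.2 n⟩ y.1) := fun n =>
    posKer_of_form (gnsForm_nonneg h) fun x : D × {f : NoiseFn E // StepApprox 𝔞 t f} =>
      gnsVec ⟨a x.2 n, ha x.2 n⟩ x.1
  refine posKer_of_tendsto (l := (atTop : Filter ℕ)) hpos fun x y => ?_
  have hs := fun f n => stepsBefore_mono hts (ha f n)
  simp only [gnsForm_gnsVec, LinearMap.sub_apply, mul_sub]
  exact (hB.tendsto (ha _) (ha _) (hlim _) (hlim _) _ _).sub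
    (hB'.tendsto (hs _) (hs _) (hlim _) (hlim _) _ _)

theorem eq_of_eqOn (hB : IsReconstruction t θ B) {s : ℝ≥0} (hts : t ≤ s)
    {θ' : StepFn 𝔞 → DForm D} {B' : NoiseFn E → NoiseFn E → DForm D}
    (hB' : IsReconstruction s θ' B') (h : ∀ g ∈ stepsBefore 𝔞 t, θ g = θ' g) {f' f : NoiseFn E}
    (hf' : StepApprox 𝔞 t f') (hf : StepApprox 𝔞 t f) : B f' f = B' f' f := by
  obtain ⟨g', hg', hlim'⟩ := hf'
  obtain ⟨g, hg, hlim⟩ := hf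
  ext η' η
  refine tendsto_nhds_unique (hB.tendsto hg' hg hlim' hlim η' η) ?_
  simp only [h _ (starProd_mem_stepsBefore (hg' _) (hg _))]
  exact hB'.tendsto (fun n => stepsBefore_mono hts (hg' n))
    (fun n => stepsBefore_mono hts (hg n)) hlim' hlim η' η

end IsReconstruction

end ReconstructionProperties

/-! ### The positive submartingale of a family of generating functions -/

section Martingale

variable {E : Type*} [AddCommGroup E] [Module ℂ E] [UniformSpace E] [IsUniformAddGroup E]
  [ContinuousSMul ℂ E] [HilbertScale E] {𝔞 : NonUnitalStarSubalgebra ℂ (HPAlg E)}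
  {D : Type*} [AddCommGroup D] [Module ℂ D] [UniformSpace D] [IsUniformAddGroup D]
  [ContinuousSMul ℂ D] [HilbertScale D] {𝒜 : NonUnitalSubalgebra ℂ (D →L[ℂ] D)}

theorem QForm.ext_coh {Y Z : QForm D E}
    (h : ∀ η' f' η f, Y (coh η' f') (coh η f) = Z (coh η' f') (coh η f)) : Y = Z := by
  refine LinearMap.ext fun ψ' => LinearMap.ext fun ψ => ?_
  rw [eq_sum_coh ψ, eq_sum_coh ψ']
  simp only [Finsupp.sum, map_sum, LinearMap.sum_apply, h]

theorem form_tens (Y : QForm D E) (η : D) (φ : CoherentSpan E) :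
    Y (tens η φ) (tens η φ) = matForm (fun f' f => Y (coh η f') (coh η f)) φ φ := by
  rw [tens_eq_sum, matForm_apply]
  simp only [Finsupp.sum, map_sum, LinearMap.sum_apply, coh_smul, map_smul, LinearMap.map_smulₛₗ,
    LinearMap.smul_apply, smul_eq_mul, Finset.mul_sum]
  rw [Finset.sum_comm]
  exact Finset.sum_congr rfl fun f' _ => Finset.sum_congr rfl fun f _ => by ring

/-- The form with the coherent matrix elements `B` on the range of `mainPart` and the identity on
the range of `restPart`. -/
def recon (P : E →L[ℂ] E) (t : ℝ≥0) (B : NoiseFn E → NoiseFn E → DForm D) : QForm D E :=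
  ofKernel fun f' f => Complex.exp (nForm (restPart P t f') (restPart P t f)) •
    B (mainPart P t f') (mainPart P t f)

theorem recon_coh (P : E →L[ℂ] E) (t : ℝ≥0) (B : NoiseFn E → NoiseFn E → DForm D) (η' η : D)
    (f' f : NoiseFn E) : recon P t B (coh η' f') (coh η f) =
      Complex.exp (nForm (restPart P t f') (restPart P t f)) *
        B (mainPart P t f') (mainPart P t f) η' η := by
  rw [recon, ofKernel_coh, LinearMap.smul_apply, LinearMap.smul_apply, smul_eq_mul]

theorem recon_sub (P : E →L[ℂ] E) (t : ℝ≥0) (B B' : NoiseFn E → NoiseFn E → DForm D) :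
    recon P t B - recon P t B' = recon P t fun f' f => B f' f - B' f' f :=
  QForm.ext_coh fun η' f' η f => by
    simp only [LinearMap.sub_apply, recon_coh, mul_sub]

/-- The case s = t is adaptedness; for t < s it reduces the comparison of ε_t(R_s) with R_t to that
of the two kernels B at the same time t. -/
theorem condExp_recon (P : E →L[ℂ] E) {t s : ℝ≥0} (h : t ≤ s)
    (B : NoiseFn E → NoiseFn E → DForm D) : condExp t (recon P s B) = recon P t B :=
  QForm.ext_coh fun η' f' η f => by
    rw [condExp_coh, recon_coh, recon_coh, mainPart_past P h, mainPart_past P h, ← mul_assoc,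
      ← Complex.exp_add, ← nForm_apply, nForm_restPart_past P h]

variable {P : E →L[ℂ] E} {t : ℝ≥0} {θ : StepFn 𝔞 → DForm D}
  {B : NoiseFn E → NoiseFn E → DForm D}

theorem posKer_rest (P : E →L[ℂ] E) (t : ℝ≥0) :
    PosKer fun f' f : NoiseFn E => Complex.exp (nForm (restPart P t f') (restPart P t f)) :=
  (posKer_of_form nForm_nonneg fun f => restPart P t f).exp

theorem IsCreaProj.qpos_recon (hP : IsCreaProj 𝔞 P)
    (hB : PosKer fun x y : D × {f : NoiseFn E // StepApprox 𝔞 t f} => B x.2.1 y.2.1 x.1 y.1) :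
    QPos (recon P t B) := fun ψ =>
  kerForm_nonneg (((posKer_rest P t).comp Prod.snd).mul
    (hB.comp fun x : D × NoiseFn E => (x.1, ⟨mainPart P t x.2, hP.stepApprox t x.2⟩))) ψ

/-- By Cauchy–Schwarz and the extremality of the projective norm it is enough to bound the form on
vectors η ⊗ φ, which is an inequality of positive kernels. -/
theorem IsCreaProj.qcontinuous_recon (hP : IsCreaProj 𝔞 P) (hB : IsReconstruction t θ B) :
    QContinuous (recon P t B) := by
  have hq : QPos (recon P t B) := hP.qpos_recon
    (hB.posKer.comp fun x : D × {f : NoiseFn E // StepApprox 𝔞 t f} => (x.1, x.2.1))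
  obtain ⟨p, ζ, C, hC, hb⟩ := hB.bound
  obtain ⟨ξ, hξ⟩ := hP.posKer_split ζ
  have hsplit : PosKer fun f' f : NoiseFn E => nFormL ζ (mainPart P t f') (mainPart P t f) +
      nForm (restPart P t f') (restPart P t f) :=
    (posKer_of_form (nFormL_nonneg ζ) fun f => mainPart P t f).add
      (posKer_of_form nForm_nonneg fun f => restPart P t f)
  have hn : ∀ η φ, formNorm (recon P t B) (tens η φ) ≤ C * nrmL p η * fockNorm ξ φ := by
    intro η φ
    set r := (C * nrmL p η) ^ 2 with hr
    have hr0 : 0 ≤ C * nrmL p η := mul_nonneg hC (nrmL_nonneg _ _)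
    -- Telescoping: with m and n the main and rest inner products, r e^⟨·|·⟩(ξ) - e^n B =
    -- r(e^⟨·|·⟩(ξ) - e^(m+n)) + (r e^m - B)e^n, both terms being positive kernels.
    have h1 := ((hsplit.exp_sub_exp (hξ t)).const_mul (sq_nonneg (C * nrmL p η))).add
      (((hb η).comp fun f => ⟨mainPart P t f, hP.stepApprox t f⟩).mul (posKer_rest P t))
    have h2 : PosKer fun f' f : NoiseFn E => (r : ℂ) * fockKer ξ f' f -
        recon P t B (coh η f') (coh η f) := by
      convert h1 using 3 with f' f
      rw [recon_coh, Complex.exp_add, fockKer, fockKer]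
      ring
    have h3 := h2.formNorm_le φ
    have h4 : formNorm (matForm fun f' f => recon P t B (coh η f') (coh η f)) φ =
        formNorm (recon P t B) (tens η φ) := by
      rw [formNorm, formNorm, form_tens]
    have h5 : matForm (fun f' f => (r : ℂ) * fockKer ξ f' f) φ φ = (r : ℂ) * fockForm ξ φ φ := by
      rw [fockForm, matForm_apply, matForm_apply, Finsupp.mul_sum]
      refine Finsupp.sum_congr fun f' _ => ?_
      rw [Finsupp.mul_sum]
      exact Finsupp.sum_congr fun f _ => by ring
    rw [h4] at h3
    refine h3.trans_eq ?_
    rw [fockNorm_eq, formNorm, h5, Complex.re_ofReal_mul, Real.sqrt_mul (sq_nonneg _),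
      Real.sqrt_sq hr0, formNorm]
  refine ⟨p, ξ, C ^ 2, fun ψ' ψ => (norm_form_le hq ψ' ψ).trans ?_⟩
  have hall := formNorm_le_projNorm hq hC hn
  calc _ ≤ (C * projNorm p ξ ψ') * (C * projNorm p ξ ψ) :=
        mul_le_mul (hall ψ') (hall ψ) (formNorm_nonneg _ _)
          (mul_nonneg hC (projNorm_nonneg _ _ _))
    _ = _ := by ring

theorem IsCreaProj.commutesWeyl_recon (hP : IsCreaProj 𝔞 P) (hB : IsReconstruction t θ B)
    (g : StepFn 𝔞) : CommutesWeyl (recon P t B) g := by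
  refine commutesWeyl_iff.2 fun η' f' η f => ?_
  have h1 := hB.weyl (cut_mem_stepsBefore t g) (hP.stepApprox t f') (hP.stepApprox t f) η' η
  have h2 := congrArg Complex.exp (hP.weylExp_rest t g f' f)
  simp only [Complex.exp_add, Complex.exp_conj] at h2
  rw [recon_coh, recon_coh, hP.mainPart_weylShift, hP.mainPart_weylShift, weylFactor_eq,
    weylFactor_eq, ← StepFn.star_cut]
  set x := (starRingEnd ℂ) (Complex.exp (weylExp (star (g.cut t)) (mainPart P t f')))
  set y := Complex.exp (weylExp (g.cut t) (mainPart P t f))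
  have hx : x ≠ 0 := (map_ne_zero _).2 (Complex.exp_ne_zero _)
  have hy : y ≠ 0 := Complex.exp_ne_zero _
  -- The exponents of the cut functions stand on opposite sides of the balance `h2`; multiplying by
  -- both, which are nonzero, avoids divisions.
  refine mul_left_cancel₀ hx (mul_left_cancel₀ hy ?_)
  linear_combination y * B (mainPart P t f') (weylShift (g.cut t) (mainPart P t f)) η' η * h2 +
    y * (starRingEnd ℂ) (Complex.exp (weylExp (star g) f')) *
      Complex.exp (nForm (restPart P t (weylShift (star g) f')) (restPart P t f)) * h1

theorem IsCreaProj.recon_mem_filtration (hP : IsCreaProj 𝔞 P) (hB : IsReconstruction t θ B)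
    (hθ : ∀ g ∈ stepsBefore 𝔞 t, θ g ∈ commutant 𝒜) : recon P t B ∈ filtration 𝒜 𝔞 t := by
  refine ⟨⟨hP.qcontinuous_recon hB, fun A hA A' hA' hAA' ψ' ψ => ?_, fun r a _ ψ' ψ => ?_⟩,
    condExp_recon P le_rfl B⟩
  · rw [eq_sum_coh ψ, eq_sum_coh ψ']
    simp only [Finsupp.sum, map_sum, LinearMap.sum_apply, ampl_coh, recon_coh]
    refine Finset.sum_congr rfl fun f _ => Finset.sum_congr rfl fun f' _ => ?_
    rw [hB.commutes (fun g hg => (hθ g hg).2 A hA A' hA' hAA') (hP.stepApprox t _)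
      (hP.stepApprox t _)]
  · rw [hP.commutesWeyl_recon hB, StepFn.star_const]

theorem IsCreaProj.genFun_recon (hP : IsCreaProj 𝔞 P) (hB : IsReconstruction t θ B)
    {g : StepFn 𝔞} (hg : g ∈ stepsBefore 𝔞 t) : genFun (recon P t B) g = θ g := by
  ext η' η
  -- The left vector is the vacuum, whose rest part is zero, so the identity factor is 1.
  rw [genFun_apply, weyl_vacuum, map_smul, recon_coh, hP.mainPart_creaFn hg, map_zero, map_zero,
    map_zero, LinearMap.zero_apply, Complex.exp_zero, one_mul, hB.apply_creaFn hg, weylFactor_eq, smul_eq_mul,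
    ← mul_assoc, ← Complex.exp_add, add_neg_cancel, Complex.exp_zero, one_mul]

theorem recon_zero (P : E →L[ℂ] E) (hB : IsReconstruction 0 θ B) (h0 : θ 0 = ipForm D) :
    recon P 0 B = idForm D E :=
  QForm.ext_coh fun η' f' η f => by
    have h := hB.apply_creaFn (zero_mem_stepsBefore 0) η' η
    rw [creaFn_zero, weylExp_zero_left, neg_zero, Complex.exp_zero, one_mul, h0] at h
    rw [recon_coh, mainPart_zero_time, mainPart_zero_time, restPart_zero_time, restPart_zero_time,
      h, idForm, ofKernel_coh]
    rfl

/-! ### Families of generating functions over all times -/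

section Families

variable {ϑ : ℝ≥0 → StepFn 𝔞 → DForm D}

theorem absContOn_congr {θ' : StepFn 𝔞 → DForm D} (h : ∀ g ∈ stepsBefore 𝔞 t, θ g = θ' g)
    (hθ : AbsContOn t θ') : AbsContOn t θ := fun η hη hlim => by
  refine (hθ η hη hlim).congr fun n => ?_
  refine Finsupp.sum_congr fun g hg => Finsupp.sum_congr fun k hk => ?_
  rw [h _ (starProd_mem_stepsBefore (hη n g hg) (hη n k hk))]

theorem absContOn_of_genFun {R : ℝ≥0 → QForm D E} (hR : ∀ t, R t ∈ filtration 𝒜 𝔞 t)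
    (h : ∀ t, ∀ g ∈ stepsBefore 𝔞 t, ϑ t g = genFun (R t) g) (t : ℝ≥0) : AbsContOn t (ϑ t) :=
  absContOn_congr (h t) (absContOn_genFun (hR t).1 t)

theorem exists_reconstructions (hϑ : IsPosDefFamily 𝒜 ϑ) (habs : ∀ t, AbsContOn t (ϑ t)) :
    ∃ B : ℝ≥0 → NoiseFn E → NoiseFn E → DForm D, ∀ t, IsReconstruction t (ϑ t) (B t) := by
  choose B hB using fun t => exists_reconstruction (hϑ.2.1 t) (habs t)
  exact ⟨B, hB⟩

/-- The forms are reconstructed at each time separately. Since R_t - ε_t(R_s) is `recon` at time t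
of B_t - B_s, its positivity is that of the difference kernel on the test functions approximable at
time t. -/
theorem exists_submartingale (hP : NoiseComplemented 𝔞) (hϑ : IsPosDefFamily 𝒜 ϑ)
    (hmono : ∀ t s, t ≤ s → PosDefOn t fun g => ϑ t g - ϑ s g)
    (habs : ∀ t, AbsContOn t (ϑ t)) : ∃ R : ℝ≥0 → QForm D E, IsPosSubmartingale 𝒜 𝔞 R ∧
      R 0 = idForm D E ∧ ∀ t, ∀ g ∈ stepsBefore 𝔞 t, ϑ t g = genFun (R t) g := by
  obtain ⟨P, hP⟩ := hP.exists_isCreaProj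
  obtain ⟨B, hB⟩ := exists_reconstructions hϑ habs
  refine ⟨fun t => recon P t (B t), ⟨fun t => hP.recon_mem_filtration (hB t) (hϑ.1 t),
    fun t => hP.qpos_recon ((hB t).posKer.comp
      fun x : D × {f : NoiseFn E // StepApprox 𝔞 t f} => (x.1, x.2.1)), fun t s h => ?_⟩,
    recon_zero P (hB 0) hϑ.2.2, fun t g hg => (hP.genFun_recon (hB t) hg).symm⟩
  rw [QLe, condExp_recon P h, recon_sub]
  exact hP.qpos_recon ((hB t).posKer_sub h (hB s) (hmono t s h))

theorem exists_martingale (hP : NoiseComplemented 𝔞) (hϑ : IsPosDefFamily 𝒜 ϑ)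
    (heq : ∀ t s, t ≤ s → ∀ g ∈ stepsBefore 𝔞 t, ϑ t g = ϑ s g)
    (habs : ∀ t, AbsContOn t (ϑ t)) : ∃ R : ℝ≥0 → QForm D E, IsPosMartingale 𝒜 𝔞 R ∧
      R 0 = idForm D E ∧ ∀ t, ∀ g ∈ stepsBefore 𝔞 t, ϑ t g = genFun (R t) g := by
  obtain ⟨P, hP⟩ := hP.exists_isCreaProj
  obtain ⟨B, hB⟩ := exists_reconstructions hϑ habs
  refine ⟨fun t => recon P t (B t), ⟨fun t => hP.recon_mem_filtration (hB t) (hϑ.1 t),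
    fun t => hP.qpos_recon ((hB t).posKer.comp
      fun x : D × {f : NoiseFn E // StepApprox 𝔞 t f} => (x.1, x.2.1)), fun t s h => ?_⟩,
    recon_zero P (hB 0) hϑ.2.2, fun t g hg => (hP.genFun_recon (hB t) hg).symm⟩
  rw [condExp_recon P h]
  refine QForm.ext_coh fun η' f' η f => ?_
  rw [recon_coh, recon_coh,
    (hB t).eq_of_eqOn h (hB s) (heq t s h) (hP.stepApprox t f') (hP.stepApprox t f)]

end Families

end Martingale

end QFlow

end

theorem mainTheorem5 {D E : Type*}
    [AddCommGroup D] [Module ℂ D] [UniformSpace D] [IsUniformAddGroup D] [ContinuousSMul ℂ D]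
    [CompleteSpace D] [QFlow.HilbertScale D]
    [AddCommGroup E] [Module ℂ E] [UniformSpace E] [IsUniformAddGroup E] [ContinuousSMul ℂ E]
    [CompleteSpace E] [QFlow.HilbertScale E]
    (𝒜 : NonUnitalSubalgebra ℂ (D →L[ℂ] D))
    (h𝒜 : ∀ A ∈ 𝒜, ∃ A' ∈ 𝒜, QFlow.IsAdj A A')
    (𝔞 : NonUnitalStarSubalgebra ℂ (QFlow.HPAlg E)) :
    -- the generating functions of a positive submartingale
    (∀ R : ℝ≥0 → QFlow.QForm D E, QFlow.IsPosSubmartingale 𝒜 𝔞 R →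
      (∀ t, ∀ g ∈ QFlow.stepsBefore 𝔞 t, QFlow.genFun (R t) g ∈ QFlow.commutant 𝒜) ∧
      (∀ t, QFlow.PosDefOn (𝔞 := 𝔞) t (QFlow.genFun (R t))) ∧
      (∀ t s, t ≤ s → QFlow.PosDefOn (𝔞 := 𝔞) t
        (fun g => QFlow.genFun (R t) g - QFlow.genFun (R s) g)) ∧
      (R 0 = QFlow.idForm D E →
        QFlow.genFun (R 0) (0 : QFlow.StepFn 𝔞) = QFlow.ipForm D ∧
        ∀ t η, QFlow.genFun (R t) (0 : QFlow.StepFn 𝔞) η η ≤ QFlow.ip η η) ∧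
      (∀ t, QFlow.AbsContOn (𝔞 := 𝔞) t (QFlow.genFun (R t)))) ∧
    -- the generating functions of a positive martingale
    (∀ R : ℝ≥0 → QFlow.QForm D E, QFlow.IsPosMartingale 𝒜 𝔞 R →
      (∀ t s, t ≤ s → ∀ g ∈ QFlow.stepsBefore 𝔞 t,
        QFlow.genFun (R t) g = QFlow.genFun (R s) g) ∧
      (R 0 = QFlow.idForm D E →
        ∀ t, QFlow.genFun (R t) (0 : QFlow.StepFn 𝔞) = QFlow.ipForm D)) ∧
    -- the characterization of the generating functions
    (QFlow.NoiseComplemented 𝔞 → ∀ ϑ : ℝ≥0 → QFlow.StepFn 𝔞 → QFlow.DForm D,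
      QFlow.IsPosDefFamily 𝒜 ϑ →
      ((∀ t s, t ≤ s → QFlow.PosDefOn t (fun g => ϑ t g - ϑ s g)) →
        ((∃ R : ℝ≥0 → QFlow.QForm D E, QFlow.IsPosSubmartingale 𝒜 𝔞 R ∧
            R 0 = QFlow.idForm D E ∧
            ∀ t, ∀ g ∈ QFlow.stepsBefore 𝔞 t, ϑ t g = QFlow.genFun (R t) g) ↔
          ∀ t, QFlow.AbsContOn t (ϑ t))) ∧
      ((∀ t s, t ≤ s → ∀ g ∈ QFlow.stepsBefore 𝔞 t, ϑ t g = ϑ s g) →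
        ((∃ R : ℝ≥0 → QFlow.QForm D E, QFlow.IsPosMartingale 𝒜 𝔞 R ∧
            R 0 = QFlow.idForm D E ∧
            ∀ t, ∀ g ∈ QFlow.stepsBefore 𝔞 t, ϑ t g = QFlow.genFun (R t) g) ↔
          ∀ t, QFlow.AbsContOn t (ϑ t)))) := by
  refine ⟨fun R hR => ⟨fun t g _ => QFlow.genFun_mem_commutant (hR.1 t).1 g,
    fun t => QFlow.posDefOn_genFun (hR.1 t).1 (hR.2.1 t) t,
    fun t s h => QFlow.posDefOn_genFun_sub (hR.1 t).1 (hR.1 s).1 (hR.2.2 t s h),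
    fun h0 => ⟨by rw [h0, QFlow.genFun_idForm_zero], fun t η => QFlow.genFun_zero_le hR h0 t η⟩,
    fun t => QFlow.absContOn_genFun (hR.1 t).1 t⟩, fun R hR => ?_, fun hP ϑ hϑ =>
    ⟨fun hmono => ⟨fun ⟨R, hR, _, h⟩ => QFlow.absContOn_of_genFun hR.1 h,
      QFlow.exists_submartingale hP hϑ hmono⟩,
    fun heq => ⟨fun ⟨R, hR, _, h⟩ => QFlow.absContOn_of_genFun hR.1 h,
      QFlow.exists_martingale hP hϑ heq⟩⟩⟩
  have heq : ∀ t s, t ≤ s → ∀ g ∈ QFlow.stepsBefore 𝔞 t,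
      QFlow.genFun (R t) g = QFlow.genFun (R s) g := fun t s h g hg => by
    rw [← hR.2.2 t s h, QFlow.genFun_condExp _ hg]
  refine ⟨heq, fun h0 t => ?_⟩
  -- The zero function belongs to 𝔤_0, so its value at time t is already determined at time 0.
  rw [← heq 0 t zero_le 0 (QFlow.zero_mem_stepsBefore 0), h0, QFlow.genFun_idForm_zero]
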